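/- Let $M$ be a smooth supermanifold with local coordinates $x^a$ of parity $\tilde a$. Let $\Pi TM$ and $\Pi T^*M$ be its tangent and cotangent bundles with reversed parity. Their fibre coordinates $dx^a$ and $x^*_a$ have parity $\tilde a+1$ and transform by $dx^a=dx^{a'}\frac{\partial x^a}{\partial x^{a'}}$ and $x^*_a=\frac{\partial x^{a'}}{\partial x^a}x^*_{a'}$. Let $U\subseteq \Pi T^*M$ and $V\subseteq\Pi TM$ be open (for example the whole total spaces, or neighbourhoods of the zero sections). All derivatives are left derivatives and summation over repeated indices is understood. For an even function $P\in C^\infty(U)$ (an even multivector field), the formulas $$\varphi_P^*(x^a)=x^a,\qquad \varphi_P^*(dx^a)=(-1)^{\tilde a+1}\frac{\partial P}{\partial x^*_a}$$ give a well-defined map $\varphi_P\colon U\to\Pi TM$ over $\mathrm{id}_M$. For an even function $\omega\in C^\infty(V)$ (an even form), the formulas $$\psi_\omega^*(x^a)=x^a,\qquad \psi_\omega^*(x^*_a)=\frac{\partial\omega}{\partial dx^a}$$ give a well-defined map $\psi_\omega\colon V\to\Pi T^*M$ over $\mathrm{id}_M$. 1. Let $P\in C^\infty(U)$ be even and such that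 $\varphi_P$ is a diffeomorphism of $U$ onto $V$. Then there is a unique $\omega\in C^\infty(V)$ with $\varphi_P^*\omega=x^*_a\frac{\partial P}{\partial x^*_a}-P$, called the fibrewise Legendre transform of $P$. It is even, and $\varphi_P^{-1}=\psi_\omega$. Moreover $P$ is recovered as the fibrewise Legendre transform of $\omega$: it is the unique function on $U$ with $\psi_\omega^*P=dx^a\frac{\partial\omega}{\partial dx^a}-\omega$. 2. The Legendre transforms are mutually inverse bijections between the following two sets: - the non-degenerate higher Poisson multivector fields, i.e. the even $P\in C^\infty(U)$ with $[P,P]=0$ (canonical Schouten bracket) for which $\varphi_P$ is a diffeomorphism of $U$ onto $V$; - the generalized symplectic forms, i.e. the even $\omega\in C^\infty(V)$ with $d\omega=0$, where $d=dx^a\frac{\partial}{\partial x^a}$, for which $\psi_\omega$ is a diffeomorphism of $V$ onto $U$. -/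

import Mathlib

open scoped ContDiff

noncomputable section

namespace SuperGeom

universe u v

/-! ### Grassmann algebras and superfunctions -/

/-- The real Grassmann algebra on odd generators indexed by `κ`. -/
abbrev Gr (κ : Type*) := ExteriorAlgebra ℝ (κ → ℝ)

instance grFinite (κ : Type*) [Finite κ] : Module.Finite ℝ (Gr κ) := by
  have := Fintype.ofFinite κ
  let _ : LinearOrder κ := LinearOrder.lift' _ (Fintype.equivFin κ).injective
  exact Module.Finite.of_basis (Pi.basisFun ℝ κ).ExteriorAlgebra

/-- Linear coordinates on the finite-dimensional space `Gr κ`. -/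
def grCoord (κ : Type*) [Finite κ] :
    Gr κ ≃ₗ[ℝ] (Fin (Module.finrank ℝ (Gr κ)) → ℝ) :=
  (Module.finBasis ℝ (Gr κ)).equivFun

/-- A norm on `Gr κ` (all norms on it are equivalent); it is only used to speak of smooth
`Gr κ`-valued functions and their derivatives. -/
instance grNormed (κ : Type*) [Finite κ] : NormedAddCommGroup (Gr κ) :=
  NormedAddCommGroup.induced (Gr κ) (Fin (Module.finrank ℝ (Gr κ)) → ℝ) (grCoord κ)
    (grCoord κ).injective

instance grNormedSpace (κ : Type*) [Finite κ] : NormedSpace ℝ (Gr κ) :=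
  NormedSpace.induced ℝ (Gr κ) (Fin (Module.finrank ℝ (Gr κ)) → ℝ) (grCoord κ)

/-- The parity involution: `+1` on even and `-1` on odd elements. -/
def parityInv {κ : Type*} : Gr κ →ₐ[ℝ] Gr κ := CliffordAlgebra.involute

/-- The body (the part of degree zero) of an element of the Grassmann algebra. -/
def body {κ : Type*} : Gr κ →ₐ[ℝ] ℝ := ExteriorAlgebra.algebraMapInv

/-- Functions on `ℝ^{ι|κ}`, that is, functions of the even coordinates with values in the
Grassmann algebra generated by the odd coordinates. Smoothness is imposed separately, on open
sets. A coordinate index is an element of `ι ⊕ κ`: `inl` for even, `inr` for odd. -/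
abbrev SF (ι κ : Type*) := (ι → ℝ) → Gr κ

section Calculus

variable {ι κ ι' κ' : Type*} [Fintype ι] [DecidableEq ι] [Fintype κ] [DecidableEq κ]
  [Fintype ι'] [DecidableEq ι'] [Fintype κ'] [DecidableEq κ']

/-- The parity of a coordinate. -/
def par : ι ⊕ κ → ℕ
  | Sum.inl _ => 0
  | Sum.inr _ => 1

/-- The coordinate functions of `ℝ^{ι|κ}`. -/
def coord : ι ⊕ κ → SF ι κ
  | Sum.inl i => fun x => algebraMap ℝ (Gr κ) (x i)
  | Sum.inr j => fun _ => ExteriorAlgebra.ι ℝ (Pi.single j 1)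

/-- Partial derivatives; for odd coordinates these are left derivatives. -/
def pd : ι ⊕ κ → SF ι κ → SF ι κ
  | Sum.inl i => fun f x => fderiv ℝ f x (Pi.single i 1)
  | Sum.inr j => fun f x =>
      CliffordAlgebra.contractLeft (Q := (0 : QuadraticForm ℝ (κ → ℝ))) (LinearMap.proj j) (f x)

/-- The linear map `v ↦ ∑ j, v j • η j`. -/
def oddComb (η : κ' → Gr κ) : (κ' → ℝ) →ₗ[ℝ] Gr κ := Fintype.linearCombination ℝ η

open Classical in
/-- Substitution of elements `η j` for the odd generators. It is the algebra homomorphism with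
these values on the generators; the condition for its existence holds whenever all `η j` are
odd. -/
def oddSubst (η : κ' → Gr κ) : Gr κ' →ₗ[ℝ] Gr κ :=
  if h : ∀ v, oddComb η v * oddComb η v = 0 then
    (ExteriorAlgebra.lift ℝ ⟨oddComb η, h⟩).toLinearMap
  else 0

/-- The derivative `∑ b, n b * ∂g/∂y^b` of a `Gr κ`-valued function of real variables along a
vector with coefficients in `Gr κ`. -/
def dirDeriv (n : ι' → Gr κ) (g : (ι' → ℝ) → Gr κ) : (ι' → ℝ) → Gr κ :=
  fun y => ∑ b, n b * fderiv ℝ g y (Pi.single b 1)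

/-- The Taylor expansion of `g` at a real point `y` with nilpotent increment `n`. For even
nilpotent `n` all terms of order above `card κ` vanish. -/
def taylor (n : ι' → Gr κ) (g : (ι' → ℝ) → Gr κ) (y : ι' → ℝ) : Gr κ :=
  ∑ k ∈ Finset.range (Fintype.card κ + 1), ((k.factorial : ℝ)⁻¹) • ((dirDeriv n)^[k] g) y

/-- The map of underlying real points of the map with coordinate expressions `F`. -/
def bodyMap (F : ι' ⊕ κ' → SF ι κ) (x : ι → ℝ) : ι' → ℝ := fun b => body (F (Sum.inl b) x)

/-- The pullback `F^* f`: substitution of the functions `F c` for the coordinates of `f`. -/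
def pull (F : ι' ⊕ κ' → SF ι κ) (f : SF ι' κ') : SF ι κ := fun x =>
  taylor (fun b => F (Sum.inl b) x - algebraMap ℝ (Gr κ) (body (F (Sum.inl b) x)))
    (fun y => oddSubst (fun j => F (Sum.inr j) x) (f y)) (bodyMap F x)

/-- `F` is the coordinate expression of a morphism of superdomains from `U` to `V`. -/
structure IsSuperMap (U : Set (ι → ℝ)) (V : Set (ι' → ℝ)) (F : ι' ⊕ κ' → SF ι κ) : Prop where
  smooth : ∀ c, ContDiffOn ℝ ∞ (F c) U
  parity : ∀ c, ∀ x ∈ U, parityInv (F c x) = (-1 : ℝ) ^ par c • F c x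
  mapsTo : Set.MapsTo (bodyMap F) U V

end Calculus

/-! ### Supermanifolds, open subsets, functions and maps in charts -/

/-- Raw gluing data: superdomains `dom i`, their parts `ov i j` overlapping with the `j`-th
one, and the coordinates `tr i j c` of the `j`-th superdomain written in those of the `i`-th. -/
structure Gluing (I : Type*) (ι κ : Type*) where
  dom : I → Set (ι → ℝ)
  ov : I → I → Set (ι → ℝ)
  tr : I → I → ι ⊕ κ → SF ι κ

section Glue

variable {I ι κ : Type*} [Fintype ι] [DecidableEq ι] [Fintype κ] [DecidableEq κ]

/-- The sets `U i` are the chart pictures of one open subset. -/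
structure Gluing.IsOpenSub (N : Gluing I ι κ) (U : I → Set (ι → ℝ)) : Prop where
  isOpen : ∀ i, IsOpen (U i)
  subset : ∀ i, U i ⊆ N.dom i
  compat : ∀ i j, ∀ z ∈ N.ov i j, z ∈ U i ↔ bodyMap (N.tr i j) z ∈ U j

/-- Smooth functions on the open subset `U`: families of smooth superfunctions in the charts,
compatible with the changes of coordinates. The values outside `U i` carry no information and
are normalized to zero. -/
@[ext]
structure SuperFn (N : Gluing I ι κ) (U : I → Set (ι → ℝ)) where
  fn : I → SF ι κ
  smooth : ∀ i, ContDiffOn ℝ ∞ (fn i) (U i)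
  compat : ∀ i j, ∀ z ∈ U i ∩ N.ov i j, pull (N.tr i j) (fn j) z = fn i z
  zero_outside : ∀ i, ∀ z ∉ U i, fn i z = 0

/-- Even functions. -/
def SuperFn.IsEven {N : Gluing I ι κ} {U : I → Set (ι → ℝ)} (f : SuperFn N U) : Prop :=
  ∀ i z, parityInv (f.fn i z) = f.fn i z

end Glue

set_option linter.checkUnivs false in
/-- A (smooth, real) supermanifold of dimension `ι|κ`: a Hausdorff second countable space with
an atlas whose changes of coordinates are morphisms of superdomains that induce the changes of
coordinates of the underlying space and satisfy the cocycle condition. -/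
structure Supermanifold (ι κ : Type*) [Fintype ι] [DecidableEq ι] [Fintype κ]
    [DecidableEq κ] where
  X : Type u
  [top : TopologicalSpace X]
  [t2 : T2Space X]
  [secondCountable : SecondCountableTopology X]
  I : Type v
  chart : I → OpenPartialHomeomorph X (ι → ℝ)
  cover : ∀ x, ∃ i, x ∈ (chart i).source
  tr : I → I → ι ⊕ κ → SF ι κ
  tr_map : ∀ i j, IsSuperMap ((chart i).symm.trans (chart j)).source
    ((chart j).symm.trans (chart i)).source (tr i j)
  tr_body : ∀ i j, ∀ x ∈ ((chart i).symm.trans (chart j)).source,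
    bodyMap (tr i j) x = chart j ((chart i).symm x)
  tr_self : ∀ i, ∀ x ∈ (chart i).target, ∀ c, tr i i c x = coord c x
  tr_comp : ∀ i j k, ∀ x ∈ ((chart i).symm.trans (chart j)).source ∩
    ((chart i).symm.trans (chart k)).source, ∀ c, pull (tr i j) (tr j k c) x = tr i k c x

attribute [instance] Supermanifold.top Supermanifold.t2 Supermanifold.secondCountable

section Bundles

variable {ι κ : Type*} [Fintype ι] [DecidableEq ι] [Fintype κ] [DecidableEq κ]

/-- Indices of the coordinates `x^a` on the total space of `ΠTM` or `ΠT^*M`. The even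
coordinates there are the even `x^a` and the fibre coordinates for odd `a`; the odd coordinates
are the odd `x^a` and the fibre coordinates for even `a`. -/
def bas : ι ⊕ κ → (ι ⊕ κ) ⊕ (κ ⊕ ι)
  | Sum.inl i => Sum.inl (Sum.inl i)
  | Sum.inr j => Sum.inr (Sum.inl j)

/-- Indices of the fibre coordinates `dx^a` on `ΠTM`, or `x^*_a` on `ΠT^*M`; their parity is
opposite to that of `x^a`. -/
def fib : ι ⊕ κ → (ι ⊕ κ) ⊕ (κ ⊕ ι)
  | Sum.inl i => Sum.inr (Sum.inr i)
  | Sum.inr j => Sum.inl (Sum.inr j)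

/-- The map to `ΠTM` or `ΠT^*M` with given coordinate expressions for base and fibre. -/
def joint {S : Type*} (f g : ι ⊕ κ → S) : (ι ⊕ κ) ⊕ (κ ⊕ ι) → S
  | Sum.inl (Sum.inl i) => f (Sum.inl i)
  | Sum.inl (Sum.inr j) => g (Sum.inr j)
  | Sum.inr (Sum.inl j) => f (Sum.inr j)
  | Sum.inr (Sum.inr i) => g (Sum.inl i)

/-- Functions on the total spaces of `ΠTM` and `ΠT^*M` in a chart. -/
abbrev SFTot (ι κ : Type*) := SF (ι ⊕ κ) (κ ⊕ ι)

/-- Pullback of a function from the base to the total space along the bundle projection. -/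
def lift (f : SF ι κ) : SFTot ι κ := pull (fun a => (coord (bas a) : SFTot ι κ)) f

/-- The part of the total space over a subset of the base. -/
def overSet (D : Set (ι → ℝ)) : Set (ι ⊕ κ → ℝ) := {z | (fun i => z (Sum.inl i)) ∈ D}

variable (M : Supermanifold.{u, v} ι κ)

/-- The domain of the change of coordinates from the `i`-th to the `j`-th chart. -/
def Supermanifold.ov (i j : M.I) : Set (ι → ℝ) := ((M.chart i).symm.trans (M.chart j)).source

/-- The odd tangent bundle `ΠTM`, with coordinates `x^a`, `dx^a` and the transformation law
`dx^b = ∑ a, dx^a * ∂x^b/∂x^a`. -/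
def Supermanifold.PiT : Gluing M.I (ι ⊕ κ) (κ ⊕ ι) where
  dom i := overSet (M.chart i).target
  ov i j := overSet (M.ov i j)
  tr i j := joint (fun b => lift (M.tr i j b))
    (fun b => ∑ a, coord (fib a) * lift (pd a (M.tr i j b)))

/-- The odd cotangent bundle `ΠT^*M`, with coordinates `x^a`, `x^*_a`. The new fibre coordinate
`x^*_b` is `∑ a, (∂x^a/∂x^b) * x^*_a`, where the derivatives of the old coordinates by the new
ones are expressed in the old coordinates. -/
def Supermanifold.PiTstar : Gluing M.I (ι ⊕ κ) (κ ⊕ ι) where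
  dom i := overSet (M.chart i).target
  ov i j := overSet (M.ov i j)
  tr i j := joint (fun b => lift (M.tr i j b))
    (fun b => ∑ a, lift (pull (M.tr i j) (pd b (M.tr j i a))) * coord (fib a))

/-- The family `F` of maps written in charts is a morphism over the identity of the base from the
open subset `U` of one bundle to the open subset `V` of another. -/
structure IsBundleMap {I : Type*} (N N' : Gluing I (ι ⊕ κ) (κ ⊕ ι))
    (U V : I → Set (ι ⊕ κ → ℝ)) (F : I → (ι ⊕ κ) ⊕ (κ ⊕ ι) → SFTot ι κ) : Prop where
  isSuperMap : ∀ i, IsSuperMap (U i) (V i) (F i)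
  base : ∀ i, ∀ z ∈ U i, ∀ a, F i (bas a) z = coord (bas a) z
  compat : ∀ i j, ∀ z ∈ U i ∩ N.ov i j, ∀ c,
    pull (N.tr i j) (F j c) z = pull (F i) (N'.tr i j c) z

/-- `F : U → V` and `G : V → U` are inverse to each other. -/
def AreInverse {I : Type*} (U V : I → Set (ι ⊕ κ → ℝ))
    (F G : I → (ι ⊕ κ) ⊕ (κ ⊕ ι) → SFTot ι κ) : Prop :=
  (∀ i, ∀ z ∈ U i, ∀ c, pull (F i) (G i c) z = coord c z) ∧
  (∀ i, ∀ z ∈ V i, ∀ c, pull (G i) (F i c) z = coord c z)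

/-- `F` is a diffeomorphism of `U` onto `V` over the identity of the base. -/
def IsDiffeo {I : Type*} (N N' : Gluing I (ι ⊕ κ) (κ ⊕ ι))
    (U V : I → Set (ι ⊕ κ → ℝ)) (F : I → (ι ⊕ κ) ⊕ (κ ⊕ ι) → SFTot ι κ) : Prop :=
  IsBundleMap N N' U V F ∧ ∃ G, IsBundleMap N' N V U G ∧ AreInverse U V F G

/-! ### The maps `φ_P` and `ψ_ω`, Legendre transforms, differentials and brackets -/

/-- `φ_P^* x^a = x^a`, `φ_P^* dx^a = (-1)^{ã+1} ∂P/∂x^*_a`. -/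
def phi (P : SFTot ι κ) : (ι ⊕ κ) ⊕ (κ ⊕ ι) → SFTot ι κ :=
  joint (fun a => coord (bas a)) (fun a => (-1 : ℝ) ^ (par a + 1) • pd (fib a) P)

/-- `ψ_ω^* x^a = x^a`, `ψ_ω^* x^*_a = ∂ω/∂dx^a`. -/
def psi (w : SFTot ι κ) : (ι ⊕ κ) ⊕ (κ ⊕ ι) → SFTot ι κ :=
  joint (fun a => coord (bas a)) (fun a => pd (fib a) w)

/-- The fibrewise Euler vector field. -/
def euler (f : SFTot ι κ) : SFTot ι κ := ∑ a, coord (fib a) * pd (fib a) f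

/-- The de Rham differential `∑ a, dx^a * ∂/∂x^a`. -/
def deRham (w : SFTot ι κ) : SFTot ι κ := ∑ a, coord (fib a) * pd (bas a) w

/-- The operator `f ↦ (-1)^{f̃+1} f`. -/
def signTwist (f : SFTot ι κ) : SFTot ι κ := fun z => -parityInv (f z)

/-- The canonical Schouten bracket of multivector fields,
`∑ a, ((-1)^{(P̃+1)(ã+1)} ∂P/∂x^*_a ∂Q/∂x^a - (-1)^{(P̃+1)ã} ∂P/∂x^a ∂Q/∂x^*_a)`. -/
def schouten (P Q : SFTot ι κ) : SFTot ι κ :=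
  ∑ a, (pd (fib a) (signTwist^[par a + 1] P) * pd (bas a) Q
    - pd (bas a) (signTwist^[par a] P) * pd (fib a) Q)

variable {M} {U V : M.I → Set (ι ⊕ κ → ℝ)}

/-- `w` is the fibrewise Legendre transform of `P`: `φ_P^* w = ∑ a, x^*_a ∂P/∂x^*_a - P`. -/
def IsLegendreOfMult (P : SuperFn M.PiTstar U) (w : SuperFn M.PiT V) : Prop :=
  ∀ i, ∀ z ∈ U i, pull (phi (P.fn i)) (w.fn i) z = euler (P.fn i) z - P.fn i z

/-- `P` is the fibrewise Legendre transform of `w`: `ψ_w^* P = ∑ a, dx^a ∂w/∂dx^a - w`. -/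
def IsLegendreOfForm (w : SuperFn M.PiT V) (P : SuperFn M.PiTstar U) : Prop :=
  ∀ i, ∀ z ∈ V i, pull (psi (w.fn i)) (P.fn i) z = euler (w.fn i) z - w.fn i z

variable (M U V)

/-- Higher Poisson structures on `U ⊆ ΠT^*M` for which `φ_P` is a diffeomorphism onto `V`. -/
def NondegPoisson : Set (SuperFn M.PiTstar U) :=
  {P | P.IsEven ∧ (∀ i, ∀ z ∈ U i, schouten (P.fn i) (P.fn i) z = 0) ∧
    IsDiffeo M.PiTstar M.PiT U V (fun i => phi (P.fn i))}

/-- Generalized symplectic forms on `V ⊆ ΠTM`, with `ψ_ω` a diffeomorphism onto `U`. -/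
def GenSymplectic : Set (SuperFn M.PiT V) :=
  {w | w.IsEven ∧ (∀ i, ∀ z ∈ V i, deRham (w.fn i) z = 0) ∧
    IsDiffeo M.PiT M.PiTstar V U (fun i => psi (w.fn i))}

end Bundles

end SuperGeom

end

open SuperGeom

set_option linter.unusedSectionVars false

noncomputable section

namespace SuperGeom

universe u v

/-! ### Grassmann algebra -/

section Grassmann

variable {κ κ' : Type*}

/-! Write φ for φ_P, E for the fibrewise Euler field, and suppose φ^*ω = EP - P. Apply ∂/∂x^*_b. The
terms ∂P/∂x^*_b cancel on the right, and the chain rule turns what remains into the statement that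
the vertical Jacobian of φ annihilates the family φ^*(∂ω/∂dx^a) - x^*_a. This Jacobian has a left
inverse because φ has an inverse over the identity, so φ^*(∂ω/∂dx^a) = x^*_a, which says ψ_ω =
φ^{-1} (`pull_pd_fib_legendre`, `IsLegendre.leg_eq`). Differentiating along the base then gives
φ^*(∂ω/∂x^a) = -∂P/∂x^a (`pull_pd_bas_legendre`).

The rest is substitution. φ^*(Eω - ω) = P, so the transform is involutive
(`pull_euler_sub_legendre`). Also φ^*(dω) = -½[P, P] (`two_smul_pull_deRham`), so ω is closed
exactly when P is Poisson, pullback along a diffeomorphism being injective. Both directions are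
handled at once by the maps `leg s P` with signs s, s² = 1: passing to the transform replaces s by
s·sgn, which exchanges the signs of φ and ψ.

Globally ω is defined as (φ^{-1})^*(EP - P). It does not depend on the chart because the fibre
coordinates transform linearly, so that E is invariant (`IsFibLinear.euler_pull`). That φ_P and ψ_ω
are maps of bundles is the chain rule together with the inverse relation between the two Jacobians.

All this rests on pullback of superfunctions, a Taylor expansion in nilpotent increments, being
multiplicative (`taylor_mul`), functorial (`pull_pull`) and subject to the chain rule (`pd_pull`).
The last two follow from one principle, `eq_zero_of_nilpotent`: the defect of the identity vanishes
on constants and turns a factor x^b - y^b into a nilpotent factor, so iterating Hadamard's lemma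
puts it in every power of the nilpotent ideal, and high powers are zero. -/

theorem gr_induction {C : Gr κ → Prop} (hr : ∀ r : ℝ, C (algebraMap ℝ (Gr κ) r))
    (hadd : ∀ x y, C x → C y → C (x + y))
    (hmul : ∀ v x, C x → C (ExteriorAlgebra.ι ℝ v * x)) (x : Gr κ) : C x :=
  CliffordAlgebra.left_induction (0 : QuadraticForm ℝ (κ → ℝ)) hr hadd (fun x v h => hmul v x h) x

@[simp] theorem parityInv_ι (v : κ → ℝ) :
    parityInv (ExteriorAlgebra.ι ℝ v) = -ExteriorAlgebra.ι ℝ v :=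
  CliffordAlgebra.involute_ι v

@[simp] theorem parityInv_parityInv (x : Gr κ) : parityInv (parityInv x) = x :=
  CliffordAlgebra.involute_involute x

@[simp] theorem body_ι (v : κ → ℝ) : body (ExteriorAlgebra.ι ℝ v) = 0 := by
  simp [body, ExteriorAlgebra.algebraMapInv]

@[simp] theorem body_algebraMap (r : ℝ) : body (algebraMap ℝ (Gr κ) r) = r :=
  body.commutes r

@[simp] theorem parityInv_algebraMap (r : ℝ) :
    parityInv (algebraMap ℝ (Gr κ) r) = algebraMap ℝ (Gr κ) r :=
  parityInv.commutes r

@[simp] theorem body_parityInv (x : Gr κ) : body (parityInv x) = body x := by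
  induction x using gr_induction with
  | hr r => simp
  | hadd x y hx hy => simp [hx, hy]
  | hmul v x _ => simp

/-- `x` is homogeneous of parity `p`. -/
def HasPar (p : ℕ) (x : Gr κ) : Prop := parityInv x = (-1 : ℝ) ^ p • x

theorem hasPar_zero_iff {x : Gr κ} : HasPar 0 x ↔ parityInv x = x := by simp [HasPar]

theorem hasPar_one_iff {x : Gr κ} : HasPar 1 x ↔ parityInv x = -x := by simp [HasPar]

/-- Parity matters only modulo 2. Natural exponents are kept so that parities of products and
derivatives can simply be added. -/
theorem hasPar_of_even_add {p q : ℕ} (h : Even (p + q)) {x : Gr κ} (hx : HasPar p x) :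
    HasPar q x := by
  unfold HasPar at *
  rw [hx]
  congr 1
  rcases Nat.even_or_odd p with hp | hp
  · rw [hp.neg_one_pow, ((Nat.even_add.1 h).1 hp).neg_one_pow]
  · have : Odd q := by
      rw [← Nat.not_even_iff_odd] at hp ⊢
      exact fun hq => hp ((Nat.even_add.1 h).2 hq)
    rw [hp.neg_one_pow, this.neg_one_pow]

theorem HasPar.cases {p : ℕ} {x : Gr κ} (hx : HasPar p x) :
    (Even p ∧ parityInv x = x) ∨ (Odd p ∧ parityInv x = -x) := by
  rcases Nat.even_or_odd p with hp | hp
  · left; exact ⟨hp, by rw [hx, hp.neg_one_pow, one_smul]⟩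
  · right; exact ⟨hp, by rw [hx, hp.neg_one_pow, neg_one_smul]⟩

theorem HasPar.add {p : ℕ} {x y : Gr κ} (hx : HasPar p x) (hy : HasPar p y) :
    HasPar p (x + y) := by
  unfold HasPar at *; rw [map_add, hx, hy, smul_add]

theorem HasPar.smul {p : ℕ} {x : Gr κ} (r : ℝ) (hx : HasPar p x) : HasPar p (r • x) := by
  unfold HasPar at *; rw [map_smul, hx, smul_comm]

theorem HasPar.neg {p : ℕ} {x : Gr κ} (hx : HasPar p x) : HasPar p (-x) := by
  unfold HasPar at *; rw [map_neg, hx, smul_neg]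

theorem HasPar.sub {p : ℕ} {x y : Gr κ} (hx : HasPar p x) (hy : HasPar p y) :
    HasPar p (x - y) := by
  rw [sub_eq_add_neg]; exact hx.add hy.neg

theorem HasPar.sum {α : Type*} {s : Finset α} {p : ℕ} {f : α → Gr κ}
    (h : ∀ a ∈ s, HasPar p (f a)) : HasPar p (∑ a ∈ s, f a) := by
  unfold HasPar at *
  rw [map_sum, Finset.smul_sum]
  exact Finset.sum_congr rfl h

theorem HasPar.mul {p q : ℕ} {x y : Gr κ} (hx : HasPar p x) (hy : HasPar q y) :
    HasPar (p + q) (x * y) := by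
  unfold HasPar at *
  rw [map_mul, hx, hy, smul_mul_smul_comm, pow_add]

theorem hasPar_algebraMap (r : ℝ) : HasPar 0 (algebraMap ℝ (Gr κ) r) := by
  simp [HasPar]

theorem hasPar_ι (v : κ → ℝ) : HasPar 1 (ExteriorAlgebra.ι ℝ v : Gr κ) := by
  simp [HasPar]

/-- Generators anticommute, so moving one past `x` costs a sign per degree, which is the involution.
All supercommutativity below derives from this. -/
theorem ι_mul_eq (v : κ → ℝ) (x : Gr κ) :
    ExteriorAlgebra.ι ℝ v * x = parityInv x * ExteriorAlgebra.ι ℝ v := by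
  induction x using gr_induction with
  | hr r => simp [Algebra.commutes]
  | hadd x y hx hy => simp [mul_add, add_mul, hx, hy]
  | hmul w x hx =>
    rw [map_mul, parityInv_ι, mul_assoc, ← hx, ← mul_assoc, ← mul_assoc, neg_mul]
    rw [eq_neg_of_add_eq_zero_left (ExteriorAlgebra.ι_add_mul_swap v w)]

theorem mul_comm_of_even {y : Gr κ} (hy : parityInv y = y) (x : Gr κ) : x * y = y * x := by
  induction x using gr_induction with
  | hr r => exact Algebra.commutes r y
  | hadd a b ha hb => rw [add_mul, ha, hb, mul_add]
  | hmul v a ha => rw [mul_assoc, ha, ← mul_assoc, ι_mul_eq, hy, mul_assoc]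

theorem mul_of_odd {y : Gr κ} (hy : parityInv y = -y) (x : Gr κ) :
    x * y = y * parityInv x := by
  induction x using gr_induction with
  | hr r => rw [parityInv_algebraMap]; exact Algebra.commutes r y
  | hadd a b ha hb => rw [add_mul, ha, hb, map_add, mul_add]
  | hmul v a ha =>
    rw [mul_assoc, ha, ← mul_assoc, ι_mul_eq, hy, map_mul, parityInv_ι]
    simp [mul_assoc]

theorem HasPar.mul_comm {p q : ℕ} {x y : Gr κ} (hx : HasPar p x) (hy : HasPar q y) :
    x * y = (-1 : ℝ) ^ (p * q) • (y * x) := by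
  rcases hy.cases with ⟨hq, h⟩ | ⟨hq, h⟩
  · rw [mul_comm_of_even h, (hq.mul_left p).neg_one_pow, one_smul]
  · rw [mul_of_odd h]
    rcases hx.cases with ⟨hp, h'⟩ | ⟨hp, h'⟩
    · rw [h', (hp.mul_right q).neg_one_pow, one_smul]
    · rw [h', (hp.mul hq).neg_one_pow, neg_one_smul, mul_neg]

theorem body_of_odd {x : Gr κ} (hx : parityInv x = -x) : body x = 0 := by
  have h := body_parityInv x
  rw [hx, map_neg] at h
  linarith

/-- An odd element anticommutes with itself and 2 is invertible. This is the condition that makes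
`oddSubst` the intended homomorphism rather than its default 0. -/
theorem mul_self_of_odd {x : Gr κ} (hx : parityInv x = -x) : x * x = 0 := by
  have h := mul_of_odd hx x
  rw [hx, mul_neg] at h
  have h2 : (2 : ℝ) • (x * x) = 0 := by rw [two_smul]; nth_rewrite 1 [h]; simp
  exact (smul_eq_zero.1 h2).resolve_left (by norm_num)

/-! #### Nilpotency -/

/-- The nilpotent ideal of the Grassmann algebra. -/
def augIdeal (κ : Type*) : Submodule ℝ (Gr κ) := LinearMap.ker (body (κ := κ)).toLinearMap

theorem mem_augIdeal {x : Gr κ} : x ∈ augIdeal κ ↔ body x = 0 := by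
  simp [augIdeal]

/-- The filtration by the powers of the nilpotent ideal. -/
def aug (κ : Type*) (k : ℕ) : Submodule ℝ (Gr κ) := augIdeal κ ^ k * ⊤

theorem mem_aug_zero (x : Gr κ) : x ∈ aug κ 0 := by simp [aug]

theorem mul_mem_aug_succ {k : ℕ} {x y : Gr κ} (hx : body x = 0) (hy : y ∈ aug κ k) :
    x * y ∈ aug κ (k + 1) := by
  rw [aug, pow_succ', mul_assoc]
  exact Submodule.mul_mem_mul (mem_augIdeal.2 hx) hy

/-- Powers are products of subspaces in a noncommutative algebra, with `⊤` on the right only. Moving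
`⊤` across shows that they are two-sided, which makes the filtration multiplicative. -/
theorem top_mul_augIdeal_pow (k : ℕ) : (⊤ : Submodule ℝ (Gr κ)) * augIdeal κ ^ k ≤ aug κ k := by
  induction k with
  | zero => simp [aug]
  | succ k ih =>
    have h : (⊤ : Submodule ℝ (Gr κ)) * augIdeal κ ≤ augIdeal κ * ⊤ := by
      rw [Submodule.mul_le]
      intro x _ y hy
      rw [← mul_one (x * y)]
      refine Submodule.mul_mem_mul ?_ trivial
      rw [mem_augIdeal] at hy ⊢
      simp [hy]
    rw [aug, pow_succ, ← mul_assoc]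
    calc _ ≤ (augIdeal κ ^ k * ⊤) * augIdeal κ := mul_le_mul_left ih _
      _ = augIdeal κ ^ k * (⊤ * augIdeal κ) := mul_assoc _ _ _
      _ ≤ augIdeal κ ^ k * (augIdeal κ * ⊤) := mul_le_mul_right h _
      _ = _ := by rw [mul_assoc]

theorem mul_mem_aug {k l : ℕ} {x y : Gr κ} (hx : x ∈ aug κ k) (hy : y ∈ aug κ l) :
    x * y ∈ aug κ (k + l) := by
  have h : aug κ k * aug κ l ≤ aug κ (k + l) := by
    have : aug κ k * aug κ l = augIdeal κ ^ k * (⊤ * augIdeal κ ^ l) * ⊤ := by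
      simp only [aug, mul_assoc]
    rw [this]
    calc _ ≤ augIdeal κ ^ k * (augIdeal κ ^ l * ⊤) * ⊤ :=
          mul_le_mul_left (mul_le_mul_right (top_mul_augIdeal_pow l) _) _
      _ = augIdeal κ ^ (k + l) * (⊤ * ⊤) := by rw [pow_add]; simp only [mul_assoc]
      _ ≤ _ := mul_le_mul_right le_top _
  exact h (Submodule.mul_mem_mul hx hy)

theorem augIdeal_le : augIdeal κ ≤ LinearMap.range (ExteriorAlgebra.ι ℝ (M := κ → ℝ)) * ⊤ := by
  intro x hx
  have : ∀ x : Gr κ, x - algebraMap ℝ (Gr κ) (body x) ∈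
      LinearMap.range (ExteriorAlgebra.ι ℝ (M := κ → ℝ)) * ⊤ := by
    intro x
    induction x using gr_induction with
    | hr r => simp
    | hadd x y hx hy => rw [map_add, map_add, add_sub_add_comm]; exact add_mem hx hy
    | hmul v x _ =>
      simp only [map_mul, body_ι, zero_mul, map_zero, sub_zero]
      exact Submodule.mul_mem_mul ⟨v, rfl⟩ trivial
  simpa [mem_augIdeal.1 hx] using this x

/-- An element without body is a sum of products that start with a generator, and generators move to
the left at the cost of the involution. Hence a product of `k` such elements starts with `k`
generators. -/
theorem augIdeal_pow_le (k : ℕ) :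
    augIdeal κ ^ k ≤ LinearMap.range (ExteriorAlgebra.ι ℝ (M := κ → ℝ)) ^ k * ⊤ := by
  set E := LinearMap.range (ExteriorAlgebra.ι ℝ (M := κ → ℝ)) with hE
  have h : (⊤ : Submodule ℝ (Gr κ)) * E ≤ E * ⊤ := by
    rw [Submodule.mul_le]
    rintro x _ _ ⟨v, rfl⟩
    rw [← parityInv_parityInv x, ← ι_mul_eq]
    exact Submodule.mul_mem_mul ⟨v, rfl⟩ trivial
  induction k with
  | zero => simp
  | succ k ih =>
    rw [pow_succ, pow_succ]
    calc _ ≤ (E ^ k * ⊤) * (E * ⊤) := mul_le_mul' ih augIdeal_le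
      _ = E ^ k * (⊤ * E) * ⊤ := by simp only [mul_assoc]
      _ ≤ E ^ k * (E * ⊤) * ⊤ := mul_le_mul_left (mul_le_mul_right h _) _
      _ = E ^ k * E * (⊤ * ⊤) := by simp only [mul_assoc]
      _ ≤ _ := mul_le_mul_right le_top _

/-- The exterior power of degree `k` has dimension `(card κ).choose k`, which is 0 here. -/
theorem aug_eq_bot [Fintype κ] {k : ℕ} (hk : Fintype.card κ < k) : aug κ k = ⊥ := by
  have h : (⋀[ℝ]^k (κ → ℝ)) = ⊥ := by
    rw [← Submodule.finrank_eq_zero (R := ℝ), exteriorPower.finrank_eq]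
    exact Nat.choose_eq_zero_of_lt (by simpa using hk)
  rw [eq_bot_iff, aug]
  calc _ ≤ (LinearMap.range (ExteriorAlgebra.ι ℝ (M := κ → ℝ)) ^ k * ⊤) * ⊤ :=
        mul_le_mul_left (augIdeal_pow_le k) _
    _ = (⋀[ℝ]^k (κ → ℝ)) * ⊤ * ⊤ := rfl
    _ ≤ ⊥ := by rw [h]; simp

theorem eq_zero_of_mem_aug [Fintype κ] {x : Gr κ} (h : ∀ k, x ∈ aug κ k) : x = 0 := by
  have := h (Fintype.card κ + 1)
  rwa [aug_eq_bot (Nat.lt_succ_self _), Submodule.mem_bot] at this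

/-! #### Odd derivatives -/

/-- The left derivative by an odd generator. -/
def oddDer (j : κ) : Gr κ →ₗ[ℝ] Gr κ :=
  CliffordAlgebra.contractLeft (Q := (0 : QuadraticForm ℝ (κ → ℝ))) (LinearMap.proj j)

@[simp] theorem oddDer_ι_mul (j : κ) (v : κ → ℝ) (x : Gr κ) :
    oddDer j (ExteriorAlgebra.ι ℝ v * x) = v j • x - ExteriorAlgebra.ι ℝ v * oddDer j x :=
  CliffordAlgebra.contractLeft_ι_mul _ v x

@[simp] theorem oddDer_ι (j : κ) (v : κ → ℝ) :
    oddDer j (ExteriorAlgebra.ι ℝ v : Gr κ) = algebraMap ℝ _ (v j) :=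
  CliffordAlgebra.contractLeft_ι (0 : QuadraticForm ℝ (κ → ℝ)) _ v

@[simp] theorem oddDer_algebraMap (j : κ) (r : ℝ) :
    oddDer j (algebraMap ℝ (Gr κ) r) = 0 :=
  CliffordAlgebra.contractLeft_algebraMap (0 : QuadraticForm ℝ (κ → ℝ)) _ r

theorem oddDer_mul (j : κ) (x y : Gr κ) :
    oddDer j (x * y) = oddDer j x * y + parityInv x * oddDer j y := by
  induction x using gr_induction with
  | hr r => simp [← Algebra.smul_def]
  | hadd a b ha hb => simp only [add_mul, map_add, ha, hb]; abel
  | hmul v a ha =>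
    rw [mul_assoc, oddDer_ι_mul, ha, oddDer_ι_mul, map_mul, parityInv_ι]
    simp only [mul_add, sub_mul, smul_mul_assoc, mul_assoc, neg_mul]
    abel

theorem parityInv_oddDer (j : κ) (x : Gr κ) :
    parityInv (oddDer j x) = -oddDer j (parityInv x) := by
  induction x using gr_induction with
  | hr r => simp
  | hadd a b ha hb => simp only [map_add, ha, hb]; abel
  | hmul v a ha =>
    rw [oddDer_ι_mul, map_sub, map_smul, map_mul, ha, map_mul, parityInv_ι, neg_mul, neg_mul, map_neg,
      oddDer_ι_mul]
    simp

/-! #### Substitution -/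

section Subst

variable [Fintype κ] [Fintype κ']

theorem parityInv_oddComb {η : κ' → Gr κ} (h : ∀ j, parityInv (η j) = -η j) (v : κ' → ℝ) :
    parityInv (oddComb η v) = -oddComb η v := by
  simp [oddComb, Fintype.linearCombination_apply, h]

/-- Substitution of odd elements, as an algebra homomorphism. -/
def oddSubstHom (η : κ' → Gr κ) (h : ∀ j, parityInv (η j) = -η j) : Gr κ' →ₐ[ℝ] Gr κ :=
  ExteriorAlgebra.lift ℝ ⟨oddComb η, fun v => mul_self_of_odd (parityInv_oddComb h v)⟩

theorem oddSubst_eq {η : κ' → Gr κ} (h : ∀ j, parityInv (η j) = -η j) (x : Gr κ') :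
    oddSubst η x = oddSubstHom η h x := by
  rw [oddSubst, dif_pos (fun v => mul_self_of_odd (parityInv_oddComb h v))]
  rfl

theorem oddSubst_mul {η : κ' → Gr κ} (h : ∀ j, parityInv (η j) = -η j)
    (x y : Gr κ') : oddSubst η (x * y) = oddSubst η x * oddSubst η y := by
  simp only [oddSubst_eq h, map_mul]

theorem oddSubst_algebraMap {η : κ' → Gr κ} (h : ∀ j, parityInv (η j) = -η j)
    (r : ℝ) :
    oddSubst η (algebraMap ℝ (Gr κ') r) = algebraMap ℝ (Gr κ) r := by
  simp only [oddSubst_eq h, AlgHom.commutes]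

theorem oddSubst_ι {η : κ' → Gr κ} (h : ∀ j, parityInv (η j) = -η j)
    (v : κ' → ℝ) : oddSubst η (ExteriorAlgebra.ι ℝ v) = oddComb η v := by
  rw [oddSubst_eq h, oddSubstHom, ExteriorAlgebra.lift_ι_apply]

theorem parityInv_oddSubst {η : κ' → Gr κ} (h : ∀ j, parityInv (η j) = -η j)
    (x : Gr κ') : parityInv (oddSubst η x) = oddSubst η (parityInv x) := by
  induction x using gr_induction with
  | hr r => simp [oddSubst_algebraMap h]
  | hadd a b ha hb => simp only [map_add, ha, hb]
  | hmul v a ha =>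
    simp only [oddSubst_mul h, map_mul, ha, parityInv_ι, map_neg, oddSubst_ι h,
      parityInv_oddComb h]

theorem body_oddSubst {η : κ' → Gr κ} (h : ∀ j, parityInv (η j) = -η j)
    (x : Gr κ') : body (oddSubst η x) = body x := by
  induction x using gr_induction with
  | hr r => simp [oddSubst_algebraMap h]
  | hadd a b ha hb => simp only [map_add, ha, hb]
  | hmul v a ha =>
    simp only [oddSubst_mul h, map_mul, oddSubst_ι h, body_of_odd (parityInv_oddComb h v),
      body_ι, zero_mul]

end Subst

theorem oddComb_single [Fintype κ] [Fintype κ'] [DecidableEq κ'] (η : κ' → Gr κ) (j : κ') :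
    oddComb η (Pi.single j 1) = η j := by
  simp [oddComb, Fintype.linearCombination_apply, Pi.single_apply]

end Grassmann

/-! ### Calculus of superfunctions -/

section SuperCalculus

open Filter Topology

variable {κ κ' : Type*} [Fintype κ] [Fintype κ']

/-- Multiplication of the Grassmann algebra as a continuous bilinear map. -/
def mulCLM (κ : Type*) [Fintype κ] : Gr κ →L[ℝ] Gr κ →L[ℝ] Gr κ :=
  LinearMap.toContinuousLinearMap
    ((LinearMap.toContinuousLinearMap : (Gr κ →ₗ[ℝ] Gr κ) ≃ₗ[ℝ] _).toLinearMap ∘ₗ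
      LinearMap.mul ℝ (Gr κ))

@[simp] theorem mulCLM_apply (x y : Gr κ) : mulCLM κ x y = x * y := rfl

/-! ### Smooth Grassmann-valued functions on a normed space -/

section Normed

variable {E : Type*} [NormedAddCommGroup E] [NormedSpace ℝ E]

/-- The norm comes from linear coordinates and need not be submultiplicative, so products go through
the bounded bilinear map `mulCLM`. -/
theorem contDiffAt_gr_mul {n : WithTop ℕ∞} {f g : E → Gr κ} {z : E} (hf : ContDiffAt ℝ n f z)
    (hg : ContDiffAt ℝ n g z) : ContDiffAt ℝ n (f * g) z :=
  (mulCLM κ).isBoundedBilinearMap.contDiff.contDiffAt.comp z (hf.prodMk hg)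

theorem contDiffAt_lin {n : WithTop ℕ∞} (L : Gr κ →ₗ[ℝ] Gr κ') {f : E → Gr κ} {z : E}
    (hf : ContDiffAt ℝ n f z) : ContDiffAt ℝ n (fun x => L (f x)) z :=
  L.toContinuousLinearMap.contDiff.contDiffAt.comp z hf

theorem fderiv_gr_mul {f g : E → Gr κ} {z : E} (hf : DifferentiableAt ℝ f z)
    (hg : DifferentiableAt ℝ g z) (v : E) :
    fderiv ℝ (f * g) z v = fderiv ℝ f z v * g z + f z * fderiv ℝ g z v := by
  have h := (mulCLM κ).hasFDerivAt_of_bilinear hf.hasFDerivAt hg.hasFDerivAt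
  have h' : HasFDerivAt (f * g) _ z := h
  rw [h'.fderiv]
  simp [ContinuousLinearMap.precompR, ContinuousLinearMap.precompL, add_comm]

theorem fderiv_lin (L : Gr κ →ₗ[ℝ] Gr κ') {f : E → Gr κ} {z : E} (hf : DifferentiableAt ℝ f z)
    (v : E) : fderiv ℝ (fun x => L (f x)) z v = L (fderiv ℝ f z v) := by
  have h := (L.toContinuousLinearMap.hasFDerivAt (x := f z)).comp z hf.hasFDerivAt
  have h' : HasFDerivAt (fun x => L (f x)) _ z := h
  rw [h'.fderiv]
  rfl

/-- `f` is smooth in a neighbourhood of `z`. -/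
def Sm (f : E → Gr κ) (z : E) : Prop := ∀ᶠ x in 𝓝 z, ContDiffAt ℝ ∞ f x

variable {f g : E → Gr κ} {z : E}

theorem Sm.contDiffAt (hf : Sm f z) : ContDiffAt ℝ ∞ f z := hf.self_of_nhds

theorem Sm.differentiableAt (hf : Sm f z) : DifferentiableAt ℝ f z :=
  hf.contDiffAt.differentiableAt (by simp)

/-- Requiring smoothness on a neighbourhood makes `Sm` an open condition, which allows local
identities to be differentiated. `ContDiffAt ℝ ∞` at one point is not open: the neighbourhoods may
shrink with the order. -/
theorem Sm.eventually (hf : Sm f z) : ∀ᶠ x in 𝓝 z, Sm f x := eventually_eventually_nhds.2 hf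

theorem Sm.congr (hf : Sm f z) (h : f =ᶠ[𝓝 z] g) : Sm g z := by
  filter_upwards [hf, h.eventuallyEq_nhds] with x hx hx'
  exact hx.congr_of_eventuallyEq hx'.symm

theorem sm_of_contDiffOn {s : Set E} (hs : IsOpen s) (hf : ContDiffOn ℝ ∞ f s) (hz : z ∈ s) :
    Sm f z := by
  filter_upwards [hs.mem_nhds hz] with x hx
  exact hf.contDiffAt (hs.mem_nhds hx)

theorem contDiffOn_of_sm {s : Set E} (h : ∀ z ∈ s, Sm f z) : ContDiffOn ℝ ∞ f s :=
  fun z hz => (h z hz).contDiffAt.contDiffWithinAt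

theorem sm_const (c : Gr κ) : Sm (fun _ : E => c) z := Eventually.of_forall fun _ => contDiffAt_const

theorem Sm.add (hf : Sm f z) (hg : Sm g z) : Sm (f + g) z := by
  filter_upwards [hf, hg] with x h h' using h.add h'

theorem Sm.sub (hf : Sm f z) (hg : Sm g z) : Sm (f - g) z := by
  filter_upwards [hf, hg] with x h h' using h.sub h'

theorem Sm.smul (r : ℝ) (hf : Sm f z) : Sm (r • f) z := by
  filter_upwards [hf] with x h using contDiffAt_const.smul h

theorem Sm.mul (hf : Sm f z) (hg : Sm g z) : Sm (f * g) z := by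
  filter_upwards [hf, hg] with x h h' using contDiffAt_gr_mul h h'

theorem Sm.lin (L : Gr κ →ₗ[ℝ] Gr κ') (hf : Sm f z) : Sm (fun x => L (f x)) z := by
  filter_upwards [hf] with x h using contDiffAt_lin L h

theorem sm_sum {α : Type*} {s : Finset α} {f : α → E → Gr κ}
    (h : ∀ a ∈ s, Sm (f a) z) : Sm (∑ a ∈ s, f a) z := by
  classical
  induction s using Finset.induction_on with
  | empty => exact sm_const (0 : Gr κ)
  | insert a s ha ih =>
    rw [Finset.sum_insert ha]
    exact (h a (by simp)).add (ih fun b hb => h b (by simp [hb]))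

theorem Sm.fderiv (v : E) (hf : Sm f z) : Sm (fun x => fderiv ℝ f x v) z := by
  filter_upwards [hf] with x h
  exact (h.fderiv_right (m := ∞) (by simp)).clm_apply contDiffAt_const

end Normed

/-! ### Partial derivatives of superfunctions -/

variable {ι : Type*} [Fintype ι] [DecidableEq ι] [DecidableEq κ]
variable {f g : SF ι κ} {z : ι → ℝ} {a b c : ι ⊕ κ}

theorem Sm.pd (a : ι ⊕ κ) (hf : Sm f z) : Sm (pd a f) z := by
  cases a with
  | inl i => exact hf.fderiv _
  | inr j => exact hf.lin (oddDer j)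

theorem sm_coord (a : ι ⊕ κ) : Sm (coord a : SF ι κ) z := by
  cases a with
  | inl i =>
    refine Eventually.of_forall fun (x : ι → ℝ) => ?_
    have h : (coord (Sum.inl i) : SF ι κ) = fun x => x i • (1 : Gr κ) := by
      funext x; exact Algebra.algebraMap_eq_smul_one _
    rw [h]
    have h1 : ContDiff ℝ ∞ (fun x : ι → ℝ => x i) := contDiff_apply ℝ ℝ i
    have h2 : ContDiffAt ℝ ∞ (fun _ : ι → ℝ => (1 : Gr κ)) x := contDiffAt_const
    exact h1.contDiffAt.smul h2
  | inr j => exact sm_const (E := ι → ℝ) (ExteriorAlgebra.ι ℝ (Pi.single j 1) : Gr κ)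

theorem parityInv_coord (a : ι ⊕ κ) : HasPar (par a) ((coord a : SF ι κ) z) := by
  cases a with
  | inl i => exact hasPar_algebraMap _
  | inr j => exact hasPar_ι _

theorem pd_inr (j : κ) (f : SF ι κ) (z : ι → ℝ) : pd (Sum.inr j) f z = oddDer j (f z) := rfl

theorem pd_inl (i : ι) (f : SF ι κ) (z : ι → ℝ) :
    pd (Sum.inl i) f z = fderiv ℝ f z (Pi.single i 1) := rfl

theorem pd_congr (a : ι ⊕ κ) (h : f =ᶠ[𝓝 z] g) : pd a f =ᶠ[𝓝 z] pd a g := by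
  cases a with
  | inl i => filter_upwards [h.fderiv (𝕜 := ℝ)] with x hx; simp only [pd_inl, hx]
  | inr j => filter_upwards [h] with x hx; simp only [pd_inr, hx]

theorem pd_add (a : ι ⊕ κ) (hf : DifferentiableAt ℝ f z) (hg : DifferentiableAt ℝ g z) :
    pd a (f + g) z = pd a f z + pd a g z := by
  cases a with
  | inl i => simp [pd_inl, fderiv_add hf hg]
  | inr j => simp [pd_inr]

theorem pd_sub (a : ι ⊕ κ) (hf : DifferentiableAt ℝ f z) (hg : DifferentiableAt ℝ g z) :
    pd a (f - g) z = pd a f z - pd a g z := by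
  cases a with
  | inl i => simp [pd_inl, fderiv_sub hf hg]
  | inr j => simp [pd_inr]

theorem pd_smul (a : ι ⊕ κ) (r : ℝ) : pd a (r • f) z = r • pd a f z := by
  cases a with
  | inl i => simp [pd_inl, fderiv_const_smul_field]
  | inr j => simp [pd_inr]

theorem pd_sum {α : Type*} (a : ι ⊕ κ) {s : Finset α} {f : α → SF ι κ}
    (h : ∀ b ∈ s, DifferentiableAt ℝ (f b) z) : pd a (∑ b ∈ s, f b) z = ∑ b ∈ s, pd a (f b) z := by
  cases a with
  | inl i =>
    simp only [pd_inl, fderiv_sum h, _root_.sum_apply]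
  | inr j => simp [pd_inr, Finset.sum_apply]

theorem pd_const_inl (i : ι) (c : Gr κ) : pd (Sum.inl i) (fun _ => c) z = 0 := by
  simp [pd_inl]

/-- Iterating the involution `par a` times expresses the sign rule without assuming `f` homogeneous.
-/
theorem pd_mul (a : ι ⊕ κ) (hf : DifferentiableAt ℝ f z) (hg : DifferentiableAt ℝ g z) :
    pd a (f * g) z = pd a f z * g z + parityInv^[par a] (f z) * pd a g z := by
  cases a with
  | inl i => simp [pd_inl, par, fderiv_gr_mul hf hg]
  | inr j => simp [pd_inr, par, oddDer_mul]

theorem HasPar.iterate_parityInv {p : ℕ} {x : Gr κ} (hx : HasPar p x) (a : ι ⊕ κ) :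
    parityInv^[par a] x = (-1 : ℝ) ^ (par a * p) • x := by
  cases a with
  | inl i => simp [par]
  | inr j => simpa [par, HasPar] using hx

theorem pd_mul_of_hasPar {p : ℕ} (a : ι ⊕ κ) (hf : DifferentiableAt ℝ f z)
    (hg : DifferentiableAt ℝ g z) (hp : HasPar p (f z)) :
    pd a (f * g) z = pd a f z * g z + (-1 : ℝ) ^ (par a * p) • (f z * pd a g z) := by
  rw [pd_mul a hf hg, hp.iterate_parityInv, smul_mul_assoc]

theorem pd_coord (a c : ι ⊕ κ) : pd a (coord c : SF ι κ) z = if c = a then 1 else 0 := by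
  cases c with
  | inl i =>
    have h : (coord (Sum.inl i) : SF ι κ) = fun x => x i • (1 : Gr κ) := by
      funext x; exact Algebra.algebraMap_eq_smul_one _
    cases a with
    | inl i' =>
      have h2 : HasFDerivAt (fun x : ι → ℝ => x i • (1 : Gr κ))
        ((ContinuousLinearMap.proj (R := ℝ) (φ := fun _ : ι => ℝ) i).smulRight (1 : Gr κ)) z :=
        ((ContinuousLinearMap.proj (R := ℝ) (φ := fun _ : ι => ℝ) i).hasFDerivAt).smul_const _
      rw [pd_inl, h, h2.fderiv]
      by_cases hii : i = i'
      · subst hii; simp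
      · simp [hii]
    | inr j => simp [pd_inr, coord]
  | inr j =>
    cases a with
    | inl i => simp [pd_inl, coord]
    | inr j' =>
      rw [pd_inr, coord, oddDer_ι]
      by_cases hjj : j = j'
      · subst hjj; simp
      · simp [hjj, Ne.symm hjj]

theorem HasPar.lin_of_anti {L : Gr κ →ₗ[ℝ] Gr κ} (hL : ∀ x, parityInv (L x) = -L (parityInv x))
    {p : ℕ} {x : Gr κ} (hx : HasPar p x) : HasPar (p + 1) (L x) := by
  unfold HasPar at *
  rw [hL, hx, map_smul, pow_succ, mul_neg_one, neg_smul]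

/-- The involution is a constant linear map, so it commutes with even derivatives, and it
anticommutes with odd ones. Parity is needed near `z` because the even derivative sees the germ. -/
theorem hasPar_pd {p : ℕ} (a : ι ⊕ κ) (hp : ∀ᶠ x in 𝓝 z, HasPar p (f x))
    (hf : DifferentiableAt ℝ f z) : HasPar (p + par a) (pd a f z) := by
  cases a with
  | inl i =>
    have h : (fun x => (parityInv (κ := κ)).toLinearMap (f x)) =ᶠ[𝓝 z] (-1 : ℝ) ^ p • f := hp
    have h2 := fderiv_lin (parityInv (κ := κ)).toLinearMap hf (Pi.single i 1)
    rw [h.fderiv_eq, fderiv_const_smul hf] at h2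
    exact h2.symm
  | inr j => exact hp.self_of_nhds.lin_of_anti (parityInv_oddDer j)

end SuperCalculus

/-! ### Taylor expansions with nilpotent increments -/

section Taylor

open Filter Topology

variable {κ ι' : Type*} [Fintype κ] [Fintype ι'] [DecidableEq ι']
variable {n : ι' → Gr κ} {g h : (ι' → ℝ) → Gr κ} {y : ι' → ℝ}

theorem dirDeriv_congr (hgh : g =ᶠ[𝓝 y] h) : dirDeriv n g =ᶠ[𝓝 y] dirDeriv n h := by
  filter_upwards [hgh.fderiv (𝕜 := ℝ)] with x hx
  simp only [dirDeriv, hx]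

theorem iterate_dirDeriv_congr (k : ℕ) (hgh : g =ᶠ[𝓝 y] h) :
    (dirDeriv n)^[k] g =ᶠ[𝓝 y] (dirDeriv n)^[k] h := by
  induction k generalizing g h with
  | zero => exact hgh
  | succ k ih => exact ih (dirDeriv_congr hgh)

theorem dirDeriv_eq_sum (n : ι' → Gr κ) (g : (ι' → ℝ) → Gr κ) :
    dirDeriv n g = ∑ b, (fun _ => n b) * (fun x => fderiv ℝ g x (Pi.single b 1)) := by
  funext x; simp [dirDeriv]

theorem Sm.dirDeriv (n : ι' → Gr κ) (hg : Sm g y) : Sm (dirDeriv n g) y := by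
  rw [dirDeriv_eq_sum]
  exact sm_sum fun b _ => (sm_const (n b)).mul (hg.fderiv _)

theorem dirDeriv_add (hg : Sm g y) (hh : Sm h y) :
    dirDeriv n (g + h) =ᶠ[𝓝 y] dirDeriv n g + dirDeriv n h := by
  filter_upwards [hg.eventually, hh.eventually] with x hx hx'
  simp [dirDeriv, fderiv_add hx.differentiableAt hx'.differentiableAt, mul_add,
    Finset.sum_add_distrib]

theorem iterate_dirDeriv_add (k : ℕ) (hg : Sm g y) (hh : Sm h y) :
    (dirDeriv n)^[k] (g + h) =ᶠ[𝓝 y] (dirDeriv n)^[k] g + (dirDeriv n)^[k] h := by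
  induction k generalizing g h with
  | zero => exact EventuallyEq.rfl
  | succ k ih =>
    exact (iterate_dirDeriv_congr k (dirDeriv_add hg hh)).trans (ih (hg.dirDeriv n) (hh.dirDeriv n))

theorem iterate_dirDeriv_zero (k : ℕ) : (dirDeriv n)^[k] (0 : (ι' → ℝ) → Gr κ) = 0 := by
  induction k with
  | zero => rfl
  | succ k ih =>
    rw [Function.iterate_succ_apply]
    have : dirDeriv n (0 : (ι' → ℝ) → Gr κ) = 0 := by
      funext x; simp [dirDeriv]
    rw [this, ih]

theorem iterate_dirDeriv_sum (k : ℕ) {α : Type*} {s : Finset α} {f : α → (ι' → ℝ) → Gr κ}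
    (hf : ∀ a ∈ s, Sm (f a) y) :
    (dirDeriv n)^[k] (∑ a ∈ s, f a) y = ∑ a ∈ s, (dirDeriv n)^[k] (f a) y := by
  classical
  induction s using Finset.induction_on with
  | empty => simp [iterate_dirDeriv_zero]
  | insert a s ha ih =>
    rw [Finset.sum_insert ha, Finset.sum_insert ha,
      (iterate_dirDeriv_add k (hf a (by simp)) (sm_sum fun b hb => hf b (by simp [hb]))).self_of_nhds,
      Pi.add_apply, ih fun b hb => hf b (by simp [hb])]

theorem dirDeriv_const_mul {c : Gr κ} (hc : parityInv c = c) (hg : Sm g y) :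
    dirDeriv n ((fun _ => c) * g) =ᶠ[𝓝 y] (fun _ => c) * dirDeriv n g := by
  filter_upwards [hg.eventually] with x hx
  simp only [dirDeriv, Pi.mul_apply, Finset.mul_sum]
  refine Finset.sum_congr rfl fun b _ => ?_
  rw [fderiv_gr_mul (differentiableAt_const _) hx.differentiableAt]
  simp [← mul_assoc, mul_comm_of_even hc]

theorem iterate_dirDeriv_const_mul (k : ℕ) {c : Gr κ} (hc : parityInv c = c) (hg : Sm g y) :
    (dirDeriv n)^[k] ((fun _ => c) * g) y = c * (dirDeriv n)^[k] g y := by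
  induction k generalizing g with
  | zero => rfl
  | succ k ih =>
    rw [Function.iterate_succ_apply, Function.iterate_succ_apply,
      (iterate_dirDeriv_congr k (dirDeriv_const_mul hc hg)).self_of_nhds, ih (hg.dirDeriv n)]

/-- Even coefficients are central, so the coefficient of the innermost derivative can be pulled out
in front. Inductions on the order run in this form, with `g` generalized. -/
theorem iterate_dirDeriv_succ (hn : ∀ b, parityInv (n b) = n b) (k : ℕ) (hg : Sm g y) :
    (dirDeriv n)^[k + 1] g y =
      ∑ b, n b * (dirDeriv n)^[k] (fun x => fderiv ℝ g x (Pi.single b 1)) y := by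
  rw [Function.iterate_succ_apply, dirDeriv_eq_sum,
    iterate_dirDeriv_sum k fun b _ => (sm_const (n b)).mul (hg.fderiv _)]
  exact Finset.sum_congr rfl fun b _ => iterate_dirDeriv_const_mul k (hn b) (hg.fderiv _)

/-- Each differentiation contributes one nilpotent factor. -/
theorem iterate_dirDeriv_mem_aug (hn : ∀ b, parityInv (n b) = n b) (hb : ∀ b, body (n b) = 0)
    (k : ℕ) (hg : Sm g y) : (dirDeriv n)^[k] g y ∈ aug κ k := by
  induction k generalizing g with
  | zero => exact mem_aug_zero _
  | succ k ih =>
    rw [iterate_dirDeriv_succ hn k hg]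
    exact Submodule.sum_mem _ fun b _ => mul_mem_aug_succ (hb b) (ih (hg.fderiv _))

theorem dirDeriv_mul (hn : ∀ b, parityInv (n b) = n b) (hg : Sm g y) (hh : Sm h y) :
    dirDeriv n (g * h) =ᶠ[𝓝 y] dirDeriv n g * h + g * dirDeriv n h := by
  filter_upwards [hg.eventually, hh.eventually] with x hx hx'
  simp only [dirDeriv, Pi.add_apply, Pi.mul_apply, Finset.sum_mul, Finset.mul_sum,
    ← Finset.sum_add_distrib, fderiv_gr_mul hx.differentiableAt hx'.differentiableAt, mul_add]
  refine Finset.sum_congr rfl fun b _ => ?_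
  rw [← mul_assoc, ← mul_assoc, ← mul_assoc, mul_comm_of_even (hn b) (g x)]

theorem iterate_dirDeriv_mul (hn : ∀ b, parityInv (n b) = n b) (k : ℕ) (hg : Sm g y)
    (hh : Sm h y) : (dirDeriv n)^[k] (g * h) y = ∑ ij ∈ Finset.HasAntidiagonal.antidiagonal k,
      k.choose ij.1 • ((dirDeriv n)^[ij.1] g y * (dirDeriv n)^[ij.2] h y) := by
  induction k generalizing g h with
  | zero => simp
  | succ k ih =>
    rw [Function.iterate_succ_apply,
      (iterate_dirDeriv_congr k (dirDeriv_mul hn hg hh)).self_of_nhds,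
      (iterate_dirDeriv_add k ((hg.dirDeriv n).mul hh) (hg.mul (hh.dirDeriv n))).self_of_nhds,
      Pi.add_apply, ih (hg.dirDeriv n) hh, ih hg (hh.dirDeriv n),
      Finset.sum_antidiagonal_choose_succ_nsmul
        (fun i j => (dirDeriv n)^[i] g y * (dirDeriv n)^[j] h y), add_comm]
    congr 1
    refine Finset.sum_congr rfl fun ij hij => ?_
    rw [← Nat.choose_symm_of_eq_add (Finset.HasAntidiagonal.mem_antidiagonal.1 hij).symm]
    rfl

/-- Terms of order above `card κ` vanish, so the cut-off may be raised at will. -/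
theorem taylor_eq_sum (hn : ∀ b, parityInv (n b) = n b) (hb : ∀ b, body (n b) = 0)
    (hg : Sm g y) {K : ℕ} (hK : Fintype.card κ < K) :
    taylor n g y = ∑ k ∈ Finset.range K, ((k.factorial : ℝ)⁻¹) • ((dirDeriv n)^[k] g) y := by
  refine Finset.sum_subset (Finset.range_subset_range.2 hK) fun k _ hk => ?_
  have h := iterate_dirDeriv_mem_aug hn hb k hg
  rw [aug_eq_bot (by simpa using hk), Submodule.mem_bot] at h
  rw [h, smul_zero]

theorem taylor_add (hg : Sm g y) (hh : Sm h y) :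
    taylor n (g + h) y = taylor n g y + taylor n h y := by
  simp only [taylor, (iterate_dirDeriv_add _ hg hh).self_of_nhds, Pi.add_apply, smul_add,
    Finset.sum_add_distrib]

theorem taylor_congr (hgh : g =ᶠ[𝓝 y] h) : taylor n g y = taylor n h y := by
  simp only [taylor, (iterate_dirDeriv_congr _ hgh).self_of_nhds]

theorem taylor_const (c : Gr κ) : taylor n (fun _ => c) y = c := by
  have : ∀ k, (dirDeriv n)^[k + 1] (fun _ => c) = 0 := by
    intro k
    rw [Function.iterate_succ_apply]
    have : dirDeriv n (fun _ => c) = 0 := by funext x; simp [dirDeriv]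
    rw [this, iterate_dirDeriv_zero]
  rw [taylor, Finset.sum_range_succ', Finset.sum_eq_zero]
  · simp
  · intro k _; simp [this]

theorem taylor_zero_increment (g : (ι' → ℝ) → Gr κ) :
    taylor (0 : ι' → Gr κ) g y = g y := by
  have : ∀ k, (dirDeriv (0 : ι' → Gr κ))^[k + 1] g = 0 := by
    intro k
    rw [Function.iterate_succ_apply']
    funext x; simp [dirDeriv]
  rw [taylor, Finset.sum_range_succ', Finset.sum_eq_zero]
  · simp
  · intro k _; simp [this]

theorem body_taylor (hb : ∀ b, body (n b) = 0) : body (taylor n g y) = body (g y) := by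
  rw [taylor, Finset.sum_range_succ', map_add, map_sum, Finset.sum_eq_zero]
  · simp
  · intro k _
    rw [Function.iterate_succ_apply']
    simp [dirDeriv, hb]

theorem taylor_linear (hn : ∀ b, parityInv (n b) = n b) (hb : ∀ b, body (n b) = 0) (b : ι') :
    taylor n (fun x => algebraMap ℝ (Gr κ) (x b)) y = algebraMap ℝ (Gr κ) (y b) + n b := by
  have h1 : dirDeriv n (fun x => algebraMap ℝ (Gr κ) (x b)) = fun _ => n b := by
    funext x
    have h : (fun x : ι' → ℝ => algebraMap ℝ (Gr κ) (x b)) = fun x => x b • (1 : Gr κ) := by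
      funext x; exact Algebra.algebraMap_eq_smul_one _
    have h2 : HasFDerivAt (fun x : ι' → ℝ => x b • (1 : Gr κ))
      ((ContinuousLinearMap.proj (R := ℝ) (φ := fun _ : ι' => ℝ) b).smulRight (1 : Gr κ)) x :=
      ((ContinuousLinearMap.proj (R := ℝ) (φ := fun _ : ι' => ℝ) b).hasFDerivAt).smul_const _
    rw [dirDeriv, h, h2.fderiv]
    simp [Pi.single_apply]
  have h2 : ∀ k, (dirDeriv n)^[k + 2] (fun x => algebraMap ℝ (Gr κ) (x b)) = 0 := by
    intro k
    rw [Function.iterate_succ_apply, Function.iterate_succ_apply, h1]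
    have : dirDeriv n (fun _ => n b) = 0 := by funext x; simp [dirDeriv]
    rw [this, iterate_dirDeriv_zero]
  have hs : Sm (fun x : ι' → ℝ => algebraMap ℝ (Gr κ) (x b)) y := by
    classical exact sm_coord (κ := κ) (Sum.inl b)
  -- The cut-off is raised by one so that the terms of order 0 and 1 both occur even when `κ` is
  -- empty.
  rw [taylor_eq_sum hn hb hs (K := Fintype.card κ + 2) (by omega),
    Finset.sum_range_succ', Finset.sum_range_succ', Finset.sum_eq_zero]
  · simp [h1, add_comm]
  · intro k _; simp [h2]

theorem parityInv_iterate_dirDeriv (hn : ∀ b, parityInv (n b) = n b) (k : ℕ) (hg : Sm g y) :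
    parityInv ((dirDeriv n)^[k] g y) = (dirDeriv n)^[k] (fun x => parityInv (g x)) y := by
  have hs : ∀ {g : (ι' → ℝ) → Gr κ}, Sm g y → Sm (fun x => parityInv (g x)) y :=
    fun hg => hg.lin (parityInv (κ := κ)).toLinearMap
  induction k generalizing g with
  | zero => rfl
  | succ k ih =>
    rw [iterate_dirDeriv_succ hn k hg, iterate_dirDeriv_succ hn k (hs hg), map_sum]
    refine Finset.sum_congr rfl fun b _ => ?_
    rw [map_mul, hn, ih (hg.fderiv _)]
    congr 1
    refine (iterate_dirDeriv_congr k ?_).self_of_nhds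
    filter_upwards [hg.eventually] with x hx
    exact (fderiv_lin (parityInv (κ := κ)).toLinearMap hx.differentiableAt _).symm

theorem parityInv_taylor (hn : ∀ b, parityInv (n b) = n b) (hg : Sm g y) :
    parityInv (taylor n g y) = taylor n (fun x => parityInv (g x)) y := by
  simp only [taylor, map_sum, map_smul, parityInv_iterate_dirDeriv hn _ hg]

/-- This compares the triangle `i + j < K` with the square `i, j < K` in a truncated Cauchy product.
-/
theorem sum_range_antidiagonal {M : Type*} [AddCommMonoid M] (K : ℕ) (f : ℕ × ℕ → M)
    (hf : ∀ i j, K ≤ i + j → f (i, j) = 0) :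
    ∑ k ∈ Finset.range K, ∑ ij ∈ Finset.HasAntidiagonal.antidiagonal k, f ij =
      ∑ i ∈ Finset.range K, ∑ j ∈ Finset.range K, f (i, j) := by
  rw [← Finset.sum_product', ← Finset.sum_filter_of_ne (p := fun ij : ℕ × ℕ => ij.1 + ij.2 < K),
    ← Finset.sum_fiberwise_of_maps_to (t := Finset.range K) (g := fun ij : ℕ × ℕ => ij.1 + ij.2)]
  · refine Finset.sum_congr rfl fun k hk => Finset.sum_congr ?_ fun _ _ => rfl
    ext ⟨i, j⟩
    simp only [Finset.HasAntidiagonal.mem_antidiagonal, Finset.mem_filter, Finset.mem_product, Finset.mem_range]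
      at hk ⊢
    omega
  · intro ij hij
    simpa using (Finset.mem_filter.1 hij).2
  · intro ij _ hne
    by_contra hlt
    exact hne (hf _ _ (not_lt.1 hlt))

/-- This is the Cauchy product of two exponential series: the Leibniz coefficient `k.choose i` over
`k!` is `1 / (i! j!)`, and products of total order above `card κ` vanish by nilpotency. -/
theorem taylor_mul (hn : ∀ b, parityInv (n b) = n b) (hb : ∀ b, body (n b) = 0)
    (hg : Sm g y) (hh : Sm h y) : taylor n (g * h) y = taylor n g y * taylor n h y := by
  simp only [taylor]
  rw [Finset.sum_mul_sum, ← sum_range_antidiagonal (f := fun ij : ℕ × ℕ =>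
    (((ij.1.factorial : ℝ)⁻¹) • (dirDeriv n)^[ij.1] g y) *
      (((ij.2.factorial : ℝ)⁻¹) • (dirDeriv n)^[ij.2] h y))]
  · refine Finset.sum_congr rfl fun k _ => ?_
    rw [iterate_dirDeriv_mul hn k hg hh, Finset.smul_sum]
    refine Finset.sum_congr rfl fun ij hij => ?_
    rw [smul_mul_smul_comm, ← Nat.cast_smul_eq_nsmul ℝ, smul_smul]
    congr 1
    have hk := Finset.HasAntidiagonal.mem_antidiagonal.1 hij
    have hle : ij.1 ≤ k := by omega
    have h1 := Nat.choose_mul_factorial_mul_factorial hle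
    have h2 : k - ij.1 = ij.2 := by omega
    rw [h2] at h1
    have h3 : (k.choose ij.1 : ℝ) * ij.1.factorial * ij.2.factorial = k.factorial := by
      exact_mod_cast h1
    have h4 : (k.factorial : ℝ) ≠ 0 := by positivity
    have h5 : (ij.1.factorial : ℝ) ≠ 0 := by positivity
    have h6 : (ij.2.factorial : ℝ) ≠ 0 := by positivity
    field_simp
    linarith
  · intro i j hij
    have h1 := mul_mem_aug (iterate_dirDeriv_mem_aug hn hb i hg)
      (iterate_dirDeriv_mem_aug hn hb j hh)
    rw [aug_eq_bot (by omega), Submodule.mem_bot] at h1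
    rw [smul_mul_smul_comm, h1, smul_zero]

end Taylor

/-! ### Pullbacks -/

section Pullback

open Filter Topology

variable {ι κ ι' κ' : Type*} [Fintype ι] [DecidableEq ι] [Fintype κ] [DecidableEq κ]
  [Fintype ι'] [DecidableEq ι'] [Fintype κ'] [DecidableEq κ']

/-- `F` is a smooth morphism of superdomains near `z`. -/
structure MorAt (F : ι' ⊕ κ' → SF ι κ) (z : ι → ℝ) : Prop where
  sm : ∀ c, Sm (F c) z
  parity : ∀ᶠ w in 𝓝 z, ∀ c, HasPar (par c) (F c w)

/-- The nilpotent parts of the even components of `F`. -/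
def nilPart (F : ι' ⊕ κ' → SF ι κ) (z : ι → ℝ) (b : ι') : Gr κ :=
  F (Sum.inl b) z - algebraMap ℝ (Gr κ) (body (F (Sum.inl b) z))

/-- The odd components of `F` substituted in `f`. -/
def substOdd (F : ι' ⊕ κ' → SF ι κ) (z : ι → ℝ) (f : SF ι' κ') : (ι' → ℝ) → Gr κ :=
  fun y => oddSubst (fun j => F (Sum.inr j) z) (f y)

theorem pull_eq (F : ι' ⊕ κ' → SF ι κ) (f : SF ι' κ') (z : ι → ℝ) :
    pull F f z = taylor (nilPart F z) (substOdd F z f) (bodyMap F z) := rfl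

variable {F F' : ι' ⊕ κ' → SF ι κ} {z : ι → ℝ} {f g : SF ι' κ'}

theorem IsSuperMap.morAt {U : Set (ι → ℝ)} {V : Set (ι' → ℝ)} (hF : IsSuperMap U V F)
    (hU : IsOpen U) (hz : z ∈ U) : MorAt F z where
  sm c := sm_of_contDiffOn hU (hF.smooth c) hz
  parity := by
    filter_upwards [hU.mem_nhds hz] with w hw c using hF.parity c w hw

theorem MorAt.eventually (hF : MorAt F z) : ∀ᶠ w in 𝓝 z, MorAt F w := by
  have h1 : ∀ᶠ w in 𝓝 z, ∀ c, Sm (F c) w := eventually_all.2 fun c => (hF.sm c).eventually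
  filter_upwards [h1, eventually_eventually_nhds.2 hF.parity] with w h h' using ⟨h, h'⟩

theorem MorAt.odd (hF : MorAt F z) (j : κ') :
    parityInv (F (Sum.inr j) z) = -F (Sum.inr j) z :=
  hasPar_one_iff.1 (hF.parity.self_of_nhds (Sum.inr j))

theorem MorAt.even (hF : MorAt F z) (b : ι') : parityInv (F (Sum.inl b) z) = F (Sum.inl b) z :=
  hasPar_zero_iff.1 (hF.parity.self_of_nhds (Sum.inl b))

theorem MorAt.even_nilPart (hF : MorAt F z) (b : ι') :
    parityInv (nilPart F z b) = nilPart F z b := by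
  rw [nilPart, map_sub, hF.even, parityInv_algebraMap]

theorem body_nilPart (b : ι') : body (nilPart F z b) = 0 := by
  simp [nilPart]

theorem MorAt.tendsto_bodyMap (hF : MorAt F z) :
    Tendsto (bodyMap F) (𝓝 z) (𝓝 (bodyMap F z)) := by
  refine tendsto_pi_nhds.2 fun b => ?_
  exact ((body (κ := κ)).toLinearMap.toContinuousLinearMap.continuous.tendsto _).comp
    (hF.sm (Sum.inl b)).differentiableAt.continuousAt

theorem MorAt.contDiffAt_bodyMap (hF : MorAt F z) : ContDiffAt ℝ ∞ (bodyMap F) z := by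
  refine contDiffAt_pi.2 fun b => ?_
  exact (body (κ := κ)).toLinearMap.toContinuousLinearMap.contDiff.contDiffAt.comp z
    (hF.sm (Sum.inl b)).contDiffAt

theorem Sm.substOdd (hf : Sm f (bodyMap F z)) : Sm (substOdd F z f) (bodyMap F z) :=
  hf.lin _

theorem pull_add (hf : Sm f (bodyMap F z)) (hg : Sm g (bodyMap F z)) :
    pull F (f + g) z = pull F f z + pull F g z := by
  rw [pull_eq, pull_eq, pull_eq, ← taylor_add hf.substOdd hg.substOdd]
  congr 1
  funext y; simp [substOdd]

theorem pull_congr (h : f =ᶠ[𝓝 (bodyMap F z)] g) : pull F f z = pull F g z := by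
  refine taylor_congr ?_
  filter_upwards [h] with y hy
  rw [hy]

/-- Only the value of `F` at `z` enters, whereas `f` enters through its germ. -/
theorem pull_congr_left (h : ∀ c, F c z = F' c z) : pull F f z = pull F' f z := by
  have h1 : bodyMap F z = bodyMap F' z := by funext b; simp [bodyMap, h]
  simp only [pull, h, h1]

theorem pull_mul (hF : MorAt F z) (hf : Sm f (bodyMap F z)) (hg : Sm g (bodyMap F z)) :
    pull F (f * g) z = pull F f z * pull F g z := by
  rw [pull_eq, pull_eq, pull_eq, ← taylor_mul hF.even_nilPart body_nilPart hf.substOdd hg.substOdd]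
  congr 1
  funext y; exact oddSubst_mul hF.odd _ _

theorem pull_const (c : Gr κ') :
    pull F (fun _ => c) z = oddSubst (fun j => F (Sum.inr j) z) c := taylor_const _

theorem pull_algebraMap (hF : MorAt F z) (r : ℝ) :
    pull F (fun _ => algebraMap ℝ (Gr κ') r) z = algebraMap ℝ (Gr κ) r := by
  rw [pull_const, oddSubst_algebraMap hF.odd]

theorem pull_zero : pull F (0 : SF ι' κ') z = 0 := by
  have h : (0 : SF ι' κ') = fun _ => 0 := rfl
  rw [h, pull_const, map_zero]

theorem pull_smul (hF : MorAt F z) (r : ℝ) (hf : Sm f (bodyMap F z)) :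
    pull F (r • f) z = r • pull F f z := by
  have h : r • f = (fun _ => algebraMap ℝ (Gr κ') r) * f := by
    funext y; simp [Algebra.smul_def]
  rw [h, pull_mul hF (sm_const _) hf, pull_algebraMap hF, Algebra.smul_def]

theorem pull_sub (hF : MorAt F z) (hf : Sm f (bodyMap F z)) (hg : Sm g (bodyMap F z)) :
    pull F (f - g) z = pull F f z - pull F g z := by
  have h : f - g = f + (-1 : ℝ) • g := by simp [sub_eq_add_neg]
  rw [h, pull_add hf (hg.smul _), pull_smul hF _ hg]
  simp [sub_eq_add_neg]

theorem pull_sum {α : Type*} {s : Finset α} {f : α → SF ι' κ'}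
    (hf : ∀ a ∈ s, Sm (f a) (bodyMap F z)) :
    pull F (∑ a ∈ s, f a) z = ∑ a ∈ s, pull F (f a) z := by
  classical
  induction s using Finset.induction_on with
  | empty => simp [pull_zero]
  | insert a s ha ih =>
    rw [Finset.sum_insert ha, Finset.sum_insert ha, pull_add (hf a (by simp))
      (sm_sum fun b hb => hf b (by simp [hb])), ih fun b hb => hf b (by simp [hb])]

theorem pull_coord (hF : MorAt F z) (c : ι' ⊕ κ') : pull F (coord c) z = F c z := by
  cases c with
  | inl b =>
    have h : substOdd F z (coord (Sum.inl b)) = fun x => algebraMap ℝ (Gr κ) (x b) := by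
      funext x; exact oddSubst_algebraMap hF.odd _
    rw [pull_eq, h, taylor_linear hF.even_nilPart body_nilPart]
    simp [nilPart, bodyMap]
  | inr j =>
    have h : (coord (Sum.inr j) : SF ι' κ') = fun _ => ExteriorAlgebra.ι ℝ (Pi.single j 1) := rfl
    rw [h, pull_const, oddSubst_ι hF.odd, oddComb_single]

theorem body_pull (hF : MorAt F z) : body (pull F f z) = body (f (bodyMap F z)) := by
  rw [pull_eq, body_taylor body_nilPart, substOdd, body_oddSubst hF.odd]

theorem parityInv_pull (hF : MorAt F z) (hf : Sm f (bodyMap F z)) :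
    parityInv (pull F f z) = pull F (fun y => parityInv (f y)) z := by
  rw [pull_eq, parityInv_taylor hF.even_nilPart hf.substOdd]
  congr 1
  funext y; exact parityInv_oddSubst hF.odd _

theorem hasPar_pull {p : ℕ} (hF : MorAt F z) (hf : Sm f (bodyMap F z))
    (hp : ∀ᶠ y in 𝓝 (bodyMap F z), HasPar p (f y)) : HasPar p (pull F f z) := by
  rw [HasPar, parityInv_pull hF hf, ← pull_smul hF _ hf]
  exact pull_congr hp

/-! #### Smoothness of pullbacks -/

theorem sm_oddSubst (hF : MorAt F z) (v : Gr κ') :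
    Sm (fun w => oddSubst (fun j => F (Sum.inr j) w) v) z := by
  induction v using gr_induction with
  | hr r =>
    refine (sm_const (algebraMap ℝ (Gr κ) r)).congr ?_
    filter_upwards [hF.eventually] with w hw
    rw [oddSubst_algebraMap hw.odd]
  | hadd x y hx hy =>
    refine (hx.add hy).congr (Eventually.of_forall fun w => ?_)
    simp
  | hmul u x hx =>
    have h : Sm (∑ j, u j • F (Sum.inr j)) z := sm_sum fun j _ => (hF.sm _).smul _
    refine (h.mul hx).congr ?_
    filter_upwards [hF.eventually] with w hw
    rw [oddSubst_mul hw.odd, oddSubst_ι hw.odd]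
    simp [oddComb, Fintype.linearCombination_apply]

/-- Expanding `f` in a basis of `Gr κ'` separates its smooth real coefficients from the
substitution, which also varies with the point. -/
theorem sm_substOdd (hF : MorAt F z) (hf : Sm f (bodyMap F z)) :
    Sm (fun w => substOdd F w f (bodyMap F w)) z := by
  have h : (fun w => substOdd F w f (bodyMap F w)) =
      ∑ i, fun w => grCoord κ' (f (bodyMap F w)) i •
        oddSubst (fun j => F (Sum.inr j) w) (Module.finBasis ℝ (Gr κ') i) := by
    funext w
    rw [substOdd, Finset.sum_apply]
    refine (congrArg _ ((Module.finBasis ℝ (Gr κ')).sum_equivFun (f (bodyMap F w))).symm).trans ?_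
    rw [map_sum]
    exact Finset.sum_congr rfl fun i _ => map_smul _ _ _
  rw [h]
  refine sm_sum fun i _ => ?_
  filter_upwards [hF.eventually, hF.tendsto_bodyMap.eventually hf.eventually,
    (sm_oddSubst hF (Module.finBasis ℝ (Gr κ') i)).eventually] with w hw hfw hv
  have h1 : ContDiffAt ℝ ∞ (fun w => f (bodyMap F w)) w :=
    hfw.contDiffAt.comp w hw.contDiffAt_bodyMap
  have h2 : ContDiffAt ℝ ∞ (fun w => grCoord κ' (f (bodyMap F w)) i) w :=
    ((LinearMap.proj i ∘ₗ (grCoord κ').toLinearMap).toContinuousLinearMap).contDiff.contDiffAt.comp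
      w h1
  exact h2.smul hv.contDiffAt

/-- The increments, the substitution and the base point all depend on `w`. Peeling off one
derivative and moving it through the substitution onto `f` reduces the order, with increments that
are smooth in `w`. -/
theorem sm_iterate_dirDeriv_substOdd (hF : MorAt F z) (k : ℕ) (hf : Sm f (bodyMap F z)) :
    Sm (fun w => (dirDeriv (nilPart F w))^[k] (substOdd F w f) (bodyMap F w)) z := by
  induction k generalizing f with
  | zero => exact sm_substOdd hF hf
  | succ k ih =>
    have hn : ∀ b, Sm (fun w => nilPart F w b) z := fun b => by
      refine (hF.sm (Sum.inl b)).sub (Sm.lin (Algebra.linearMap ℝ (Gr κ) ∘ₗ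
        (body (κ := κ)).toLinearMap) (hF.sm (Sum.inl b)))
    have h : Sm (∑ b, (fun w => nilPart F w b) * fun w => (dirDeriv (nilPart F w))^[k]
        (substOdd F w (pd (Sum.inl b) f)) (bodyMap F w)) z :=
      sm_sum fun b _ => (hn b).mul (ih (hf.pd (Sum.inl b)))
    refine h.congr ?_
    filter_upwards [hF.eventually, hF.tendsto_bodyMap.eventually hf.eventually] with w hw hfw
    rw [iterate_dirDeriv_succ hw.even_nilPart k hfw.substOdd]
    simp only [Finset.sum_apply, Pi.mul_apply]
    refine Finset.sum_congr rfl fun b _ => ?_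
    congr 1
    refine (iterate_dirDeriv_congr k ?_).self_of_nhds
    filter_upwards [hfw.eventually] with y hy
    exact (fderiv_lin _ hy.differentiableAt _).symm

theorem sm_pull (hF : MorAt F z) (hf : Sm f (bodyMap F z)) : Sm (pull F f) z := by
  have h : pull F f = ∑ k ∈ Finset.range (Fintype.card κ + 1), ((k.factorial : ℝ)⁻¹) •
      fun w => (dirDeriv (nilPart F w))^[k] (substOdd F w f) (bodyMap F w) := by
    funext w
    simp [pull_eq, taylor]
  rw [h]
  exact sm_sum fun k _ => (sm_iterate_dirDeriv_substOdd hF k hf).smul _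

theorem pull_coord_left (f : SF ι κ) : pull (coord : ι ⊕ κ → SF ι κ) f z = f z := by
  have h1 : nilPart (coord : ι ⊕ κ → SF ι κ) z = 0 := by
    funext b; simp [nilPart, coord]
  have h2 : bodyMap (coord : ι ⊕ κ → SF ι κ) z = z := by
    funext b; simp [bodyMap, coord]
  have hodd : ∀ j, parityInv ((coord (Sum.inr j) : SF ι κ) z) = -(coord (Sum.inr j) : SF ι κ) z :=
    fun j => hasPar_one_iff.1 (parityInv_coord _)
  rw [pull_eq, h1, h2, taylor_zero_increment, substOdd, oddSubst_eq hodd]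
  have h3 : oddSubstHom (fun j => (coord (Sum.inr j) : SF ι κ) z) hodd = AlgHom.id ℝ _ := by
    refine ExteriorAlgebra.hom_ext ?_
    refine LinearMap.pi_ext' fun j => LinearMap.ext_ring ?_
    simp [oddSubstHom, oddComb_single, coord]
  rw [h3]; rfl

end Pullback

/-! ### Hadamard's lemma and its consequences -/

section Hadamard

open Filter Topology MeasureTheory

/-- The integral is a convolution evaluated at the constant point 0, of the indicator of `(0, 1]`
with a function depending on the parameter `x`. Convolution evaluates that function at `0 - t`,
whence the reversed sign of `τ`. The bump `χ` equals 1 on `[-1, 1]` and supplies the compact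
support. -/
theorem contDiff_integral_segment {E G : Type*} [NormedAddCommGroup E] [NormedSpace ℝ E]
    [NormedAddCommGroup G] [NormedSpace ℝ G] {D : E → G} (hD : ContDiff ℝ ∞ D) (y : E) :
    ContDiff ℝ ∞ (fun x => ∫ t in (0 : ℝ)..1, D (y + t • (x - y))) := by
  let χ : ContDiffBump (0 : ℝ) := ⟨1, 2, by norm_num, by norm_num⟩
  have h := contDiffOn_convolution_right_with_param_comp (μ := (volume : Measure ℝ)) (n := ⊤)
    (ContinuousLinearMap.lsmul ℝ ℝ : ℝ →L[ℝ] G →L[ℝ] G) (s := (Set.univ : Set E))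
    (v := fun _ : E => (0 : ℝ)) contDiffOn_const
    (f := (Set.Ioc (0 : ℝ) 1).indicator fun _ => (1 : ℝ))
    (g := fun x τ => χ τ • D (y - τ • (x - y)))
    (k := Metric.closedBall 0 2) isOpen_univ (isCompact_closedBall _ _) ?_ ?_ ?_
  · rw [contDiffOn_univ] at h
    refine (congrArg (ContDiff ℝ ∞) (funext fun x => ?_)).mp h
    rw [convolution_def, intervalIntegral.integral_of_le zero_le_one,
      ← integral_indicator measurableSet_Ioc]
    refine integral_congr_ae (Eventually.of_forall fun t => ?_)
    by_cases ht : t ∈ Set.Ioc (0 : ℝ) 1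
    · have h1 : χ (0 - t) = 1 := χ.one_of_mem_closedBall (by
        simpa [χ, abs_of_pos ht.1] using ht.2)
      simp only [Set.indicator_of_mem ht, ContinuousLinearMap.lsmul_apply, h1, one_smul]
      congr 1; simp [sub_eq_add_neg, add_comm]
    · simp [Set.indicator_of_notMem ht]
  · intro p x _ hx
    have : χ x = 0 := χ.zero_of_le_dist (by
      simpa [χ] using (not_le.1 fun h' => hx (Metric.mem_closedBall.2 h')).le)
    simp [this]
  · exact ((integrable_indicator_iff measurableSet_Ioc).2
      (integrableOn_const (by simp))).locallyIntegrable
  · refine ContDiff.contDiffOn ?_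
    have h1 : ContDiff ℝ ∞ (fun p : E × ℝ => χ p.2) := χ.contDiff.comp contDiff_snd
    have h2 : ContDiff ℝ ∞ (fun p : E × ℝ => D (y - p.2 • (p.1 - y))) :=
      hD.comp (contDiff_const.sub (contDiff_snd.smul (contDiff_fst.sub contDiff_const)))
    exact h1.smul h2

variable {ι κ : Type*} [Fintype ι] [DecidableEq ι] [Fintype κ] [DecidableEq κ]

/-- Multiplication by a bump function supported inside the ball of smoothness gives a global
representative of the germ, so that integrals along segments need no domain conditions. -/
theorem Sm.exists_contDiff {f : (ι → ℝ) → Gr κ} {y : ι → ℝ} (hf : Sm f y) :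
    ∃ g : (ι → ℝ) → Gr κ, ContDiff ℝ ∞ g ∧ f =ᶠ[𝓝 y] g := by
  obtain ⟨r, hr, hball⟩ := Metric.eventually_nhds_iff_ball.1 hf
  let χ : ContDiffBump y := ⟨r / 3, r / 2, by positivity, by linarith⟩
  refine ⟨fun x => χ x • f x, contDiff_iff_contDiffAt.2 fun x => ?_, ?_⟩
  · by_cases hx : x ∈ Metric.ball y r
    · exact χ.contDiff.contDiffAt.smul (hball x hx)
    · have h : x ∉ tsupport χ := by
        rw [χ.tsupport_eq]
        intro h
        have h1 := Metric.mem_closedBall.1 h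
        rw [Metric.mem_ball, not_lt] at hx
        have : χ.rOut = r / 2 := rfl
        linarith
      have h0 : (fun x => χ x • f x) =ᶠ[𝓝 x] fun _ => 0 := by
        filter_upwards [notMem_tsupport_iff_eventuallyEq.1 h] with w hw
        rw [hw]; simp
      exact contDiffAt_const.congr_of_eventuallyEq h0
  · filter_upwards [χ.eventuallyEq_one] with x hx
    rw [hx]; simp

/-- Integrate the derivative of `t ↦ g (y + t (x - y))` over `[0, 1]`; the cofactors `h b` are the
integrals of the partial derivatives of `g`. -/
theorem Sm.hadamard {f : SF ι κ} {y : ι → ℝ} (hf : Sm f y) :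
    ∃ h : ι → SF ι κ, (∀ b, Sm (h b) y) ∧ f =ᶠ[𝓝 y] (fun _ => f y) +
      ∑ b, (coord (Sum.inl b) - fun _ => algebraMap ℝ (Gr κ) (y b)) * h b := by
  obtain ⟨g, hg, hfg⟩ := hf.exists_contDiff
  have hd : ∀ b : ι, ContDiff ℝ ∞ (fun x => _root_.fderiv ℝ g x (Pi.single b 1)) := fun b =>
    (hg.fderiv_right (m := ∞) (by simp)).clm_apply contDiff_const
  refine ⟨fun b x => ∫ t in (0 : ℝ)..1, _root_.fderiv ℝ g (y + t • (x - y)) (Pi.single b 1),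
    fun b => Eventually.of_forall fun x =>
      (contDiff_integral_segment (hd b) y).contDiffAt, ?_⟩
  filter_upwards [hfg] with x hx
  have := FiniteDimensional.complete ℝ (Gr κ)
  have hder : ∀ t : ℝ, HasDerivAt (fun t : ℝ => g (y + t • (x - y)))
      (_root_.fderiv ℝ g (y + t • (x - y)) (x - y)) t := by
    intro t
    have h1 : HasDerivAt (fun t : ℝ => y + t • (x - y)) (x - y) t := by
      simpa using ((hasDerivAt_id t).smul_const (x - y)).const_add y
    exact ((hg.differentiable (by simp)) _).hasFDerivAt.comp_hasDerivAt t h1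
  have hcont : ∀ v : ι → ℝ, Continuous fun t : ℝ => _root_.fderiv ℝ g (y + t • (x - y)) v := fun v =>
    ((hg.continuous_fderiv (by simp)).comp (by fun_prop)).clm_apply continuous_const
  have key := intervalIntegral.integral_eq_sub_of_hasDerivAt (a := 0) (b := 1)
    (fun t _ => hder t) ((hcont _).intervalIntegrable _ _)
  have hexp : ∀ t : ℝ, _root_.fderiv ℝ g (y + t • (x - y)) (x - y) =
      ∑ b, (x b - y b) • _root_.fderiv ℝ g (y + t • (x - y)) (Pi.single b 1) := by
    intro t
    have h1 : ∀ (A : (ι → ℝ) →L[ℝ] Gr κ) (v : ι → ℝ),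
        A v = ∑ b, v b • A (Pi.single b 1) := by
      intro A v
      conv_lhs => rw [pi_eq_sum_univ' v, map_sum]
      refine Finset.sum_congr rfl fun b _ => ?_
      rw [map_smul]
    exact h1 _ _
  have hint : ∀ b ∈ Finset.univ, IntervalIntegrable (fun t : ℝ =>
      (x b - y b) • _root_.fderiv ℝ g (y + t • (x - y)) (Pi.single b 1)) volume 0 1 :=
    fun b _ => ((hcont _).const_smul (x b - y b)).intervalIntegrable _ _
  simp only [hexp] at key
  rw [intervalIntegral.integral_finsetSum hint] at key
  simp only [intervalIntegral.integral_smul, one_smul, zero_smul, add_zero, add_sub_cancel] at key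
  simp only [Pi.add_apply, Finset.sum_apply, Pi.mul_apply, Pi.sub_apply, coord, ← map_sub,
    ← Algebra.smul_def]
  rw [key, hx, hfg.self_of_nhds]
  abel

variable {ι' κ' : Type*} [Fintype ι'] [DecidableEq ι'] [Fintype κ'] [DecidableEq κ']

/-- A germ functional that kills constants and is linear over the coordinates, acting through
nilpotent elements, vanishes. -/
theorem eq_zero_of_nilpotent {Δ : SF ι' κ' → Gr κ} {y : ι' → ℝ} {n : ι' → Gr κ}
    (hn : ∀ b, body (n b) = 0) (hcongr : ∀ f g, f =ᶠ[𝓝 y] g → Δ f = Δ g)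
    (hadd : ∀ f g, Sm f y → Sm g y → Δ (f + g) = Δ f + Δ g) (hconst : ∀ c, Δ (fun _ => c) = 0)
    (hmul : ∀ b h, Sm h y →
      Δ ((coord (Sum.inl b) - fun _ => algebraMap ℝ (Gr κ') (y b)) * h) = n b * Δ h)
    {f : SF ι' κ'} (hf : Sm f y) : Δ f = 0 := by
  have hs : ∀ b, Sm (coord (Sum.inl b) - fun _ => algebraMap ℝ (Gr κ') (y b) : SF ι' κ') y :=
    fun b => (sm_coord _).sub (sm_const _)
  have hsum : ∀ (s : Finset ι') (h : ι' → SF ι' κ'), (∀ b, Sm (h b) y) →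
      Δ (∑ b ∈ s, h b) = ∑ b ∈ s, Δ (h b) := by
    intro s h hh
    induction s using Finset.induction_on with
    | empty => exact hconst 0
    | insert a s ha ih =>
      rw [Finset.sum_insert ha, Finset.sum_insert ha, hadd _ _ (hh a) (sm_sum fun b _ => hh b), ih]
  -- Each use of Hadamard's lemma replaces `Δ f` by a combination of `Δ (h b)` with nilpotent
  -- coefficients, gaining one power of the ideal.
  refine eq_zero_of_mem_aug fun k => ?_
  induction k generalizing f with
  | zero => exact mem_aug_zero _
  | succ k ih =>
    obtain ⟨h, hh, hfh⟩ := hf.hadamard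
    rw [hcongr _ _ hfh, hadd _ _ (sm_const _) (sm_sum fun b _ => (hs b).mul (hh b)), hconst,
      zero_add, hsum _ _ fun b => (hs b).mul (hh b)]
    refine Submodule.sum_mem _ fun b _ => ?_
    rw [hmul b _ (hh b)]
    exact mul_mem_aug_succ (hn b) (ih (hh b))

theorem bodyMap_pull {ι'' κ'' : Type*} [Fintype ι''] [DecidableEq ι''] [Fintype κ'']
    [DecidableEq κ''] {F : ι' ⊕ κ' → SF ι κ} {G : ι'' ⊕ κ'' → SF ι' κ'} {z : ι → ℝ}
    (hF : MorAt F z) : bodyMap (fun c => pull F (G c)) z = bodyMap G (bodyMap F z) := by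
  funext b
  exact body_pull hF

theorem MorAt.comp {ι'' κ'' : Type*} [Fintype ι''] [DecidableEq ι''] [Fintype κ'']
    [DecidableEq κ''] {F : ι' ⊕ κ' → SF ι κ} {G : ι'' ⊕ κ'' → SF ι' κ'} {z : ι → ℝ}
    (hF : MorAt F z) (hG : MorAt G (bodyMap F z)) : MorAt (fun c => pull F (G c)) z where
  sm c := sm_pull hF (hG.sm c)
  parity := by
    filter_upwards [hF.eventually, hF.tendsto_bodyMap.eventually hG.eventually] with w hw hGw c
    refine hasPar_pull hw (hGw.sm c) ?_
    filter_upwards [hGw.parity] with y hy using hy c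

/-- Functoriality of pullbacks. -/
theorem pull_pull {ι'' κ'' : Type*} [Fintype ι''] [DecidableEq ι''] [Fintype κ'']
    [DecidableEq κ''] {F : ι' ⊕ κ' → SF ι κ} {G : ι'' ⊕ κ'' → SF ι' κ'} {z : ι → ℝ}
    (hF : MorAt F z) (hG : MorAt G (bodyMap F z)) {f : SF ι'' κ''}
    (hf : Sm f (bodyMap G (bodyMap F z))) :
    pull F (pull G f) z = pull (fun c => pull F (G c)) f z := by
  have hFG := hF.comp hG
  have hy := bodyMap_pull (G := G) hF
  rw [← sub_eq_zero]
  -- Both sides are multiplicative in `f` and agree on coordinates, so their difference satisfies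
  -- the hypotheses; the factor x^b - y^b becomes the nilpotent part of the composite.
  refine eq_zero_of_nilpotent (y := bodyMap G (bodyMap F z))
    (Δ := fun f => pull F (pull G f) z - pull (fun c => pull F (G c)) f z)
    (n := nilPart (fun c => pull F (G c)) z) body_nilPart ?_ ?_ ?_ ?_ hf
  · intro f g hfg
    congr 1
    · refine pull_congr ?_
      filter_upwards [hG.tendsto_bodyMap.eventually hfg.eventuallyEq_nhds] with w hw
        using pull_congr hw
    · exact pull_congr (by rwa [hy])
  · intro f g hf hg
    have h1 : pull G (f + g) =ᶠ[𝓝 (bodyMap F z)] pull G f + pull G g := by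
      filter_upwards [hG.tendsto_bodyMap.eventually hf.eventually,
        hG.tendsto_bodyMap.eventually hg.eventually] with w hw hw' using pull_add hw hw'
    rw [pull_congr h1, pull_add (sm_pull hG hf) (sm_pull hG hg),
      pull_add (by rwa [hy]) (by rwa [hy])]
    abel
  · intro c
    rw [sub_eq_zero, pull_const]
    have h0 : pull G (fun _ => c) = fun w => oddSubst (fun j => G (Sum.inr j) w) c := by
      funext w; exact pull_const c
    rw [h0]
    -- A constant is a polynomial in the odd generators, on which both substitutions agree.
    induction c using gr_induction with
    | hr r =>
      have h : (fun w => oddSubst (fun j => G (Sum.inr j) w) (algebraMap ℝ (Gr κ'') r))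
          =ᶠ[𝓝 (bodyMap F z)] fun _ => algebraMap ℝ (Gr κ') r := by
        filter_upwards [hG.eventually] with w hw using oddSubst_algebraMap hw.odd r
      rw [pull_congr h, pull_algebraMap hF, oddSubst_algebraMap hFG.odd]
    | hadd x y hx hy =>
      have hx0 : pull G (fun _ => x) = fun w => oddSubst (fun j => G (Sum.inr j) w) x := by
        funext w; exact pull_const x
      have hy0 : pull G (fun _ => y) = fun w => oddSubst (fun j => G (Sum.inr j) w) y := by
        funext w; exact pull_const y
      have h : (fun w => oddSubst (fun j => G (Sum.inr j) w) (x + y)) =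
          (fun w => oddSubst (fun j => G (Sum.inr j) w) x) +
            fun w => oddSubst (fun j => G (Sum.inr j) w) y := by
        funext w; simp
      rw [h, pull_add (sm_oddSubst hG x) (sm_oddSubst hG y), hx hx0, hy hy0, map_add]
    | hmul u x hx =>
      have hx0 : pull G (fun _ => x) = fun w => oddSubst (fun j => G (Sum.inr j) w) x := by
        funext w; exact pull_const x
      have hs : Sm (∑ j, u j • G (Sum.inr j)) (bodyMap F z) :=
        sm_sum fun j _ => (hG.sm _).smul _
      have h : (fun w => oddSubst (fun j => G (Sum.inr j) w) (ExteriorAlgebra.ι ℝ u * x))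
          =ᶠ[𝓝 (bodyMap F z)] (∑ j, u j • G (Sum.inr j)) *
            fun w => oddSubst (fun j => G (Sum.inr j) w) x := by
        filter_upwards [hG.eventually] with w hw
        rw [oddSubst_mul hw.odd, oddSubst_ι hw.odd]
        simp [oddComb, Fintype.linearCombination_apply]
      rw [pull_congr h, pull_mul hF hs (sm_oddSubst hG x), hx hx0, oddSubst_mul hFG.odd,
        oddSubst_ι hFG.odd, pull_sum fun j _ => (hG.sm _).smul _]
      congr 1
      simp only [oddComb, Fintype.linearCombination_apply]
      exact Finset.sum_congr rfl fun j _ => pull_smul hF _ (hG.sm _)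
  · intro b h hh
    have hs : ∀ {w}, Sm (coord (Sum.inl b) -
        fun _ => algebraMap ℝ (Gr κ'') (bodyMap G (bodyMap F z) b) : SF ι'' κ'') w :=
      (sm_coord _).sub (sm_const _)
    have h1 : pull G ((coord (Sum.inl b) -
          fun _ => algebraMap ℝ (Gr κ'') (bodyMap G (bodyMap F z) b)) * h)
        =ᶠ[𝓝 (bodyMap F z)] (G (Sum.inl b) -
          fun _ => algebraMap ℝ (Gr κ') (bodyMap G (bodyMap F z) b)) * pull G h := by
      filter_upwards [hG.eventually, hG.tendsto_bodyMap.eventually hh.eventually] with w hw hhw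
      rw [pull_mul hw hs hhw, pull_sub hw (sm_coord _) (sm_const _), pull_coord hw,
        pull_algebraMap hw]
      rfl
    rw [pull_congr h1, pull_mul hF ((hG.sm _).sub (sm_const _)) (sm_pull hG hh),
      pull_sub hF (hG.sm _) (sm_const _), pull_algebraMap hF,
      pull_mul hFG hs (by rwa [hy]), pull_sub hFG (sm_coord _) (sm_const _), pull_coord hFG,
      pull_algebraMap hFG, ← mul_sub, nilPart, body_pull hF]
    rfl

end Hadamard

/-! ### The chain rule -/

section ChainRule

open Filter Topology

variable {ι κ ι' κ' : Type*} [Fintype ι] [DecidableEq ι] [Fintype κ] [DecidableEq κ]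
  [Fintype ι'] [DecidableEq ι'] [Fintype κ'] [DecidableEq κ']
  {F : ι' ⊕ κ' → SF ι κ} {z : ι → ℝ} {f : SF ι' κ'}

theorem pd_algebraMap (a : ι ⊕ κ) (r : ℝ) :
    pd a (fun _ => algebraMap ℝ (Gr κ) r) z = 0 := by
  cases a with
  | inl i => exact pd_const_inl i _
  | inr j => exact oddDer_algebraMap j r

theorem MorAt.hasPar_pd (hF : MorAt F z) (a : ι ⊕ κ) (c : ι' ⊕ κ') :
    HasPar (par c + par a) (pd a (F c) z) :=
  SuperGeom.hasPar_pd a (hF.parity.mono fun _ h => h c) (hF.sm c).differentiableAt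

/-- This is the chain rule for functions of the odd variables alone. In the inductive step the
Leibniz sign of `a` and the sign of exchanging `∂_a F_j` with an odd factor combine to the minus
sign in `oddDer_ι_mul`. -/
theorem pd_oddSubst (hF : MorAt F z) (a : ι ⊕ κ) (v : Gr κ') :
    pd a (fun w => oddSubst (fun j => F (Sum.inr j) w) v) z =
      ∑ j, pd a (F (Sum.inr j)) z * oddSubst (fun j => F (Sum.inr j) z) (oddDer j v) := by
  induction v using gr_induction with
  | hr r =>
    have h : (fun w => oddSubst (fun j => F (Sum.inr j) w) (algebraMap ℝ (Gr κ') r))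
        =ᶠ[𝓝 z] fun _ => algebraMap ℝ (Gr κ) r := by
      filter_upwards [hF.eventually] with w hw using oddSubst_algebraMap hw.odd r
    rw [(pd_congr a h).self_of_nhds, pd_algebraMap]
    simp
  | hadd x y hx hy =>
    have h : (fun w => oddSubst (fun j => F (Sum.inr j) w) (x + y)) =
        (fun w => oddSubst (fun j => F (Sum.inr j) w) x) +
          fun w => oddSubst (fun j => F (Sum.inr j) w) y := by
      funext w; simp
    rw [h, pd_add a (sm_oddSubst hF x).differentiableAt (sm_oddSubst hF y).differentiableAt,
      hx, hy, ← Finset.sum_add_distrib]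
    simp only [map_add, mul_add]
  | hmul u x hx =>
    have hs : Sm (∑ j, u j • F (Sum.inr j)) z := sm_sum fun j _ => (hF.sm _).smul _
    have h : (fun w => oddSubst (fun j => F (Sum.inr j) w) (ExteriorAlgebra.ι ℝ u * x))
        =ᶠ[𝓝 z] (∑ j, u j • F (Sum.inr j)) *
          fun w => oddSubst (fun j => F (Sum.inr j) w) x := by
      filter_upwards [hF.eventually] with w hw
      rw [oddSubst_mul hw.odd, oddSubst_ι hw.odd]
      simp [oddComb, Fintype.linearCombination_apply]
    have hz : (∑ j, u j • F (Sum.inr j)) z = oddComb (fun j => F (Sum.inr j) z) u := by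
      simp [oddComb, Fintype.linearCombination_apply]
    have hp : HasPar 1 ((∑ j, u j • F (Sum.inr j)) z) := by
      rw [hz]; exact hasPar_one_iff.2 (parityInv_oddComb hF.odd u)
    rw [(pd_congr a h).self_of_nhds, pd_mul_of_hasPar a hs.differentiableAt
      (sm_oddSubst hF x).differentiableAt hp, hx,
      pd_sum a fun j _ => ((hF.sm _).smul _).differentiableAt, Finset.sum_mul, Finset.mul_sum,
      Finset.smul_sum, ← Finset.sum_add_distrib]
    refine Finset.sum_congr rfl fun j _ => ?_
    rw [pd_smul, oddDer_ι_mul, map_sub, map_smul, oddSubst_mul hF.odd, oddSubst_ι hF.odd, ← hz,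
      mul_sub, mul_smul_comm, smul_mul_assoc, sub_eq_add_neg, ← mul_assoc, ← mul_assoc,
      (hF.hasPar_pd a (Sum.inr j)).mul_comm hp]
    congr 1
    rw [smul_mul_assoc, ← neg_smul]
    congr 1
    simp [par, pow_add]

/-- The chain rule. -/
theorem pd_pull (hF : MorAt F z) (hf : Sm f (bodyMap F z)) (a : ι ⊕ κ) :
    pd a (pull F f) z = ∑ c, pd a (F c) z * pull F (pd c f) z := by
  rw [← sub_eq_zero]
  -- Both sides obey the Leibniz rule over pullback, so on a product with x^b - y^b the terms that
  -- differentiate this factor cancel and only the nilpotent multiple of the defect remains.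
  refine eq_zero_of_nilpotent (y := bodyMap F z)
    (Δ := fun f => pd a (pull F f) z - ∑ c, pd a (F c) z * pull F (pd c f) z)
    (n := nilPart F z) body_nilPart ?_ ?_ ?_ ?_ hf
  · intro f g hfg
    have h : pull F f =ᶠ[𝓝 z] pull F g := by
      filter_upwards [hF.tendsto_bodyMap.eventually hfg.eventuallyEq_nhds] with w hw
        using pull_congr hw
    simp only [(pd_congr a h).self_of_nhds, pull_congr (pd_congr _ hfg)]
  · intro f g hf hg
    have h : pull F (f + g) =ᶠ[𝓝 z] pull F f + pull F g := by
      filter_upwards [hF.tendsto_bodyMap.eventually hf.eventually,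
        hF.tendsto_bodyMap.eventually hg.eventually] with w hw hw' using pull_add hw hw'
    have h2 : ∀ c, pull F (pd c (f + g)) z = pull F (pd c f) z + pull F (pd c g) z := by
      intro c
      rw [← pull_add (hf.pd c) (hg.pd c)]
      refine pull_congr ?_
      filter_upwards [hf.eventually, hg.eventually] with y hy hy'
        using pd_add c hy.differentiableAt hy'.differentiableAt
    simp only [(pd_congr a h).self_of_nhds, h2, mul_add, Finset.sum_add_distrib,
      pd_add a (sm_pull hF hf).differentiableAt (sm_pull hF hg).differentiableAt]
    abel
  · intro v
    have h : pull F (fun _ => v) = fun w => oddSubst (fun j => F (Sum.inr j) w) v := by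
      funext w; exact pull_const v
    have h1 : ∀ b, pd (Sum.inl b) (fun _ => v : SF ι' κ') = 0 := by
      intro b; funext y; exact pd_const_inl b v
    have h2 : ∀ j, pd (Sum.inr j) (fun _ => v : SF ι' κ') = fun _ => oddDer j v := fun _ => rfl
    rw [h, pd_oddSubst hF, Fintype.sum_sum_type]
    simp [h1, h2, pull_zero, pull_const]
  · intro b h hh
    set y := bodyMap F z with hy
    have hs : ∀ {w}, Sm (coord (Sum.inl b) - fun _ => algebraMap ℝ (Gr κ') (y b) : SF ι' κ') w :=
      (sm_coord _).sub (sm_const _)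
    have hs' : Sm (F (Sum.inl b) - fun _ => algebraMap ℝ (Gr κ) (y b)) z :=
      (hF.sm _).sub (sm_const _)
    have h1 : pull F ((coord (Sum.inl b) - fun _ => algebraMap ℝ (Gr κ') (y b)) * h)
        =ᶠ[𝓝 z] (F (Sum.inl b) - fun _ => algebraMap ℝ (Gr κ) (y b)) * pull F h := by
      filter_upwards [hF.eventually, hF.tendsto_bodyMap.eventually hh.eventually] with w hw hhw
      rw [pull_mul hw hs hhw, pull_sub hw (sm_coord _) (sm_const _), pull_coord hw,
        pull_algebraMap hw]
      rfl
    have hp : HasPar 0 ((F (Sum.inl b) - (fun _ => algebraMap ℝ (Gr κ) (y b)) : SF ι κ) z) :=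
      hasPar_zero_iff.2 (hF.even_nilPart b)
    have h2 : ∀ c, pull F (pd c ((coord (Sum.inl b) - fun _ => algebraMap ℝ (Gr κ') (y b)) * h)) z
        = (if Sum.inl b = c then 1 else 0) * pull F h z + nilPart F z b * pull F (pd c h) z := by
      intro c
      have h3 : pd c ((coord (Sum.inl b) - fun _ => algebraMap ℝ (Gr κ') (y b)) * h) =ᶠ[𝓝 y]
          (fun _ => algebraMap ℝ (Gr κ') (if Sum.inl b = c then 1 else 0)) * h +
            (coord (Sum.inl b) - fun _ => algebraMap ℝ (Gr κ') (y b)) * pd c h := by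
        filter_upwards [hh.eventually] with x hx
        have hpx : HasPar 0 ((coord (Sum.inl b) -
            fun _ => algebraMap ℝ (Gr κ') (y b) : SF ι' κ') x) :=
          HasPar.sub (parityInv_coord (Sum.inl b)) (hasPar_algebraMap _)
        rw [pd_mul_of_hasPar c hs.differentiableAt hx.differentiableAt hpx,
          pd_sub c (sm_coord _).differentiableAt (sm_const _).differentiableAt, pd_coord,
          pd_algebraMap]
        simp
      rw [pull_congr h3, pull_add ((sm_const _).mul hh) (hs.mul (hh.pd c)),
        pull_mul hF (sm_const _) hh, pull_mul hF hs (hh.pd c), pull_algebraMap hF,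
        pull_sub hF (sm_coord _) (sm_const _), pull_coord hF, pull_algebraMap hF]
      congr 2
      split_ifs <;> simp
    rw [(pd_congr a h1).self_of_nhds, pd_mul_of_hasPar a hs'.differentiableAt
      (sm_pull hF hh).differentiableAt hp, pd_sub a (hF.sm _).differentiableAt
      (sm_const _).differentiableAt, pd_algebraMap]
    have h4 : (F (Sum.inl b) - (fun _ => algebraMap ℝ (Gr κ) (y b)) : SF ι κ) z = nilPart F z b := rfl
    simp only [h2, h4, mul_add, Finset.sum_add_distrib, mul_sub, Finset.mul_sum, sub_zero, mul_zero,
      pow_zero, one_smul, ← mul_assoc, mul_comm_of_even (hF.even_nilPart b)]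
    simp

end ChainRule

/-! ### Total spaces and fibrewise Legendre transforms in a chart -/

section Chart

open Filter Topology

variable {ι κ : Type*} [Fintype ι] [DecidableEq ι] [Fintype κ] [DecidableEq κ]

theorem bas_injective : Function.Injective (bas : ι ⊕ κ → _) := by
  rintro (i | j) (i' | j') h <;> simp_all [bas]

theorem fib_injective : Function.Injective (fib : ι ⊕ κ → _) := by
  rintro (i | j) (i' | j') h <;> simp_all [fib]

theorem bas_ne_fib (a b : ι ⊕ κ) : bas a ≠ fib b := by
  rcases a with i | j <;> rcases b with i' | j' <;> simp [bas, fib]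

theorem bas_or_fib (c : (ι ⊕ κ) ⊕ (κ ⊕ ι)) : (∃ a, c = bas a) ∨ ∃ a, c = fib a := by
  rcases c with (i | j) | (j | i)
  · exact Or.inl ⟨Sum.inl i, rfl⟩
  · exact Or.inr ⟨Sum.inr j, rfl⟩
  · exact Or.inl ⟨Sum.inr j, rfl⟩
  · exact Or.inr ⟨Sum.inl i, rfl⟩

theorem forall_tot {p : (ι ⊕ κ) ⊕ (κ ⊕ ι) → Prop} (hb : ∀ a, p (bas a)) (hf : ∀ a, p (fib a))
    (c) : p c := by
  rcases bas_or_fib c with ⟨a, rfl⟩ | ⟨a, rfl⟩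
  exacts [hb a, hf a]

theorem sum_tot {R : Type*} [AddCommMonoid R] (g : (ι ⊕ κ) ⊕ (κ ⊕ ι) → R) :
    ∑ c, g c = ∑ a, g (bas a) + ∑ a, g (fib a) := by
  simp only [Fintype.sum_sum_type, bas, fib]
  abel

@[simp] theorem joint_bas {S : Type*} (f g : ι ⊕ κ → S) (a : ι ⊕ κ) :
    joint f g (bas a) = f a := by
  cases a <;> rfl

@[simp] theorem joint_fib {S : Type*} (f g : ι ⊕ κ → S) (a : ι ⊕ κ) :
    joint f g (fib a) = g a := by
  cases a <;> rfl

theorem par_bas (a : ι ⊕ κ) : par (bas a) = par a := by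
  cases a <;> rfl

/-- The numbers `par (fib a)` and `par a + 1` agree only modulo 2: for odd `a` they are 0 and 2. -/
theorem hasPar_fib_iff {x : Gr (κ ⊕ ι)} (a : ι ⊕ κ) :
    HasPar (par (fib a)) x ↔ HasPar (par a + 1) x := by
  constructor <;> refine hasPar_of_even_add ?_ <;> cases a <;> simp [par, fib]

/-- The sign `(-1)^{ã+1}`. -/
def sgn (a : ι ⊕ κ) : ℝ := (-1) ^ (par a + 1)

theorem neg_one_pow_par_fib (a : ι ⊕ κ) : (-1 : ℝ) ^ par (fib a) = sgn a := by
  cases a <;> simp [par, fib, sgn]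

theorem sgn_mul_self (a : ι ⊕ κ) : sgn a * sgn a = 1 := by
  rw [sgn, ← mul_pow]; simp

theorem pd_bas_coord (a b : ι ⊕ κ) (z : ι ⊕ κ → ℝ) :
    pd (fib a) (coord (bas b) : SFTot ι κ) z = 0 := by
  rw [pd_coord, if_neg (bas_ne_fib b a)]

/-- The projection of the total space to the base. -/
def proj (a : ι ⊕ κ) : SFTot ι κ := coord (bas a)

/-- The base point under a point of the total space. -/
def basePt (z : ι ⊕ κ → ℝ) : ι → ℝ := fun i => z (Sum.inl i)

theorem lift_eq (f : SF ι κ) : lift f = pull proj f := rfl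

theorem morAt_proj (z : ι ⊕ κ → ℝ) : MorAt (proj : ι ⊕ κ → SFTot ι κ) z where
  sm _ := sm_coord _
  parity := Eventually.of_forall fun _ c => par_bas c ▸ parityInv_coord (bas c)

theorem bodyMap_proj (z : ι ⊕ κ → ℝ) : bodyMap (proj : ι ⊕ κ → SFTot ι κ) z = basePt z := by
  funext i; simp [bodyMap, proj, bas, coord, basePt]

variable {z : ι ⊕ κ → ℝ}

theorem sm_lift {f : SF ι κ} (hf : Sm f (basePt z)) : Sm (lift f) z :=
  sm_pull (F := proj) (morAt_proj z) (by rwa [bodyMap_proj])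

theorem pd_fib_lift {f : SF ι κ} (hf : Sm f (basePt z)) (a : ι ⊕ κ) :
    pd (fib a) (lift f) z = 0 := by
  rw [lift_eq, pd_pull (morAt_proj z) (by rwa [bodyMap_proj])]
  refine Finset.sum_eq_zero fun c _ => ?_
  rw [proj, pd_bas_coord, zero_mul]

theorem hasPar_lift {f : SF ι κ} {p : ℕ} (hf : Sm f (basePt z))
    (hp : ∀ᶠ y in 𝓝 (basePt z), HasPar p (f y)) : HasPar p (lift f z) :=
  hasPar_pull (F := proj) (morAt_proj z) (by rwa [bodyMap_proj]) (by rwa [bodyMap_proj])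

theorem basePt_bodyMap {F : (ι ⊕ κ) ⊕ (κ ⊕ ι) → SFTot ι κ}
    (hb : ∀ a, F (bas a) z = coord (bas a) z) : basePt (bodyMap F z) = basePt z := by
  funext i
  have h := congrArg body (hb (Sum.inl i))
  simp only [coord, bas, body_algebraMap] at h
  exact h

/-- A map over the identity of the base fixes functions that come from the base. -/
theorem pull_lift {F : (ι ⊕ κ) ⊕ (κ ⊕ ι) → SFTot ι κ} (hF : MorAt F z)
    (hb : ∀ a, F (bas a) z = coord (bas a) z) {f : SF ι κ} (hf : Sm f (basePt z)) :
    pull F (lift f) z = lift f z := by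
  rw [lift_eq, pull_pull hF (morAt_proj _) (by rwa [bodyMap_proj, basePt_bodyMap hb])]
  refine pull_congr_left fun a => ?_
  rw [proj, pull_coord hF, hb]

theorem Sm.euler {P : SFTot ι κ} (hP : Sm P z) : Sm (euler P) z :=
  sm_sum fun _ _ => (sm_coord _).mul (hP.pd _)

theorem hasPar_coord_fib (a : ι ⊕ κ) : HasPar (par a + 1) ((coord (fib a) : SFTot ι κ) z) :=
  (hasPar_fib_iff a).1 (parityInv_coord _)

theorem hasPar_pd_fib {P : SFTot ι κ} (hP : Sm P z) (he : ∀ᶠ x in 𝓝 z, HasPar 0 (P x))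
    (a : ι ⊕ κ) : HasPar (par a + 1) (pd (fib a) P z) := by
  have h := hasPar_pd (fib a) he hP.differentiableAt
  rw [zero_add] at h
  exact (hasPar_fib_iff a).1 h

theorem sgn_smul_comm {a : ι ⊕ κ} {x y : Gr (κ ⊕ ι)} (hx : HasPar (par a + 1) x)
    (hy : HasPar (par a + 1) y) : x * y = sgn a • (y * x) := by
  rw [hx.mul_comm hy]
  congr 1
  cases a <;> norm_num [par, sgn]

theorem hasPar_euler {P : SFTot ι κ} (hP : Sm P z) (he : ∀ᶠ x in 𝓝 z, HasPar 0 (P x)) :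
    HasPar 0 (euler P z) := by
  rw [euler, Finset.sum_apply]
  refine HasPar.sum fun a _ => hasPar_of_even_add ?_
    ((hasPar_coord_fib a).mul (hasPar_pd_fib hP he a))
  exact ⟨par a + 1, by ring⟩

/-- Derivatives of `∑ a, x^*_a ∂P/∂x^*_a`. -/
theorem pd_euler {P : SFTot ι κ} (hP : Sm P z) (he : ∀ᶠ x in 𝓝 z, HasPar 0 (P x))
    (e : (ι ⊕ κ) ⊕ (κ ⊕ ι)) : pd e (euler P) z =
      ∑ a, pd e (coord (fib a)) z * pd (fib a) P z +
        ∑ a, sgn a • (pd e (pd (fib a) P) z * coord (fib a) z) := by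
  rw [euler, pd_sum e fun a _ => ((sm_coord _).mul (hP.pd _)).differentiableAt,
    ← Finset.sum_add_distrib]
  refine Finset.sum_congr rfl fun a _ => ?_
  have hc : HasPar (par (fib a)) ((coord (fib a) : SFTot ι κ) z) := parityInv_coord _
  have hev : ∀ᶠ x in 𝓝 z, HasPar (0 + par (fib a)) (pd (fib a) P x) := by
    filter_upwards [eventually_eventually_nhds.2 he, hP.eventually] with x hx hx'
      using hasPar_pd (fib a) hx hx'.differentiableAt
  have hd := hasPar_pd e hev (hP.pd (fib a)).differentiableAt
  rw [pd_mul_of_hasPar e (sm_coord _).differentiableAt (hP.pd _).differentiableAt hc,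
    hc.mul_comm hd, smul_smul, ← neg_one_pow_par_fib, ← pow_add]
  congr 2
  -- In the Leibniz sign times the reordering sign the dependence on `e` cancels, leaving (-1)^{par
  -- (fib a)²} = `sgn a`.
  have : par e * par (fib a) + par (fib a) * (0 + par (fib a) + par e) =
      2 * (par e * par (fib a)) + par (fib a) * par (fib a) := by ring
  rw [this, pow_add, pow_mul]
  cases a <;> simp [par, fib]

theorem pd_fib_euler {P : SFTot ι κ} (hP : Sm P z) (he : ∀ᶠ x in 𝓝 z, HasPar 0 (P x))
    (b : ι ⊕ κ) : pd (fib b) (euler P) z =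
      pd (fib b) P z + ∑ a, sgn a • (pd (fib b) (pd (fib a) P) z * coord (fib a) z) := by
  rw [pd_euler hP he]
  congr 1
  rw [Finset.sum_eq_single b]
  · rw [pd_coord]; simp
  · intro a _ hab
    rw [pd_coord, if_neg (fun h => hab (fib_injective h)), zero_mul]
  · simp

theorem pd_bas_euler {P : SFTot ι κ} (hP : Sm P z) (he : ∀ᶠ x in 𝓝 z, HasPar 0 (P x))
    (b : ι ⊕ κ) : pd (bas b) (euler P) z =
      ∑ a, sgn a • (pd (bas b) (pd (fib a) P) z * coord (fib a) z) := by
  rw [pd_euler hP he, Finset.sum_eq_zero, zero_add]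
  intro a _
  rw [pd_coord, if_neg (fun h => bas_ne_fib b a h.symm), zero_mul]

/-- The map with base components `x^a` and fibre components `s a • ∂P/∂(fibre coordinate)`. -/
def leg (s : ι ⊕ κ → ℝ) (P : SFTot ι κ) : (ι ⊕ κ) ⊕ (κ ⊕ ι) → SFTot ι κ :=
  joint (fun a => coord (bas a)) (fun a => s a • pd (fib a) P)

/-- The map φ corresponds to s = `sgn` and ψ to s = 1. Inversion replaces s by s·`sgn` and so
exchanges the two. -/
theorem phi_eq_leg (P : SFTot ι κ) : phi P = leg sgn P := rfl

theorem psi_eq_leg (w : SFTot ι κ) : psi w = leg 1 w := by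
  simp [psi, leg]

@[simp] theorem leg_bas (s : ι ⊕ κ → ℝ) (P : SFTot ι κ) (a : ι ⊕ κ) :
    leg s P (bas a) = coord (bas a) := joint_bas _ _ a

@[simp] theorem leg_fib (s : ι ⊕ κ → ℝ) (P : SFTot ι κ) (a : ι ⊕ κ) :
    leg s P (fib a) = s a • pd (fib a) P := joint_fib _ _ a

theorem morAt_leg (s : ι ⊕ κ → ℝ) {P : SFTot ι κ} (hP : Sm P z)
    (he : ∀ᶠ x in 𝓝 z, HasPar 0 (P x)) : MorAt (leg s P) z where
  sm := forall_tot (fun a => by rw [leg_bas]; exact sm_coord _)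
    (fun a => by rw [leg_fib]; exact (hP.pd _).smul _)
  parity := by
    filter_upwards [hP.eventually, eventually_eventually_nhds.2 he] with x hx hx'
    refine forall_tot (fun a => ?_) (fun a => ?_)
    · rw [leg_bas]; exact parityInv_coord _
    · rw [leg_fib]; exact (hasPar_fib_iff a).2 ((hasPar_pd_fib hx hx' a).smul _)

/-- `F` and `G` are mutually inverse near `z`, respectively near the image of `z`. -/
structure InvAt (F G : (ι ⊕ κ) ⊕ (κ ⊕ ι) → SFTot ι κ) (z : ι ⊕ κ → ℝ) : Prop where
  left : MorAt F z
  right : MorAt G (bodyMap F z)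
  base : ∀ᶠ y in 𝓝 (bodyMap F z), ∀ a, G (bas a) y = coord (bas a) y
  left_inv : ∀ c, pull F (G c) z = coord c z
  right_inv : ∀ᶠ y in 𝓝 (bodyMap F z), ∀ c, pull G (F c) y = coord c y

theorem bodyMap_bodyMap_of_inv {F G : (ι ⊕ κ) ⊕ (κ ⊕ ι) → SFTot ι κ} (hF : MorAt F z)
    (h : ∀ c, pull F (G c) z = coord c z) : bodyMap G (bodyMap F z) = z := by
  funext b
  have h1 := congrArg body (h (Sum.inl b))
  rw [body_pull hF] at h1
  simp only [coord, body_algebraMap] at h1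
  exact h1

theorem pull_pull_of_inv {F G : (ι ⊕ κ) ⊕ (κ ⊕ ι) → SFTot ι κ} (hF : MorAt F z)
    (hG : MorAt G (bodyMap F z)) (h : ∀ c, pull F (G c) z = coord c z) {f : SFTot ι κ}
    (hf : Sm f z) : pull F (pull G f) z = f z := by
  rw [pull_pull hF hG (by rwa [bodyMap_bodyMap_of_inv hF h]), pull_congr_left h, pull_coord_left]

theorem InvAt.bodyMap_bodyMap {F G : (ι ⊕ κ) ⊕ (κ ⊕ ι) → SFTot ι κ} (h : InvAt F G z) :
    bodyMap G (bodyMap F z) = z := bodyMap_bodyMap_of_inv h.left h.left_inv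

/-- The vertical Jacobian of a local diffeomorphism over the identity is injective. -/
theorem InvAt.vertical_injective {F G : (ι ⊕ κ) ⊕ (κ ⊕ ι) → SFTot ι κ} (h : InvAt F G z)
    (hFz : ∀ c, Sm (F c) z) {v : ι ⊕ κ → Gr (κ ⊕ ι)}
    (hv : ∀ b, ∑ a, pd (fib b) (F (fib a)) z * v a = 0) (c : ι ⊕ κ) : v c = 0 := by
  have hz := h.bodyMap_bodyMap
  have hFG : ∀ c, Sm (F c) (bodyMap G (bodyMap F z)) := fun c => by rw [hz]; exact hFz c
  -- A left inverse of the vertical Jacobian: differentiate G^*F = id along the fibre near the image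
  -- of `z`, where the base components of `G` contribute nothing, and pull the result back along
  -- `F`.
  have key : ∀ b a, ∑ d, pull F (pd (fib b) (G (fib d))) z * pd (fib d) (F (fib a)) z =
      if a = b then 1 else 0 := by
    intro b a
    have h1 : ∑ d, pd (fib b) (G (fib d)) * pull G (pd (fib d) (F (fib a)))
        =ᶠ[𝓝 (bodyMap F z)] fun _ => algebraMap ℝ _ (if a = b then 1 else 0) := by
      have hS : ∀ᶠ y in 𝓝 (bodyMap F z), Sm (F (fib a)) (bodyMap G y) :=
        h.right.tendsto_bodyMap.eventually (hFG (fib a)).eventually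
      filter_upwards [h.right.eventually, eventually_eventually_nhds.2 h.base,
        eventually_eventually_nhds.2 h.right_inv, hS] with y hGy hby hiy hSy
      have h2 : pull G (F (fib a)) =ᶠ[𝓝 y] coord (fib a) := hiy.mono fun _ h => h _
      have h3 := (pd_congr (fib b) h2).self_of_nhds
      rw [pd_pull hGy hSy, sum_tot, Finset.sum_eq_zero, zero_add, pd_coord] at h3
      · simp only [Finset.sum_apply, Pi.mul_apply]
        rw [h3]
        by_cases hab : a = b
        · simp [hab]
        · rw [if_neg (fun h => hab (fib_injective h)), if_neg hab, map_zero]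
      · intro d _
        have h4 : G (bas d) =ᶠ[𝓝 y] coord (bas d) := hby.mono fun _ h => h _
        rw [(pd_congr (fib b) h4).self_of_nhds, pd_bas_coord, zero_mul]
    have h5 := pull_congr (F := F) h1
    have hs : ∀ d, Sm (pd (fib b) (G (fib d))) (bodyMap F z) := fun d => (h.right.sm _).pd _
    have hs' : ∀ d, Sm (pull G (pd (fib d) (F (fib a)))) (bodyMap F z) :=
      fun d => sm_pull h.right ((hFG _).pd _)
    rw [pull_sum fun d _ => (hs d).mul (hs' d), pull_algebraMap h.left] at h5
    have h6 : (if a = b then 1 else 0 : Gr (κ ⊕ ι)) =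
        algebraMap ℝ _ (if a = b then 1 else 0) := by split_ifs <;> simp
    rw [h6, ← h5]
    refine Finset.sum_congr rfl fun d _ => ?_
    rw [pull_mul h.left (hs d) (hs' d), pull_pull_of_inv h.left h.right h.left_inv ((hFz _).pd _)]
  calc v c = ∑ a, (if a = c then 1 else 0) * v a := by simp
    _ = ∑ a, ∑ d, pull F (pd (fib c) (G (fib d))) z * (pd (fib d) (F (fib a)) z * v a) := by
        refine Finset.sum_congr rfl fun a _ => ?_
        rw [← key c a, Finset.sum_mul]
        exact Finset.sum_congr rfl fun d _ => mul_assoc _ _ _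
    _ = ∑ d, pull F (pd (fib c) (G (fib d))) z * ∑ a, pd (fib d) (F (fib a)) z * v a := by
        rw [Finset.sum_comm]
        exact Finset.sum_congr rfl fun d _ => (Finset.mul_sum _ _ _).symm
    _ = 0 := Finset.sum_eq_zero fun d _ => by rw [hv, mul_zero]

/-! ### Derivatives of a fibrewise Legendre transform -/

section Legendre

variable {s : ι ⊕ κ → ℝ} {P w : SFTot ι κ}

/-- The fibre derivatives of the Legendre transform are the fibre coordinates. -/
theorem pull_pd_fib_legendre (hs : ∀ a, s a * s a = 1) {G : (ι ⊕ κ) ⊕ (κ ⊕ ι) → SFTot ι κ}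
    (h : InvAt (leg s P) G z) (hP : Sm P z) (he : ∀ᶠ x in 𝓝 z, HasPar 0 (P x))
    (hw : Sm w (bodyMap (leg s P) z)) (hL : pull (leg s P) w =ᶠ[𝓝 z] euler P - P) (a : ι ⊕ κ) :
    pull (leg s P) (pd (fib a) w) z = (s a * sgn a) • coord (fib a) z := by
  rw [← sub_eq_zero]
  -- The fibre derivative of `hL` loses ∂P against the first term of the derivative of the Euler
  -- expression. The remaining second derivatives of `P` are, up to s with s² = 1, the entries of
  -- the vertical Jacobian.
  refine h.vertical_injective h.left.sm
    (v := fun a => pull (leg s P) (pd (fib a) w) z - (s a * sgn a) • coord (fib a) z)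
    (fun b => ?_) a
  have h1 := (pd_congr (fib b) hL).self_of_nhds
  rw [pd_pull h.left hw, pd_sub _ hP.euler.differentiableAt hP.differentiableAt,
    pd_fib_euler hP he, add_sub_cancel_left, sum_tot, Finset.sum_eq_zero, zero_add] at h1
  · simp only [mul_sub, Finset.sum_sub_distrib, h1]
    rw [sub_eq_zero]
    refine Finset.sum_congr rfl fun a _ => ?_
    rw [leg_fib, pd_smul, smul_mul_smul_comm, ← mul_assoc, hs, one_mul]
  · intro d _
    rw [leg_bas, pd_bas_coord, zero_mul]

/-- The base derivatives of the Legendre transform. -/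
theorem pull_pd_bas_legendre (hs : ∀ a, s a * s a = 1) {G : (ι ⊕ κ) ⊕ (κ ⊕ ι) → SFTot ι κ}
    (h : InvAt (leg s P) G z) (hP : Sm P z) (he : ∀ᶠ x in 𝓝 z, HasPar 0 (P x))
    (hw : Sm w (bodyMap (leg s P) z)) (hL : pull (leg s P) w =ᶠ[𝓝 z] euler P - P) (b : ι ⊕ κ) :
    pull (leg s P) (pd (bas b) w) z = -pd (bas b) P z := by
  have h1 := (pd_congr (bas b) hL).self_of_nhds
  rw [pd_pull h.left hw, pd_sub _ hP.euler.differentiableAt hP.differentiableAt,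
    pd_bas_euler hP he, sum_tot, Finset.sum_eq_single b] at h1
  · have h2 : ∑ a, pd (bas b) (leg s P (fib a)) z * pull (leg s P) (pd (fib a) w) z =
        ∑ a, sgn a • (pd (bas b) (pd (fib a) P) z * coord (fib a) z) := by
      refine Finset.sum_congr rfl fun a _ => ?_
      rw [pull_pd_fib_legendre hs h hP he hw hL, leg_fib, pd_smul, smul_mul_smul_comm,
        ← mul_assoc, hs, one_mul]
    rw [h2, leg_bas, pd_coord, if_pos rfl, one_mul] at h1
    rw [eq_neg_iff_add_eq_zero]
    rw [← sub_eq_zero] at h1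
    rw [← h1]; abel
  · intro a _ hab
    rw [leg_bas, pd_coord, if_neg (fun h => hab (bas_injective h)), zero_mul]
  · simp

/-- The Legendre transform is involutive. -/
theorem pull_euler_sub_legendre (hs : ∀ a, s a * s a = 1)
    {G : (ι ⊕ κ) ⊕ (κ ⊕ ι) → SFTot ι κ} (h : InvAt (leg s P) G z) (hP : Sm P z)
    (he : ∀ᶠ x in 𝓝 z, HasPar 0 (P x)) (hw : Sm w (bodyMap (leg s P) z))
    (hL : pull (leg s P) w =ᶠ[𝓝 z] euler P - P) :
    pull (leg s P) (euler w - w) z = P z := by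
  have h1 : pull (leg s P) (euler w) z = euler P z := by
    rw [euler, euler, pull_sum fun a _ => (sm_coord _).mul (hw.pd _), Finset.sum_apply]
    refine Finset.sum_congr rfl fun a _ => ?_
    rw [pull_mul h.left (sm_coord _) (hw.pd _), pull_coord h.left,
      pull_pd_fib_legendre hs h hP he hw hL, leg_fib, Pi.smul_apply, smul_mul_smul_comm,
      ← mul_assoc, hs, one_mul, Pi.mul_apply,
      sgn_smul_comm (hasPar_coord_fib a) (hasPar_pd_fib hP he a)]
  rw [pull_sub h.left hw.euler hw, h1, hL.self_of_nhds, Pi.sub_apply, sub_sub_cancel]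

/-- The pullback of `dω` is `-½ [P, P]`. -/
theorem two_smul_pull_deRham {G : (ι ⊕ κ) ⊕ (κ ⊕ ι) → SFTot ι κ} (h : InvAt (phi P) G z)
    (hP : Sm P z) (he : ∀ x, HasPar 0 (P x)) (hw : Sm w (bodyMap (phi P) z))
    (hL : pull (phi P) w =ᶠ[𝓝 z] euler P - P) :
    (2 : ℝ) • pull (phi P) (deRham w) z = -schouten P P z := by
  have he' : ∀ᶠ x in 𝓝 z, HasPar 0 (P x) := Eventually.of_forall he
  rw [phi_eq_leg] at *
  -- On an even function each twist is multiplication by -1.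
  have h1 : ∀ k, signTwist^[k] P = (-1 : ℝ) ^ k • P := by
    intro k
    induction k with
    | zero => simp
    | succ k ih =>
      rw [Function.iterate_succ_apply', ih]
      funext x
      have := he x
      rw [hasPar_zero_iff] at this
      simp [signTwist, this, pow_succ]
  rw [deRham, schouten, pull_sum fun a _ => (sm_coord _).mul (hw.pd _), Finset.sum_apply,
    Finset.smul_sum, ← Finset.sum_neg_distrib]
  refine Finset.sum_congr rfl fun a _ => ?_
  rw [pull_mul h.left (sm_coord _) (hw.pd _), pull_coord h.left,
    pull_pd_bas_legendre sgn_mul_self h hP he' hw hL, leg_fib]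
  simp only [h1, Pi.sub_apply, Pi.mul_apply, Pi.smul_apply, pd_smul]
  have hb : HasPar (par a) (pd (bas a) P z) := by
    have h := hasPar_pd (bas a) he' hP.differentiableAt
    rwa [zero_add, par_bas] at h
  -- One of the parities ã and ã + 1 is even, so the factors commute and the two halves of the
  -- bracket coincide; hence the factor 2.
  have hcomm : pd (bas a) P z * pd (fib a) P z = pd (fib a) P z * pd (bas a) P z := by
    rw [hb.mul_comm (hasPar_pd_fib hP he' a), (Nat.even_mul_succ_self _).neg_one_pow, one_smul]
  rw [smul_mul_assoc, smul_mul_assoc, smul_mul_assoc, hcomm, mul_neg, sgn, pow_succ]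
  simp only [mul_neg_one, neg_smul, smul_neg, neg_neg]
  rw [two_smul]; abel

end Legendre

end Chart

/-! ### Legendre transforms for fibre-linear gluing data -/

section Global

open Filter Topology

variable {I ι κ : Type*} [Fintype ι] [DecidableEq ι] [Fintype κ] [DecidableEq κ]

theorem isOpen_overSet {D : Set (ι → ℝ)} (hD : IsOpen D) :
    IsOpen (overSet D : Set (ι ⊕ κ → ℝ)) :=
  hD.preimage (continuous_pi fun i => continuous_apply (Sum.inl i))

theorem mem_overSet {D : Set (ι → ℝ)} {z : ι ⊕ κ → ℝ} : z ∈ overSet D ↔ basePt z ∈ D := Iff.rfl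

/-- Gluing data of a bundle whose fibre coordinates transform linearly. -/
structure IsFibLinear (N : Gluing I (ι ⊕ κ) (κ ⊕ ι)) (o : I → I → Set (ι → ℝ)) : Prop where
  ov_eq : ∀ i j, N.ov i j = overSet (o i j)
  isOpen : ∀ i j, IsOpen (o i j)
  mor : ∀ i j, ∀ z ∈ N.ov i j, MorAt (N.tr i j) z
  euler_bas : ∀ i j, ∀ z ∈ N.ov i j, ∀ b, euler (N.tr i j (bas b)) z = 0
  euler_fib : ∀ i j, ∀ z ∈ N.ov i j, ∀ b, euler (N.tr i j (fib b)) z = N.tr i j (fib b) z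

variable {N N' : Gluing I (ι ⊕ κ) (κ ⊕ ι)} {o : I → I → Set (ι → ℝ)}
  {U V : I → Set (ι ⊕ κ → ℝ)}

theorem IsFibLinear.isOpen_ov (hN : IsFibLinear N o) (i j : I) : IsOpen (N.ov i j) := by
  rw [hN.ov_eq]; exact isOpen_overSet (hN.isOpen i j)

/-- New base coordinates have fibre degree 0 and new fibre coordinates degree 1, so the Euler field
has the same form in every chart. This is what makes EP - P a global function. -/
theorem IsFibLinear.euler_pull (hN : IsFibLinear N o) {i j : I} {z : ι ⊕ κ → ℝ}
    (hz : z ∈ N.ov i j) {f : SFTot ι κ} (hf : Sm f (bodyMap (N.tr i j) z)) :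
    euler (pull (N.tr i j) f) z = pull (N.tr i j) (euler f) z := by
  have hm := hN.mor i j z hz
  have h1 : euler (pull (N.tr i j) f) z =
      ∑ c, euler (N.tr i j c) z * pull (N.tr i j) (pd c f) z := by
    simp only [euler, Finset.sum_apply, Pi.mul_apply, pd_pull hm hf, Finset.mul_sum,
      Finset.sum_mul, mul_assoc]
    exact Finset.sum_comm
  rw [h1, sum_tot, Finset.sum_eq_zero, zero_add, euler,
    pull_sum fun a _ => (sm_coord _).mul (hf.pd _)]
  · refine Finset.sum_congr rfl fun b _ => ?_
    rw [hN.euler_fib i j z hz, pull_mul hm (sm_coord _) (hf.pd _), pull_coord hm]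
  · intro b _
    rw [hN.euler_bas i j z hz, zero_mul]

theorem SuperFn.sm {N : Gluing I ι κ} {U : I → Set (ι → ℝ)} (f : SuperFn N U)
    (hU : N.IsOpenSub U) {i : I} {z : ι → ℝ} (hz : z ∈ U i) : Sm (f.fn i) z :=
  sm_of_contDiffOn (hU.isOpen i) (f.smooth i) hz

theorem SuperFn.IsEven.hasPar {N : Gluing I ι κ} {U : I → Set (ι → ℝ)} {f : SuperFn N U}
    (hf : f.IsEven) (i : I) (z : ι → ℝ) : HasPar 0 (f.fn i z) := hasPar_zero_iff.2 (hf i z)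

theorem SuperFn.eq_of_eqOn {N : Gluing I ι κ} {U : I → Set (ι → ℝ)} {f g : SuperFn N U}
    (h : ∀ i, ∀ z ∈ U i, f.fn i z = g.fn i z) : f = g := by
  ext1
  funext i z
  by_cases hz : z ∈ U i
  · exact h i z hz
  · rw [f.zero_outside i z hz, g.zero_outside i z hz]

theorem IsBundleMap.morAt {F : I → (ι ⊕ κ) ⊕ (κ ⊕ ι) → SFTot ι κ} (hF : IsBundleMap N N' U V F)
    (hU : N.IsOpenSub U) {i : I} {z : ι ⊕ κ → ℝ} (hz : z ∈ U i) : MorAt (F i) z :=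
  (hF.isSuperMap i).morAt (hU.isOpen i) hz

theorem IsBundleMap.congr {F F' : I → (ι ⊕ κ) ⊕ (κ ⊕ ι) → SFTot ι κ}
    (hF : IsBundleMap N N' U V F) (hU : N.IsOpenSub U)
    (h : ∀ i, ∀ z ∈ U i, ∀ c, F' i c z = F i c z) : IsBundleMap N N' U V F' where
  isSuperMap i :=
    { smooth := fun c => ((hF.isSuperMap i).smooth c).congr fun z hz => h i z hz c
      parity := fun c z hz => by rw [h i z hz]; exact (hF.isSuperMap i).parity c z hz
      mapsTo := fun z hz => by
        have h1 : bodyMap (F' i) z = bodyMap (F i) z := by funext b; simp [bodyMap, h i z hz]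
        rw [h1]; exact (hF.isSuperMap i).mapsTo hz }
  base i z hz a := by rw [h i z hz]; exact hF.base i z hz a
  compat i j z hz c := by
    rw [pull_congr_left (h i z hz.1), ← hF.compat i j z hz c]
    refine pull_congr ?_
    have hmem : bodyMap (N.tr i j) z ∈ U j := (hU.compat i j z hz.2).1 hz.1
    filter_upwards [(hU.isOpen j).mem_nhds hmem] with y hy using h j y hy c

theorem AreInverse.symm {F G : I → (ι ⊕ κ) ⊕ (κ ⊕ ι) → SFTot ι κ} (h : AreInverse U V F G) :
    AreInverse V U G F := ⟨h.2, h.1⟩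

theorem AreInverse.congr_right {F G G' : I → (ι ⊕ κ) ⊕ (κ ⊕ ι) → SFTot ι κ}
    (h : AreInverse U V F G) (hF : IsBundleMap N N' U V F) (hV : N'.IsOpenSub V)
    (hG : ∀ i, ∀ z ∈ V i, ∀ c, G' i c z = G i c z) : AreInverse U V F G' := by
  refine ⟨fun i z hz c => ?_, fun i z hz c => ?_⟩
  · rw [← h.1 i z hz c]
    refine pull_congr ?_
    filter_upwards [(hV.isOpen i).mem_nhds ((hF.isSuperMap i).mapsTo hz)] with y hy
      using hG i y hy c
  · rw [pull_congr_left (hG i z hz), h.2 i z hz c]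

theorem AreInverse.invAt {F G : I → (ι ⊕ κ) ⊕ (κ ⊕ ι) → SFTot ι κ} (h : AreInverse U V F G)
    (hF : IsBundleMap N N' U V F) (hG : IsBundleMap N' N V U G) (hU : N.IsOpenSub U)
    (hV : N'.IsOpenSub V) {i : I} {z : ι ⊕ κ → ℝ} (hz : z ∈ U i) : InvAt (F i) (G i) z where
  left := hF.morAt hU hz
  right := hG.morAt hV ((hF.isSuperMap i).mapsTo hz)
  base := by
    filter_upwards [(hV.isOpen i).mem_nhds ((hF.isSuperMap i).mapsTo hz)] with y hy
      using hG.base i y hy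
  left_inv := h.1 i z hz
  right_inv := by
    filter_upwards [(hV.isOpen i).mem_nhds ((hF.isSuperMap i).mapsTo hz)] with y hy
      using h.2 i y hy

theorem AreInverse.pull_pull {F G : I → (ι ⊕ κ) ⊕ (κ ⊕ ι) → SFTot ι κ} (h : AreInverse U V F G)
    (hF : IsBundleMap N N' U V F) (hG : IsBundleMap N' N V U G) (hU : N.IsOpenSub U)
    (hV : N'.IsOpenSub V) {i : I} {z : ι ⊕ κ → ℝ} (hz : z ∈ U i) {f : SFTot ι κ} (hf : Sm f z) :
    pull (F i) (pull (G i) f) z = f z :=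
  pull_pull_of_inv (hF.morAt hU hz) (hG.morAt hV ((hF.isSuperMap i).mapsTo hz)) (h.1 i z hz) hf

/-- `w` is the Legendre transform of `P` along `leg s P`. -/
def IsLegendre (s : ι ⊕ κ → ℝ) (P : SuperFn N U) (w : SuperFn N' V) : Prop :=
  ∀ i, ∀ z ∈ U i, pull (leg s (P.fn i)) (w.fn i) z = euler (P.fn i) z - P.fn i z

theorem IsLegendre.eventuallyEq {s : ι ⊕ κ → ℝ} {P : SuperFn N U} {w : SuperFn N' V}
    (h : IsLegendre s P w) (hU : N.IsOpenSub U) {i : I} {z : ι ⊕ κ → ℝ} (hz : z ∈ U i) :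
    pull (leg s (P.fn i)) (w.fn i) =ᶠ[𝓝 z] euler (P.fn i) - P.fn i := by
  filter_upwards [(hU.isOpen i).mem_nhds hz] with y hy using h i y hy

/-! ### Existence, uniqueness and inversion of the global transform -/

section

variable {s : ι ⊕ κ → ℝ} {P : SuperFn N U}

/-- The only candidate is the pullback of EP - P along the inverse map `G`, extended by zero outside
`V`. -/
theorem exists_isLegendre (hN : IsFibLinear N o) (hN' : IsFibLinear N' o) (hU : N.IsOpenSub U)
    (hV : N'.IsOpenSub V) (hP : P.IsEven)
    (hd : IsDiffeo N N' U V fun i => leg s (P.fn i)) :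
    ∃ w : SuperFn N' V, IsLegendre s P w ∧ w.IsEven := by
  classical
  obtain ⟨hF, G, hG, hinv⟩ := hd
  have hL : ∀ {i z}, z ∈ U i → Sm (euler (P.fn i) - P.fn i) z := fun hz =>
    (P.sm hU hz).euler.sub (P.sm hU hz)
  have hpar : ∀ {i z}, z ∈ U i → ∀ᶠ y in 𝓝 z, HasPar 0 ((euler (P.fn i) - P.fn i) y) := by
    intro i z hz
    filter_upwards [(P.sm hU hz).eventually] with y hy
    exact (hasPar_euler hy (Eventually.of_forall (hP.hasPar i))).sub (hP.hasPar i y)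
  have hGm : ∀ {i z}, z ∈ V i → bodyMap (G i) z ∈ U i := fun {i z} hz => (hG.isSuperMap i).mapsTo hz
  let w : I → SFTot ι κ := fun i => (V i).indicator (pull (G i) (euler (P.fn i) - P.fn i))
  have hw : ∀ {i z}, z ∈ V i → w i =ᶠ[𝓝 z] pull (G i) (euler (P.fn i) - P.fn i) := by
    intro i z hz
    filter_upwards [(hV.isOpen i).mem_nhds hz] with y hy using Set.indicator_of_mem hy _
  refine ⟨⟨w, fun i => contDiffOn_of_sm fun z hz => ?_, fun i j z hz => ?_,
    fun i z hz => Set.indicator_of_notMem hz _⟩, fun i z hz => ?_, fun i z => ?_⟩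
  · exact (sm_pull (hG.morAt hV hz) (hL (hGm hz))).congr (hw hz).symm
  · have hz' : bodyMap (N'.tr i j) z ∈ V j := (hV.compat i j z hz.2).1 hz.1
    have hov : bodyMap (G i) z ∈ N.ov i j := by
      rw [hN.ov_eq, mem_overSet, basePt_bodyMap (hG.base i z hz.1), ← mem_overSet, ← hN'.ov_eq]
      exact hz.2
    have hUj : bodyMap (N.tr i j) (bodyMap (G i) z) ∈ U j :=
      (hU.compat i j _ hov).1 (hGm hz.1)
    -- Compatibility of `G` with the coordinate changes lets the change on the target of `G` be
    -- performed first on EP - P, where it commutes with the Euler field.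
    rw [pull_congr (hw hz'), (hw hz.1).self_of_nhds,
      pull_pull (hN'.mor i j z hz.2) (hG.morAt hV hz') (hL (hGm hz')),
      pull_congr_left (hG.compat i j z hz),
      ← pull_pull (hG.morAt hV hz.1) (hN.mor i j _ hov) (hL hUj)]
    refine pull_congr ?_
    filter_upwards [(hU.isOpen i).mem_nhds (hGm hz.1), (hN.isOpen_ov i j).mem_nhds hov]
      with y hy hyov
    have hyj : bodyMap (N.tr i j) y ∈ U j := (hU.compat i j y hyov).1 hy
    have hc : pull (N.tr i j) (P.fn j) =ᶠ[𝓝 y] P.fn i := by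
      filter_upwards [(hU.isOpen i).mem_nhds hy, (hN.isOpen_ov i j).mem_nhds hyov] with x hx hxov
        using P.compat i j x ⟨hx, hxov⟩
    rw [pull_sub (hN.mor i j y hyov) (P.sm hU hyj).euler (P.sm hU hyj),
      ← hN.euler_pull hyov (P.sm hU hyj), Pi.sub_apply, hc.self_of_nhds]
    congr 1
    simp only [euler, Finset.sum_apply, Pi.mul_apply, (pd_congr _ hc).self_of_nhds]
  · rw [pull_congr (hw ((hF.isSuperMap i).mapsTo hz)), hinv.pull_pull hF hG hU hV hz (hL hz)]
    rfl
  · by_cases hz : z ∈ V i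
    · have h := (hw hz).self_of_nhds
      simp only
      rw [h]
      exact hasPar_zero_iff.1 (hasPar_pull (hG.morAt hV hz) (hL (hGm hz)) (hpar (hGm hz)))
    · simp only
      rw [show w i z = 0 from Set.indicator_of_notMem hz _, map_zero]

/-- Pullback along a diffeomorphism is injective. -/
theorem IsLegendre.unique (hU : N.IsOpenSub U) (hV : N'.IsOpenSub V)
    (hd : IsDiffeo N N' U V fun i => leg s (P.fn i)) {w w' : SuperFn N' V}
    (h : IsLegendre s P w) (h' : IsLegendre s P w') : w = w' := by
  obtain ⟨hF, G, hG, hinv⟩ := hd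
  refine SuperFn.eq_of_eqOn fun i z hz => ?_
  have hm := (hG.isSuperMap i).mapsTo hz
  rw [← hinv.symm.pull_pull hG hF hV hU hz (w.sm hV hz),
    ← hinv.symm.pull_pull hG hF hV hU hz (w'.sm hV hz),
    pull_congr (h.eventuallyEq hU hm), pull_congr (h'.eventuallyEq hU hm)]

/-- Pulling the identity φ^*(∂ω) = s·`sgn`·x^* back along the inverse `G` expresses the fibre
components of `G` by derivatives of ω. So any inverse is the Legendre map of the transform. -/
theorem IsLegendre.leg_eq (hs : ∀ a, s a * s a = 1) (hU : N.IsOpenSub U) (hV : N'.IsOpenSub V)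
    (hP : P.IsEven) (hF : IsBundleMap N N' U V fun i => leg s (P.fn i))
    {G : I → (ι ⊕ κ) ⊕ (κ ⊕ ι) → SFTot ι κ} (hG : IsBundleMap N' N V U G)
    (hinv : AreInverse U V (fun i => leg s (P.fn i)) G) {w : SuperFn N' V}
    (h : IsLegendre s P w) (i : I) (z : ι ⊕ κ → ℝ) (hz : z ∈ V i) (c) :
    leg (fun a => s a * sgn a) (w.fn i) c z = G i c z := by
  have hm := (hG.isSuperMap i).mapsTo hz
  rcases bas_or_fib c with ⟨a, rfl⟩ | ⟨a, rfl⟩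
  · rw [leg_bas]; exact (hG.base i z hz a).symm
  · have h1 : pull (leg s (P.fn i)) (pd (fib a) (w.fn i)) =ᶠ[𝓝 (bodyMap (G i) z)]
        (s a * sgn a) • coord (fib a) := by
      filter_upwards [(hU.isOpen i).mem_nhds hm] with y hy
      exact pull_pd_fib_legendre hs (hinv.invAt hF hG hU hV hy) (P.sm hU hy)
        (Eventually.of_forall (hP.hasPar i)) (w.sm hV ((hF.isSuperMap i).mapsTo hy))
        (h.eventuallyEq hU hy) a
    have h2 := pull_congr h1
    rw [hinv.symm.pull_pull hG hF hV hU hz ((w.sm hV hz).pd _),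
      pull_smul (hG.morAt hV hz) _ (sm_coord _), pull_coord (hG.morAt hV hz)] at h2
    rw [leg_fib, Pi.smul_apply, h2, smul_smul, mul_mul_mul_comm, hs, sgn_mul_self, one_mul,
      one_smul]

theorem IsLegendre.isBundleMap (hs : ∀ a, s a * s a = 1)
    (hU : N.IsOpenSub U) (hV : N'.IsOpenSub V) (hP : P.IsEven)
    (hd : IsDiffeo N N' U V fun i => leg s (P.fn i)) {w : SuperFn N' V} (h : IsLegendre s P w) :
    IsBundleMap N' N V U fun i => leg (fun a => s a * sgn a) (w.fn i) := by
  obtain ⟨hF, G, hG, hinv⟩ := hd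
  exact hG.congr hV (h.leg_eq hs hU hV hP hF hG hinv)

theorem IsLegendre.areInverse (hs : ∀ a, s a * s a = 1) (hU : N.IsOpenSub U)
    (hV : N'.IsOpenSub V) (hP : P.IsEven) (hd : IsDiffeo N N' U V fun i => leg s (P.fn i))
    {w : SuperFn N' V} (h : IsLegendre s P w) :
    AreInverse U V (fun i => leg s (P.fn i)) fun i => leg (fun a => s a * sgn a) (w.fn i) := by
  obtain ⟨hF, G, hG, hinv⟩ := hd
  exact hinv.congr_right hF hV (h.leg_eq hs hU hV hP hF hG hinv)

theorem IsLegendre.isDiffeo (hs : ∀ a, s a * s a = 1)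
    (hU : N.IsOpenSub U) (hV : N'.IsOpenSub V) (hP : P.IsEven)
    (hd : IsDiffeo N N' U V fun i => leg s (P.fn i)) {w : SuperFn N' V} (h : IsLegendre s P w) :
    IsDiffeo N' N V U fun i => leg (fun a => s a * sgn a) (w.fn i) :=
  ⟨h.isBundleMap hs hU hV hP hd, _, hd.1, (h.areInverse hs hU hV hP hd).symm⟩

theorem IsLegendre.invAt (hs : ∀ a, s a * s a = 1)
    (hU : N.IsOpenSub U) (hV : N'.IsOpenSub V) (hP : P.IsEven)
    (hd : IsDiffeo N N' U V fun i => leg s (P.fn i)) {w : SuperFn N' V} (h : IsLegendre s P w)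
    {i : I} {z : ι ⊕ κ → ℝ} (hz : z ∈ U i) :
    InvAt (leg s (P.fn i)) (leg (fun a => s a * sgn a) (w.fn i)) z :=
  (h.areInverse hs hU hV hP hd).invAt hd.1 (h.isBundleMap hs hU hV hP hd) hU hV hz

/-- The involutivity identity holds after pullback along `leg s P`; a further pullback along the
inverse map removes it. -/
theorem IsLegendre.symm (hs : ∀ a, s a * s a = 1)
    (hU : N.IsOpenSub U) (hV : N'.IsOpenSub V) (hP : P.IsEven)
    (hd : IsDiffeo N N' U V fun i => leg s (P.fn i)) {w : SuperFn N' V} (h : IsLegendre s P w) :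
    IsLegendre (fun a => s a * sgn a) w P := by
  intro i z hz
  have hG := h.isBundleMap hs hU hV hP hd
  have hm := (hG.isSuperMap i).mapsTo hz
  have h1 : pull (leg s (P.fn i)) (euler (w.fn i) - w.fn i)
      =ᶠ[𝓝 (bodyMap (leg (fun a => s a * sgn a) (w.fn i)) z)] P.fn i := by
    filter_upwards [(hU.isOpen i).mem_nhds hm] with y hy
    exact pull_euler_sub_legendre hs (h.invAt hs hU hV hP hd hy) (P.sm hU hy)
      (Eventually.of_forall (hP.hasPar i)) (w.sm hV ((hd.1.isSuperMap i).mapsTo hy))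
      (h.eventuallyEq hU hy)
  rw [← pull_congr h1, (h.areInverse hs hU hV hP hd).symm.pull_pull hG hd.1 hV hU hz
    ((w.sm hV hz).euler.sub (w.sm hV hz))]
  rfl

end

end Global

/-! ### The odd tangent and cotangent bundles -/

section OddBundles

open Filter Topology

variable {ι κ : Type*} [Fintype ι] [DecidableEq ι] [Fintype κ] [DecidableEq κ]
variable (M : Supermanifold.{u, v} ι κ) {i j : M.I}

theorem Supermanifold.isOpen_ov (i j : M.I) : IsOpen (M.ov i j) :=
  ((M.chart i).symm.trans (M.chart j)).open_source

theorem Supermanifold.ov_subset (i j : M.I) : M.ov i j ⊆ (M.chart i).target := by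
  intro x hx
  simp only [Supermanifold.ov, mfld_simps] at hx
  exact hx.1

theorem Supermanifold.morAt_tr {x : ι → ℝ} (hx : x ∈ M.ov i j) : MorAt (M.tr i j) x :=
  (M.tr_map i j).morAt (M.isOpen_ov i j) hx

theorem Supermanifold.bodyMap_tr_mem {x : ι → ℝ} (hx : x ∈ M.ov i j) :
    bodyMap (M.tr i j) x ∈ M.ov j i := (M.tr_map i j).mapsTo hx

theorem Supermanifold.pull_tr_tr {x : ι → ℝ} (hx : x ∈ M.ov i j) (c : ι ⊕ κ) :
    pull (M.tr i j) (M.tr j i c) x = coord c x := by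
  have hx' := M.ov_subset i j hx
  have hii : x ∈ ((M.chart i).symm.trans (M.chart i)).source := by
    simp [hx', (M.chart i).map_target hx']
  rw [M.tr_comp i j i x ⟨hx, hii⟩, M.tr_self i x hx']

/-- The inverse Jacobian `∂x^a/∂x^b` of the change of coordinates, in the old coordinates. -/
def Supermanifold.invJac (i j : M.I) (b a : ι ⊕ κ) : SF ι κ :=
  pull (M.tr i j) (pd b (M.tr j i a))

theorem Supermanifold.sm_invJac {x : ι → ℝ} (hx : x ∈ M.ov i j) (b a : ι ⊕ κ) :
    Sm (M.invJac i j b a) x :=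
  sm_pull (M.morAt_tr hx) (((M.morAt_tr (M.bodyMap_tr_mem hx)).sm a).pd b)

theorem Supermanifold.hasPar_invJac {x : ι → ℝ} (hx : x ∈ M.ov i j) (b a : ι ⊕ κ) :
    HasPar (par a + par b) (M.invJac i j b a x) := by
  refine hasPar_pull (M.morAt_tr hx) (((M.morAt_tr (M.bodyMap_tr_mem hx)).sm a).pd b) ?_
  filter_upwards [(M.morAt_tr (M.bodyMap_tr_mem hx)).eventually] with y hy using hy.hasPar_pd b a

/-- Differentiate the composite of the two coordinate changes, which is the identity in the new
coordinates, and express the result in the old ones. The order of the factors is that of the chain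
rule for left derivatives. -/
theorem Supermanifold.sum_invJac_mul_pd {x : ι → ℝ} (hx : x ∈ M.ov i j) (b c : ι ⊕ κ) :
    ∑ a, M.invJac i j b a x * pd a (M.tr i j c) x = if c = b then 1 else 0 := by
  have hm := M.morAt_tr hx
  have hx' := M.bodyMap_tr_mem hx
  have hm' := M.morAt_tr hx'
  have hinv := fun c => M.pull_tr_tr hx (c := c)
  have hback : bodyMap (M.tr j i) (bodyMap (M.tr i j) x) = x := by
    rw [← bodyMap_pull hm]
    funext d
    simp only [bodyMap, hinv, coord, body_algebraMap]
  have h1 : ∑ a, pd b (M.tr j i a) * pull (M.tr j i) (pd a (M.tr i j c))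
      =ᶠ[𝓝 (bodyMap (M.tr i j) x)] fun _ => algebraMap ℝ _ (if c = b then 1 else 0) := by
    filter_upwards [(M.isOpen_ov j i).mem_nhds hx'] with y hy
    have h2 : pull (M.tr j i) (M.tr i j c) =ᶠ[𝓝 y] coord c := by
      filter_upwards [(M.isOpen_ov j i).mem_nhds hy] with w hw using M.pull_tr_tr hw c
    have h3 := (pd_congr b h2).self_of_nhds
    rw [pd_pull (M.morAt_tr hy) ((M.morAt_tr (M.bodyMap_tr_mem hy)).sm c), pd_coord] at h3
    simp only [Finset.sum_apply, Pi.mul_apply]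
    rw [h3]
    split_ifs <;> simp
  have hs : ∀ a, Sm (pd b (M.tr j i a)) (bodyMap (M.tr i j) x) := fun a => (hm'.sm a).pd b
  have hp : ∀ a, Sm (pd a (M.tr i j c)) x := fun a => (hm.sm c).pd a
  have hs' : ∀ a, Sm (pull (M.tr j i) (pd a (M.tr i j c))) (bodyMap (M.tr i j) x) :=
    fun a => sm_pull hm' (by rw [hback]; exact hp a)
  have h4 := pull_congr (F := M.tr i j) h1
  rw [pull_sum fun a _ => (hs a).mul (hs' a), pull_algebraMap hm] at h4
  have h5 : (if c = b then 1 else 0 : Gr κ) = algebraMap ℝ _ (if c = b then 1 else 0) := by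
    split_ifs <;> simp
  rw [h5, ← h4]
  refine Finset.sum_congr rfl fun a _ => ?_
  rw [pull_mul hm (hs a) (hs' a), pull_pull hm hm' (by rw [hback]; exact hp a),
    pull_congr_left hinv, pull_coord_left]
  rfl

theorem Supermanifold.sum_lift_invJac_mul {z : ι ⊕ κ → ℝ} (hz : basePt z ∈ M.ov i j)
    (b c : ι ⊕ κ) :
    ∑ a, lift (M.invJac i j b a) z * lift (pd a (M.tr i j c)) z = if c = b then 1 else 0 := by
  have hJ : ∀ a, Sm (M.invJac i j b a) (bodyMap (proj : ι ⊕ κ → SFTot ι κ) z) := fun a => by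
    rw [bodyMap_proj]; exact M.sm_invJac hz b a
  have hA : ∀ a, Sm (pd a (M.tr i j c)) (bodyMap (proj : ι ⊕ κ → SFTot ι κ) z) := fun a => by
    rw [bodyMap_proj]; exact ((M.morAt_tr hz).sm c).pd a
  have h1 : ∑ a, M.invJac i j b a * pd a (M.tr i j c)
      =ᶠ[𝓝 (bodyMap (proj : ι ⊕ κ → SFTot ι κ) z)]
        fun _ => algebraMap ℝ _ (if c = b then 1 else 0) := by
    rw [bodyMap_proj]
    filter_upwards [(M.isOpen_ov i j).mem_nhds hz] with y hy
    simp only [Finset.sum_apply, Pi.mul_apply, M.sum_invJac_mul_pd hy]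
    split_ifs <;> simp
  have h2 := pull_congr h1
  rw [pull_sum fun a _ => (hJ a).mul (hA a), pull_algebraMap (morAt_proj z)] at h2
  have h3 : (if c = b then 1 else 0 : Gr (κ ⊕ ι)) = algebraMap ℝ _ (if c = b then 1 else 0) := by
    split_ifs <;> simp
  rw [h3, ← h2]
  refine Finset.sum_congr rfl fun a _ => ?_
  rw [pull_mul (morAt_proj z) (hJ a) (hA a)]
  rfl

variable {M}
variable {z : ι ⊕ κ → ℝ}

/-! ### Coordinate changes on the total spaces -/

theorem Supermanifold.sm_lift_tr (hz : basePt z ∈ M.ov i j) (b : ι ⊕ κ) :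
    Sm (lift (M.tr i j b)) z := sm_lift ((M.morAt_tr hz).sm b)

theorem Supermanifold.sm_lift_pd_tr (hz : basePt z ∈ M.ov i j) (a b : ι ⊕ κ) :
    Sm (lift (pd a (M.tr i j b))) z := sm_lift (((M.morAt_tr hz).sm b).pd a)

theorem Supermanifold.sm_lift_invJac (hz : basePt z ∈ M.ov i j) (a b : ι ⊕ κ) :
    Sm (lift (M.invJac i j b a)) z := sm_lift (M.sm_invJac hz b a)

theorem Supermanifold.hasPar_lift_tr (hz : basePt z ∈ M.ov i j) (b : ι ⊕ κ) :
    HasPar (par b) (lift (M.tr i j b) z) :=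
  hasPar_lift ((M.morAt_tr hz).sm b) ((M.morAt_tr hz).parity.mono fun _ h => h b)

theorem Supermanifold.hasPar_lift_pd_tr (hz : basePt z ∈ M.ov i j) (a b : ι ⊕ κ) :
    HasPar (par b + par a) (lift (pd a (M.tr i j b)) z) :=
  hasPar_lift (((M.morAt_tr hz).sm b).pd a)
    ((M.morAt_tr hz).eventually.mono fun _ h => h.hasPar_pd a b)

theorem Supermanifold.hasPar_lift_invJac (hz : basePt z ∈ M.ov i j) (a b : ι ⊕ κ) :
    HasPar (par a + par b) (lift (M.invJac i j b a) z) := by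
  refine hasPar_lift (M.sm_invJac hz b a) ?_
  filter_upwards [(M.isOpen_ov i j).mem_nhds hz] with y hy using M.hasPar_invJac hy b a

theorem Supermanifold.PiT_tr_bas (b : ι ⊕ κ) : M.PiT.tr i j (bas b) = lift (M.tr i j b) := by
  cases b <;> rfl

theorem Supermanifold.PiT_tr_fib (b : ι ⊕ κ) : M.PiT.tr i j (fib b) =
    ∑ a, coord (fib a) * lift (pd a (M.tr i j b)) := by
  cases b <;> rfl

theorem Supermanifold.PiTstar_tr_bas (b : ι ⊕ κ) :
    M.PiTstar.tr i j (bas b) = lift (M.tr i j b) := by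
  cases b <;> rfl

theorem Supermanifold.PiTstar_tr_fib (b : ι ⊕ κ) : M.PiTstar.tr i j (fib b) =
    ∑ a, lift (M.invJac i j b a) * coord (fib a) := by
  cases b <;> rfl

theorem pd_fib_coord_fib (a b : ι ⊕ κ) :
    pd (fib a) (coord (fib b) : SFTot ι κ) z = if b = a then 1 else 0 := by
  rw [pd_coord]
  by_cases h : b = a
  · simp [h]
  · rw [if_neg (fun h' => h (fib_injective h')), if_neg h]

theorem Supermanifold.pd_fib_PiT_tr_fib (hz : basePt z ∈ M.ov i j) (a b : ι ⊕ κ) :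
    pd (fib a) (M.PiT.tr i j (fib b)) z = lift (pd a (M.tr i j b)) z := by
  rw [M.PiT_tr_fib, pd_sum _ fun c _ =>
    ((sm_coord _).mul (M.sm_lift_pd_tr hz c b)).differentiableAt]
  have h : ∀ c, pd (fib a) (coord (fib c) * lift (pd c (M.tr i j b))) z =
      (if c = a then 1 else 0) * lift (pd c (M.tr i j b)) z := fun c => by
    rw [pd_mul_of_hasPar _ (sm_coord _).differentiableAt
      (M.sm_lift_pd_tr hz c b).differentiableAt (hasPar_coord_fib c),
      pd_fib_lift (((M.morAt_tr hz).sm b).pd c), mul_zero, smul_zero, add_zero, pd_fib_coord_fib]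
  simp only [h, ite_mul, one_mul, zero_mul, Finset.sum_ite_eq', Finset.mem_univ, if_true]

/-- Here the Jacobian stands to the left of the fibre coordinate, so the left derivative has to pass
it and picks up a sign. On `PiT` the fibre coordinate comes first and there is none. -/
theorem Supermanifold.pd_fib_PiTstar_tr_fib (hz : basePt z ∈ M.ov i j) (a b : ι ⊕ κ) :
    pd (fib a) (M.PiTstar.tr i j (fib b)) z =
      (-1 : ℝ) ^ (par (fib a) * (par a + par b)) • lift (M.invJac i j b a) z := by
  rw [M.PiTstar_tr_fib, pd_sum _ fun c _ =>
    ((M.sm_lift_invJac hz c b).mul (sm_coord _)).differentiableAt, Finset.sum_eq_single a]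
  · rw [pd_mul_of_hasPar _ (M.sm_lift_invJac hz a b).differentiableAt
      (sm_coord _).differentiableAt (M.hasPar_lift_invJac hz a b),
      pd_fib_lift (M.sm_invJac hz b a), zero_mul, zero_add, pd_fib_coord_fib, if_pos rfl, mul_one]
  · intro c _ hc
    rw [pd_mul_of_hasPar _ (M.sm_lift_invJac hz c b).differentiableAt
      (sm_coord _).differentiableAt (M.hasPar_lift_invJac hz c b),
      pd_fib_lift (M.sm_invJac hz b c), zero_mul, zero_add, pd_fib_coord_fib, if_neg hc, mul_zero,
      smul_zero]
  · simp

theorem euler_lift {f : SF ι κ} (hf : Sm f (basePt z)) : euler (lift f) z = 0 := by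
  simp [euler, pd_fib_lift hf]

variable (M)

theorem Supermanifold.isFibLinear_PiT : IsFibLinear M.PiT M.ov where
  ov_eq _ _ := rfl
  isOpen := M.isOpen_ov
  mor i j z hz :=
    { sm := forall_tot (fun b => by rw [M.PiT_tr_bas]; exact M.sm_lift_tr hz b)
        (fun b => by
          rw [M.PiT_tr_fib]
          exact sm_sum fun a _ => (sm_coord _).mul (M.sm_lift_pd_tr hz a b))
      parity := by
        filter_upwards [(isOpen_overSet (M.isOpen_ov i j)).mem_nhds hz] with w hw
        refine forall_tot (fun b => ?_) (fun b => ?_)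
        · rw [M.PiT_tr_bas, par_bas]; exact M.hasPar_lift_tr hw b
        · rw [M.PiT_tr_fib, hasPar_fib_iff, Finset.sum_apply]
          refine HasPar.sum fun a _ => hasPar_of_even_add ?_
            ((hasPar_coord_fib a).mul (M.hasPar_lift_pd_tr hw a b))
          exact ⟨par a + par b + 1, by ring⟩ }
  euler_bas i j z hz b := by rw [M.PiT_tr_bas]; exact euler_lift ((M.morAt_tr hz).sm b)
  euler_fib i j z hz b := by
    rw [euler, Finset.sum_apply]
    simp only [Pi.mul_apply, M.pd_fib_PiT_tr_fib hz]
    rw [M.PiT_tr_fib, Finset.sum_apply]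
    rfl

theorem Supermanifold.isFibLinear_PiTstar : IsFibLinear M.PiTstar M.ov where
  ov_eq _ _ := rfl
  isOpen := M.isOpen_ov
  mor i j z hz :=
    { sm := forall_tot (fun b => by rw [M.PiTstar_tr_bas]; exact M.sm_lift_tr hz b)
        (fun b => by
          rw [M.PiTstar_tr_fib]
          exact sm_sum fun a _ => (M.sm_lift_invJac hz a b).mul (sm_coord _))
      parity := by
        filter_upwards [(isOpen_overSet (M.isOpen_ov i j)).mem_nhds hz] with w hw
        refine forall_tot (fun b => ?_) (fun b => ?_)
        · rw [M.PiTstar_tr_bas, par_bas]; exact M.hasPar_lift_tr hw b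
        · rw [M.PiTstar_tr_fib, hasPar_fib_iff, Finset.sum_apply]
          refine HasPar.sum fun a _ => hasPar_of_even_add ?_
            ((M.hasPar_lift_invJac hw a b).mul (hasPar_coord_fib a))
          exact ⟨par a + par b + 1, by ring⟩ }
  euler_bas i j z hz b := by rw [M.PiTstar_tr_bas]; exact euler_lift ((M.morAt_tr hz).sm b)
  euler_fib i j z hz b := by
    rw [euler, Finset.sum_apply, M.PiTstar_tr_fib, Finset.sum_apply]
    refine Finset.sum_congr rfl fun a _ => ?_
    -- The sign of the derivative and the sign of restoring the order of the factors are equal and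
    -- square to 1.
    rw [Pi.mul_apply, ← M.PiTstar_tr_fib, M.pd_fib_PiTstar_tr_fib hz, mul_smul_comm, Pi.mul_apply,
      (parityInv_coord (z := z) (fib a)).mul_comm (M.hasPar_lift_invJac hz a b), smul_smul,
      ← mul_pow]
    simp

/-! ### Chart independence of φ and ψ -/

variable {M} {U V : M.I → Set (ι ⊕ κ → ℝ)}

theorem isSuperMap_leg {N : Gluing M.I (ι ⊕ κ) (κ ⊕ ι)} (hU : N.IsOpenSub U)
    (hdom : N.dom = fun i => overSet (M.chart i).target) {P : SuperFn N U} (hP : P.IsEven)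
    (s : ι ⊕ κ → ℝ) (i : M.I) :
    IsSuperMap (U i) (overSet (M.chart i).target) (leg s (P.fn i)) where
  smooth c := contDiffOn_of_sm fun z hz =>
    (morAt_leg s (P.sm hU hz) (Eventually.of_forall (hP.hasPar i))).sm c
  parity c z hz :=
    (morAt_leg s (P.sm hU hz) (Eventually.of_forall (hP.hasPar i))).parity.self_of_nhds c
  mapsTo z hz := by
    rw [mem_overSet, basePt_bodyMap fun a => by rw [leg_bas], ← mem_overSet]
    have h := hU.subset i hz
    rwa [hdom] at h

/-- By the chain rule the fibre derivatives of `P` transform with the inverse Jacobian, which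
cancels the Jacobian in the law for dx^a. The factor (-1)^{ã+1} in φ is what makes the total sign
independent of the summation index `a`, so that the contraction can be carried out. -/
theorem isBundleMap_phi (hU : M.PiTstar.IsOpenSub U) {P : SuperFn M.PiTstar U} (hP : P.IsEven) :
    IsBundleMap M.PiTstar M.PiT U M.PiT.dom fun i => phi (P.fn i) where
  isSuperMap := isSuperMap_leg hU rfl hP sgn
  base i z _ a := by rw [phi_eq_leg, leg_bas]
  compat i j z hz := by
    obtain ⟨hzU, hzo⟩ := hz
    have hb : basePt z ∈ M.ov i j := hzo
    have hT := M.isFibLinear_PiTstar.mor i j z hzo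
    have hzj : bodyMap (M.PiTstar.tr i j) z ∈ U j := (hU.compat i j z hzo).1 hzU
    have hPj := P.sm hU hzj
    have hPi := P.sm hU hzU
    have he : ∀ i z, ∀ᶠ x in 𝓝 z, HasPar 0 (P.fn i x) :=
      fun i z => Eventually.of_forall (hP.hasPar i)
    have hm : MorAt (leg sgn (P.fn i)) z := morAt_leg sgn hPi (he i z)
    have hbas : ∀ a, leg sgn (P.fn i) (bas a) z = coord (bas a) z := fun a => by rw [leg_bas]
    have hb' : basePt (bodyMap (leg sgn (P.fn i)) z) ∈ M.ov i j := by rwa [basePt_bodyMap hbas]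
    simp only [phi_eq_leg]
    refine forall_tot (fun b => ?_) (fun c => ?_)
    · rw [leg_bas, pull_coord hT, M.PiTstar_tr_bas, M.PiT_tr_bas,
        pull_lift hm hbas ((M.morAt_tr hb).sm b)]
    · have hloc : pull (M.PiTstar.tr i j) (P.fn j) =ᶠ[𝓝 z] P.fn i := by
        filter_upwards [(hU.isOpen i).mem_nhds hzU,
          (M.isFibLinear_PiTstar.isOpen_ov i j).mem_nhds hzo] with y hy hyo
          using P.compat i j y ⟨hy, hyo⟩
      set D : ι ⊕ κ → Gr (κ ⊕ ι) := fun b => pull (M.PiTstar.tr i j) (pd (fib b) (P.fn j)) z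
        with hD
      have hDpar : ∀ b, HasPar (par b + 1) (D b) := fun b =>
        hasPar_pull hT (hPj.pd _) (hPj.eventually.mono fun y hy => hasPar_pd_fib hy (he j y) b)
      have hpd : ∀ a, pd (fib a) (P.fn i) z = ∑ b,
          (-1 : ℝ) ^ (par (fib a) * (par a + par b)) • (lift (M.invJac i j b a) z * D b) := by
        intro a
        rw [← (pd_congr (fib a) hloc).self_of_nhds, pd_pull hT hPj, sum_tot, Finset.sum_eq_zero,
          zero_add]
        · refine Finset.sum_congr rfl fun b _ => ?_
          rw [M.pd_fib_PiTstar_tr_fib hb, smul_mul_assoc]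
        · intro b _
          rw [M.PiTstar_tr_bas, pd_fib_lift ((M.morAt_tr hb).sm b), zero_mul]
      rw [leg_fib, pull_smul hT _ (hPj.pd _), M.PiT_tr_fib,
        pull_sum fun a _ => (sm_coord _).mul (M.sm_lift_pd_tr hb' a c)]
      have hterm : ∀ a, pull (leg sgn (P.fn i)) (coord (fib a) * lift (pd a (M.tr i j c))) z =
          ∑ b, (-1 : ℝ) ^ ((par b + 1) * (par c + 1)) •
            ((lift (M.invJac i j b a) z * lift (pd a (M.tr i j c)) z) * D b) := by
        intro a
        rw [pull_mul hm (sm_coord _) (M.sm_lift_pd_tr hb' a c), pull_coord hm,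
          pull_lift hm hbas (((M.morAt_tr hb).sm c).pd a), leg_fib, Pi.smul_apply, hpd,
          Finset.smul_sum, Finset.sum_mul]
        refine Finset.sum_congr rfl fun b _ => ?_
        rw [smul_smul, smul_mul_assoc, mul_assoc, (hDpar b).mul_comm (M.hasPar_lift_pd_tr hb a c),
          mul_smul_comm, smul_smul, ← mul_assoc (lift _ _)]
        congr 1
        -- Modulo 2 the exponents satisfy (ã+1) + (ã+1)(ã+b̃) + (b̃+1)(c̃+ã) = (b̃+1)(c̃+1); the
        -- eight parity cases are checked one by one.
        rcases a with a | a <;> rcases b with b | b <;> rcases c with c | c <;>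
          norm_num [par, fib, sgn]
      simp only [hterm]
      rw [Finset.sum_comm]
      simp only [← Finset.smul_sum, ← Finset.sum_mul, M.sum_lift_invJac_mul hb, ite_mul, one_mul,
        zero_mul, smul_ite, smul_zero, Finset.sum_ite_eq, Finset.mem_univ, if_true]
      rw [hD]
      congr 1
      rcases c with c | c <;> norm_num [par, sgn]

/-- The same contraction as for φ, now without signs: in the law for dx^b the factor dx^a stands on
the left, so left derivatives bring out the bare Jacobian. -/
theorem isBundleMap_psi (hV : M.PiT.IsOpenSub V) {w : SuperFn M.PiT V} (hw : w.IsEven) :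
    IsBundleMap M.PiT M.PiTstar V M.PiTstar.dom fun i => psi (w.fn i) where
  isSuperMap i := by rw [psi_eq_leg]; exact isSuperMap_leg hV rfl hw 1 i
  base i z _ a := by rw [psi_eq_leg, leg_bas]
  compat i j z hz := by
    obtain ⟨hzV, hzo⟩ := hz
    have hb : basePt z ∈ M.ov i j := hzo
    have hT := M.isFibLinear_PiT.mor i j z hzo
    have hzj : bodyMap (M.PiT.tr i j) z ∈ V j := (hV.compat i j z hzo).1 hzV
    have hwj := w.sm hV hzj
    have hm : MorAt (leg 1 (w.fn i)) z :=
      morAt_leg 1 (w.sm hV hzV) (Eventually.of_forall (hw.hasPar i))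
    have hbas : ∀ a, leg 1 (w.fn i) (bas a) z = coord (bas a) z := fun a => by rw [leg_bas]
    have hb' : basePt (bodyMap (leg 1 (w.fn i)) z) ∈ M.ov i j := by rwa [basePt_bodyMap hbas]
    simp only [psi_eq_leg]
    refine forall_tot (fun b => ?_) (fun c => ?_)
    · rw [leg_bas, pull_coord hT, M.PiTstar_tr_bas, M.PiT_tr_bas,
        pull_lift hm hbas ((M.morAt_tr hb).sm b)]
    · have hloc : pull (M.PiT.tr i j) (w.fn j) =ᶠ[𝓝 z] w.fn i := by
        filter_upwards [(hV.isOpen i).mem_nhds hzV,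
          (M.isFibLinear_PiT.isOpen_ov i j).mem_nhds hzo] with y hy hyo
          using w.compat i j y ⟨hy, hyo⟩
      have hpd : ∀ a, pd (fib a) (w.fn i) z = ∑ b, lift (pd a (M.tr i j b)) z *
          pull (M.PiT.tr i j) (pd (fib b) (w.fn j)) z := by
        intro a
        rw [← (pd_congr (fib a) hloc).self_of_nhds, pd_pull hT hwj, sum_tot, Finset.sum_eq_zero,
          zero_add]
        · refine Finset.sum_congr rfl fun b _ => ?_
          rw [M.pd_fib_PiT_tr_fib hb]
        · intro b _
          rw [M.PiT_tr_bas, pd_fib_lift ((M.morAt_tr hb).sm b), zero_mul]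
      rw [leg_fib, Pi.one_apply, one_smul, M.PiTstar_tr_fib,
        pull_sum fun a _ => (M.sm_lift_invJac hb' a c).mul (sm_coord _)]
      have hterm : ∀ a, pull (leg 1 (w.fn i)) (lift (M.invJac i j c a) * coord (fib a)) z =
          ∑ b, (lift (M.invJac i j c a) z * lift (pd a (M.tr i j b)) z) *
            pull (M.PiT.tr i j) (pd (fib b) (w.fn j)) z := by
        intro a
        rw [pull_mul hm (M.sm_lift_invJac hb' a c) (sm_coord _), pull_coord hm,
          pull_lift hm hbas (M.sm_invJac hb c a), leg_fib, Pi.one_apply, one_smul, hpd,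
          Finset.mul_sum]
        exact Finset.sum_congr rfl fun b _ => (mul_assoc _ _ _).symm
      simp only [hterm]
      rw [Finset.sum_comm]
      simp only [← Finset.sum_mul, M.sum_lift_invJac_mul hb, ite_mul, one_mul,
        zero_mul, Finset.sum_ite_eq', Finset.mem_univ, if_true]

end OddBundles

/-! ### The correspondence -/

section Correspondence

open Filter Topology

variable {ι κ : Type*} [Fintype ι] [DecidableEq ι] [Fintype κ] [DecidableEq κ]
variable {M : Supermanifold.{u, v} ι κ} {U V : M.I → Set (ι ⊕ κ → ℝ)}

/-- This puts ψ in the form s·`sgn` with s = `sgn`, as the general inversion lemmas produce it;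
`phi_eq_leg_one` does the same for φ with s = 1. -/
theorem psi_eq_leg_sgn (w : SFTot ι κ) : psi w = leg (fun a => sgn a * sgn a) w := by
  rw [psi_eq_leg]
  congr 1
  funext a
  exact (sgn_mul_self a).symm

theorem phi_eq_leg_one (P : SFTot ι κ) :
    phi P = leg (fun a => (1 : ι ⊕ κ → ℝ) a * sgn a) P := by
  simp only [Pi.one_apply, one_mul]
  rfl

theorem isLegendre_one_iff {P : SuperFn M.PiTstar U} {w : SuperFn M.PiT V} :
    IsLegendre 1 w P ↔ IsLegendreOfForm w P := by
  simp only [IsLegendre, IsLegendreOfForm, psi_eq_leg]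

theorem Sm.deRham {w : SFTot ι κ} {z : ι ⊕ κ → ℝ} (hw : Sm w z) : Sm (deRham w) z :=
  sm_sum fun _ _ => (sm_coord _).mul (hw.pd _)

section Mult

variable {P : SuperFn M.PiTstar U} {w : SuperFn M.PiT V}

theorem IsLegendreOfMult.isDiffeo_psi (hU : M.PiTstar.IsOpenSub U) (hV : M.PiT.IsOpenSub V)
    (h : IsLegendreOfMult P w) (hP : P.IsEven)
    (hd : IsDiffeo M.PiTstar M.PiT U V fun i => phi (P.fn i)) :
    IsDiffeo M.PiT M.PiTstar V U fun i => psi (w.fn i) := by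
  simp only [psi_eq_leg_sgn]
  exact IsLegendre.isDiffeo sgn_mul_self hU hV hP hd h

theorem IsLegendreOfMult.areInverse (hU : M.PiTstar.IsOpenSub U) (hV : M.PiT.IsOpenSub V)
    (h : IsLegendreOfMult P w) (hP : P.IsEven)
    (hd : IsDiffeo M.PiTstar M.PiT U V fun i => phi (P.fn i)) :
    AreInverse U V (fun i => phi (P.fn i)) fun i => psi (w.fn i) := by
  simp only [psi_eq_leg_sgn]
  exact IsLegendre.areInverse sgn_mul_self hU hV hP hd h

theorem IsLegendreOfMult.ofForm (hU : M.PiTstar.IsOpenSub U) (hV : M.PiT.IsOpenSub V)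
    (h : IsLegendreOfMult P w) (hP : P.IsEven)
    (hd : IsDiffeo M.PiTstar M.PiT U V fun i => phi (P.fn i)) : IsLegendreOfForm w P := by
  have h1 := IsLegendre.symm sgn_mul_self hU hV hP hd h
  simpa only [IsLegendre, IsLegendreOfForm, psi_eq_leg_sgn] using h1

theorem IsLegendreOfForm.isDiffeo_phi (hU : M.PiTstar.IsOpenSub U) (hV : M.PiT.IsOpenSub V)
    (h : IsLegendreOfForm w P) (hw : w.IsEven)
    (hd : IsDiffeo M.PiT M.PiTstar V U fun i => psi (w.fn i)) :
    IsDiffeo M.PiTstar M.PiT U V fun i => phi (P.fn i) := by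
  simp only [psi_eq_leg] at hd
  simp only [phi_eq_leg_one]
  exact IsLegendre.isDiffeo (by simp) hV hU hw hd (isLegendre_one_iff.2 h)

theorem IsLegendreOfForm.ofMult (hU : M.PiTstar.IsOpenSub U) (hV : M.PiT.IsOpenSub V)
    (h : IsLegendreOfForm w P) (hw : w.IsEven)
    (hd : IsDiffeo M.PiT M.PiTstar V U fun i => psi (w.fn i)) : IsLegendreOfMult P w := by
  simp only [psi_eq_leg] at hd
  have h1 := IsLegendre.symm (by simp) hV hU hw hd (isLegendre_one_iff.2 h)
  simpa only [IsLegendre, IsLegendreOfMult, phi_eq_leg_one] using h1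

theorem IsLegendreOfForm.unique (hU : M.PiTstar.IsOpenSub U) (hV : M.PiT.IsOpenSub V)
    (hd : IsDiffeo M.PiT M.PiTstar V U fun i => psi (w.fn i)) {P' : SuperFn M.PiTstar U}
    (h : IsLegendreOfForm w P) (h' : IsLegendreOfForm w P') : P = P' := by
  simp only [psi_eq_leg] at hd
  exact IsLegendre.unique hV hU hd (isLegendre_one_iff.2 h) (isLegendre_one_iff.2 h')

/-- The Legendre transform is closed if and only if the multivector field is Poisson. -/
theorem IsLegendreOfMult.deRham_eq_zero_iff (hU : M.PiTstar.IsOpenSub U)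
    (hV : M.PiT.IsOpenSub V) (h : IsLegendreOfMult P w) (hP : P.IsEven)
    (hd : IsDiffeo M.PiTstar M.PiT U V fun i => phi (P.fn i)) :
    (∀ i, ∀ z ∈ V i, deRham (w.fn i) z = 0) ↔
      ∀ i, ∀ z ∈ U i, schouten (P.fn i) (P.fn i) z = 0 := by
  have hinv := h.areInverse hU hV hP hd
  have hpsi := (h.isDiffeo_psi hU hV hP hd).1
  have hmaps : ∀ {i z}, z ∈ U i → bodyMap (phi (P.fn i)) z ∈ V i :=
    fun {i z} hz => (hd.1.isSuperMap i).mapsTo hz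
  have key : ∀ i, ∀ z ∈ U i, (2 : ℝ) • pull (phi (P.fn i)) (deRham (w.fn i)) z =
      -schouten (P.fn i) (P.fn i) z := fun i z hz =>
    two_smul_pull_deRham (hinv.invAt hd.1 hpsi hU hV hz) (P.sm hU hz) (hP.hasPar i)
      (w.sm hV (hmaps hz)) (IsLegendre.eventuallyEq (s := sgn) h hU hz)
  constructor
  · intro hw i z hz
    have h1 : deRham (w.fn i) =ᶠ[𝓝 (bodyMap (phi (P.fn i)) z)] 0 := by
      filter_upwards [(hV.isOpen i).mem_nhds (hmaps hz)] with y hy using hw i y hy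
    have h2 := key i z hz
    rwa [pull_congr h1, pull_zero, smul_zero, zero_eq_neg] at h2
  -- The identity only controls dω after pullback along φ, so vanishing on `V` is recovered by
  -- pulling back along ψ, the inverse.
  · intro hs i z hz
    have hm := (hpsi.isSuperMap i).mapsTo hz
    have h1 : pull (phi (P.fn i)) (deRham (w.fn i)) =ᶠ[𝓝 (bodyMap (psi (w.fn i)) z)] 0 := by
      filter_upwards [(hU.isOpen i).mem_nhds hm] with y hy
      have h2 := key i y hy
      rw [hs i y hy, neg_zero] at h2
      exact (smul_eq_zero.1 h2).resolve_left two_ne_zero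
    rw [← hinv.symm.pull_pull hpsi hd.1 hV hU hz (w.sm hV hz).deRham, pull_congr h1, pull_zero]

end Mult

theorem exists_isLegendreOfMult (hU : M.PiTstar.IsOpenSub U) (hV : M.PiT.IsOpenSub V)
    {P : SuperFn M.PiTstar U} (hP : P.IsEven)
    (hd : IsDiffeo M.PiTstar M.PiT U V fun i => phi (P.fn i)) :
    ∃ w : SuperFn M.PiT V, IsLegendreOfMult P w ∧ w.IsEven :=
  exists_isLegendre (s := sgn) M.isFibLinear_PiTstar M.isFibLinear_PiT hU hV hP hd

theorem exists_isLegendreOfForm (hU : M.PiTstar.IsOpenSub U) (hV : M.PiT.IsOpenSub V)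
    {w : SuperFn M.PiT V} (hw : w.IsEven)
    (hd : IsDiffeo M.PiT M.PiTstar V U fun i => psi (w.fn i)) :
    ∃ P : SuperFn M.PiTstar U, IsLegendreOfForm w P ∧ P.IsEven := by
  simp only [psi_eq_leg] at hd
  obtain ⟨P, h, hP⟩ := exists_isLegendre M.isFibLinear_PiT M.isFibLinear_PiTstar hV hU hw hd
  exact ⟨P, isLegendre_one_iff.1 h, hP⟩

/-- The transform of a multivector field lands in the closed forms by the identity for dω.
Injectivity is uniqueness of the reverse transform, surjectivity its existence, since being the
transform of one another is a symmetric relation here. -/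
theorem exists_legendre_equiv (hU : M.PiTstar.IsOpenSub U) (hV : M.PiT.IsOpenSub V) :
    ∃ e : NondegPoisson M U V ≃ GenSymplectic M U V,
      ∀ (P : NondegPoisson M U V) (w : GenSymplectic M U V),
        (e P = w ↔ IsLegendreOfMult P.1 w.1) ∧ (e P = w ↔ IsLegendreOfForm w.1 P.1) := by
  have hex : ∀ P : NondegPoisson M U V, ∃ w : GenSymplectic M U V, IsLegendreOfMult P.1 w.1 := by
    rintro ⟨P, hP, hs, hd⟩
    obtain ⟨w, hw, he⟩ := exists_isLegendreOfMult hU hV hP hd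
    exact ⟨⟨w, he, (hw.deRham_eq_zero_iff hU hV hP hd).2 hs, hw.isDiffeo_psi hU hV hP hd⟩, hw⟩
  choose f hf using hex
  have hiff : ∀ (P : NondegPoisson M U V) (w : GenSymplectic M U V),
      IsLegendreOfMult P.1 w.1 ↔ IsLegendreOfForm w.1 P.1 := fun P w =>
    ⟨fun h => h.ofForm hU hV P.2.1 P.2.2.2, fun h => h.ofMult hU hV w.2.1 w.2.2.2⟩
  have hfw : ∀ (P : NondegPoisson M U V) (w : GenSymplectic M U V),
      f P = w ↔ IsLegendreOfMult P.1 w.1 := fun P w =>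
    ⟨fun h => h ▸ hf P, fun h =>
      Subtype.ext (IsLegendre.unique (s := sgn) hU hV P.2.2.2 (hf P) h)⟩
  have hbij : Function.Bijective f := by
    refine ⟨fun P P' h => Subtype.ext ?_, ?_⟩
    · exact IsLegendreOfForm.unique hU hV (f P').2.2.2 ((hiff P (f P')).1 (h ▸ hf P))
        ((hiff P' (f P')).1 (hf P'))
    · rintro ⟨w, hw, hdw, hd⟩
      obtain ⟨P, hP, he⟩ := exists_isLegendreOfForm hU hV hw hd
      have hdP := hP.isDiffeo_phi hU hV hw hd
      have hM := hP.ofMult hU hV hw hd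
      exact ⟨⟨P, he, (hM.deRham_eq_zero_iff hU hV he hdP).1 hdw, hdP⟩, (hfw _ _).2 hM⟩
  exact ⟨Equiv.ofBijective f hbij, fun P w => ⟨hfw P w, (hfw P w).trans (hiff P w)⟩⟩

end Correspondence
end SuperGeom

end

open SuperGeom
theorem proposition2 {ι κ : Type*} [Fintype ι] [DecidableEq ι] [Fintype κ] [DecidableEq κ]
    (M : Supermanifold ι κ) (U V : M.I → Set (ι ⊕ κ → ℝ))
    (hU : M.PiTstar.IsOpenSub U) (hV : M.PiT.IsOpenSub V) :
    -- `φ_P` and `ψ_ω` are well defined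
    (∀ P : SuperFn M.PiTstar U, P.IsEven →
      IsBundleMap M.PiTstar M.PiT U M.PiT.dom (fun i => phi (P.fn i))) ∧
    (∀ w : SuperFn M.PiT V, w.IsEven →
      IsBundleMap M.PiT M.PiTstar V M.PiTstar.dom (fun i => psi (w.fn i))) ∧
    -- the Legendre transform of `P` exists, is unique and even, defines the inverse map, and
    -- `P` is recovered as its Legendre transform
    (∀ P : SuperFn M.PiTstar U, P.IsEven →
      IsDiffeo M.PiTstar M.PiT U V (fun i => phi (P.fn i)) →
      ∃ w : SuperFn M.PiT V, IsLegendreOfMult P w ∧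
        (∀ w' : SuperFn M.PiT V, IsLegendreOfMult P w' → w' = w) ∧
        w.IsEven ∧
        IsBundleMap M.PiT M.PiTstar V U (fun i => psi (w.fn i)) ∧
        AreInverse U V (fun i => phi (P.fn i)) (fun i => psi (w.fn i)) ∧
        IsLegendreOfForm w P ∧
        (∀ P' : SuperFn M.PiTstar U, IsLegendreOfForm w P' → P' = P)) ∧
    -- the one-to-one correspondence, given by the mutually inverse Legendre transforms
    (∃ e : NondegPoisson M U V ≃ GenSymplectic M U V,
      ∀ (P : NondegPoisson M U V) (w : GenSymplectic M U V),
        (e P = w ↔ IsLegendreOfMult P.1 w.1) ∧ (e P = w ↔ IsLegendreOfForm w.1 P.1)) := by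
  refine ⟨fun P hP => isBundleMap_phi hU hP, fun w hw => isBundleMap_psi hV hw,
    fun P hP hd => ?_, exists_legendre_equiv hU hV⟩
  obtain ⟨w, hw, he⟩ := exists_isLegendreOfMult hU hV hP hd
  have hpsi := hw.isDiffeo_psi hU hV hP hd
  have hform := hw.ofForm hU hV hP hd
  exact ⟨w, hw, fun w' hw' => IsLegendre.unique (s := sgn) hU hV hd hw' hw, he, hpsi.1,
    hw.areInverse hU hV hP hd, hform, fun P' hP' => hP'.unique hU hV hpsi hform⟩
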